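/- All rings are commutative with $1$. For an ideal $I$ of a ring $R$ and $n\ge 3$: $\mathrm{Um}_n(R,I)$ is the set of unimodular rows of length $n$ over $R$ that are congruent to $e_1=(1,0,\dots,0)$ modulo $I$; $\mathrm{SL}_n(R,I)$ is the group of matrices of determinant $1$ congruent to the identity modulo $I$; $\mathrm E_n(R)$ is the group generated by the elementary matrices $E_{ij}(x)$ ($i\ne j$, $x\in R$), $\mathrm E_n(R,I)$ is the normal closure in $\mathrm E_n(R)$ of the $E_{ij}(x)$ with $i \neq j$, $x\in I$, and $\mathrm E(R,I)=\bigcup_n \mathrm E_n(R,I)$, where $\alpha$ is identified with $\alpha\perp 1$. Put $\mathrm{MSE}_n(R,I)=\mathrm{Um}_n(R,I)/\mathrm E_n(R,I)$ and $\mathrm{MSE}_n(R)=\mathrm{MSE}_n(R,R)$. Let $\mathbb Z\oplus I$ be the excision ring, with $(m,i)(n,j)=(mn,\,mj+ni+ij)$, and let $F:\mathrm{MSE}_3(\mathbb Z\oplus I,0\oplus I)\to \mathrm{MSE}_3(R,I)$ and $G:\mathrm{MSE}_3(\mathbb Z\oplus I,0\oplus I)\to \mathrm{MSE}_3(\mathbb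 Z\oplus I)$ be the maps induced by $(m,i)\mapsto m+i$ and by the identity. For a ring $A$, let $W_E(A)$ be the set of alternating matrices of even size and Pfaffian $1$ over $A$, two such matrices $\varphi,\varphi'$ being identified if $\varphi\perp\psi_k=\varepsilon^t(\varphi'\perp\psi_l)\varepsilon$ for some $k,l\ge 0$ and some $\varepsilon\in\mathrm E_N(A)$, where $N$ is the common size of both sides and $\psi_k$ is the orthogonal sum of $k$ copies of $\begin{pmatrix}0&1\\-1&0\end{pmatrix}$; the operation on $W_E(A)$ is induced by $\perp$. Theorem. Let $R$ be a commutative ring of Krull dimension $3$ and $I$ an ideal of $R$ such that $\mathrm{SL}_4(R,I)\cap \mathrm E(R,I)=\mathrm E_4(R,I)$. Then $F$ and $G$ are bijective, and $\mathrm{MSE}_3(R,I)$ has the structure of an abelian group with the following two properties, in which $\mathrm{MSE}_3(R,I)$ is identified with $\mathrm{MSE}_3(\mathbb Z\oplus I)$ through $G\circ F^{-1}$. (1) It is given by the Vaserstein–van der Kallen rule: if $v=(a,a_2,a_3)$ and $w=(b,a_2,a_3)$ are unimodular rows over $\mathbb Z\oplus I$ and $p\in\mathbb Z\oplus I$ satisfies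 $ap\equiv 1 \pmod{(a_2,a_3)}$, then $$[w]*[v]=[(a(b+p)-1,\;a_2(b+p),\;a_3)].$$ (2) It is the Witt group structure: the Vaserstein symbol, which sends the class of a unimodular row $(a_1,a_2,a_3)$ over $\mathbb Z\oplus I$ with $a_1b_1+a_2b_2+a_3b_3=1$ to the class of $$\begin{pmatrix}0&a_1&a_2&a_3\\-a_1&0&b_3&-b_2\\-a_2&-b_3&0&b_1\\-a_3&b_2&-b_1&0\end{pmatrix},$$ is a well-defined isomorphism of groups from $\mathrm{MSE}_3(R,I)$ onto $W_E(\mathbb Z\oplus I)$. -/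

import Mathlib

open Matrix

namespace WittOrbit

universe u v

section Elementary

variable {R : Type u} [CommRing R] {S : Type v} [CommRing S]

/-- The elementary group `E_n(R)`, generated by the matrices `E_{ij}(x)`, `i ≠ j`, `x ∈ R`. -/
def Elem (n : ℕ) (R : Type u) [CommRing R] : Subgroup (SpecialLinearGroup (Fin n) R) :=
  Subgroup.closure {g | ∃ (i j : Fin n) (hij : i ≠ j) (x : R),
    g = SpecialLinearGroup.transvection hij x}

/-- The relative elementary group `E_n(R, I)`: the normal closure in `E_n(R)` of the matrices
`E_{ij}(x)` with `i ≠ j` and `x ∈ I`, i.e. the subgroup generated by all their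
`E_n(R)`-conjugates. (The matrices `E_{21}(x)` alone give the same group, all the `E_{ij}(x)`
being conjugate under `E_n(R)` to `E_{21}(x)` or `E_{21}(-x)`.) -/
def RelElem (n : ℕ) (I : Ideal R) : Subgroup (SpecialLinearGroup (Fin n) R) :=
  Subgroup.closure {g | ∃ h ∈ Elem n R, ∃ (i j : Fin n) (hij : i ≠ j), ∃ x ∈ I,
    g = h * SpecialLinearGroup.transvection hij x * h⁻¹}

/-- `SL_n(R, I)`: the matrices of determinant one that are congruent to the identity mod `I`. -/
def RelSL (n : ℕ) (I : Ideal R) : Subgroup (SpecialLinearGroup (Fin n) R) :=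
  (SpecialLinearGroup.map (n := Fin n) (Ideal.Quotient.mk I)).ker

/-- The orthogonal (block diagonal) sum `M ⊥ N`. -/
def perp {m n : ℕ} (M : Matrix (Fin m) (Fin m) R) (N : Matrix (Fin n) (Fin n) R) :
    Matrix (Fin (m + n)) (Fin (m + n)) R :=
  (fromBlocks M 0 0 N).submatrix finSumFinEquiv.symm finSumFinEquiv.symm

theorem perp_mul {m n : ℕ} (M M' : Matrix (Fin m) (Fin m) R) (N N' : Matrix (Fin n) (Fin n) R) :
    perp M N * perp M' N' = perp (M * M') (N * N') := by
  simp [perp, submatrix_mul_equiv, fromBlocks_multiply]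

theorem perp_transpose {m n : ℕ} (M : Matrix (Fin m) (Fin m) R) (N : Matrix (Fin n) (Fin n) R) :
    (perp M N)ᵀ = perp Mᵀ Nᵀ := by
  simp [perp, transpose_submatrix, fromBlocks_transpose]

theorem perp_one_one {m n : ℕ} :
    perp (1 : Matrix (Fin m) (Fin m) R) (1 : Matrix (Fin n) (Fin n) R) = 1 := by
  simp [perp, fromBlocks_one]

theorem perp_det {m n : ℕ} (M : Matrix (Fin m) (Fin m) R) (N : Matrix (Fin n) (Fin n) R) :
    (perp M N).det = M.det * N.det := by
  simp [perp]

theorem perp_apply {m n : ℕ} (M : Matrix (Fin m) (Fin m) R) (N : Matrix (Fin n) (Fin n) R)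
    (i j : Fin (m + n)) : perp M N i j =
      if h : (i : ℕ) < m ∧ (j : ℕ) < m then M ⟨i, h.1⟩ ⟨j, h.2⟩
      else if h : m ≤ (i : ℕ) ∧ m ≤ (j : ℕ) then
        N ⟨i - m, by omega⟩ ⟨j - m, by omega⟩ else 0 := by
  refine Fin.addCases (fun i => ?_) (fun i => ?_) i <;>
    refine Fin.addCases (fun j => ?_) (fun j => ?_) j
  · simp [perp]
  · have := i.2
    simp [perp]
  · have := j.2
    simp [perp]
  · simp [perp]

theorem perp_lt {m n : ℕ} (M : Matrix (Fin m) (Fin m) R) (N : Matrix (Fin n) (Fin n) R)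
    (i j : Fin (m + n)) (hi : (i : ℕ) < m) (hj : (j : ℕ) < m) :
    perp M N i j = M ⟨i, hi⟩ ⟨j, hj⟩ := by
  rw [perp_apply, dif_pos ⟨hi, hj⟩]

theorem perp_ge {m n : ℕ} (M : Matrix (Fin m) (Fin m) R) (N : Matrix (Fin n) (Fin n) R)
    (i j : Fin (m + n)) (hi : m ≤ (i : ℕ)) (hj : m ≤ (j : ℕ)) :
    perp M N i j = N ⟨i - m, by omega⟩ ⟨j - m, by omega⟩ := by
  rw [perp_apply, dif_neg (by omega), dif_pos ⟨hi, hj⟩]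

theorem perp_lt_ge {m n : ℕ} (M : Matrix (Fin m) (Fin m) R) (N : Matrix (Fin n) (Fin n) R)
    (i j : Fin (m + n)) (hi : (i : ℕ) < m) (hj : m ≤ (j : ℕ)) : perp M N i j = 0 := by
  rw [perp_apply, dif_neg (by omega), dif_neg (by omega)]

theorem perp_ge_lt {m n : ℕ} (M : Matrix (Fin m) (Fin m) R) (N : Matrix (Fin n) (Fin n) R)
    (i j : Fin (m + n)) (hi : m ≤ (i : ℕ)) (hj : (j : ℕ) < m) : perp M N i j = 0 := by
  rw [perp_apply, dif_neg (by omega), dif_neg (by omega)]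

/-- The stabilization `SL_n(R) → SL_{n+k}(R)`, `α ↦ α ⊥ 1`. -/
def stabSL (n k : ℕ) (R : Type u) [CommRing R] :
    SpecialLinearGroup (Fin n) R →* SpecialLinearGroup (Fin (n + k)) R where
  toFun α := ⟨perp α.1 1, by rw [perp_det, α.2, det_one, one_mul]⟩
  map_one' := Subtype.ext perp_one_one
  map_mul' α β := Subtype.ext (by
    change perp (α.1 * β.1) 1 = perp α.1 1 * perp β.1 1
    rw [perp_mul, one_mul])

/-- The elements of `SL_n(R)` that lie in the stable relative elementary group
`E(R, I) = ⋃ₖ E_{n+k}(R, I)`. -/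
def StableRelElem (n : ℕ) (I : Ideal R) : Set (SpecialLinearGroup (Fin n) R) :=
  {α | ∃ k : ℕ, stabSL n k R α ∈ RelElem (n + k) I}

theorem map_mem_elem (n : ℕ) (f : R →+* S) {g : SpecialLinearGroup (Fin n) R}
    (hg : g ∈ Elem n R) : SpecialLinearGroup.map f g ∈ Elem n S := by
  have h : Elem n R ≤ (Elem n S).comap (SpecialLinearGroup.map f) := by
    refine (Subgroup.closure_le _).2 ?_
    rintro _ ⟨i, j, hij, x, rfl⟩
    refine Subgroup.subset_closure ⟨i, j, hij, f x, ?_⟩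
    apply Subtype.ext
    change (1 + single i j x : Matrix _ _ R).map f = 1 + single i j (f x)
    rw [Matrix.map_add f (map_add f), Matrix.map_one f (map_zero f) (map_one f), map_single]
  exact h hg

theorem map_transvection (n : ℕ) (f : R →+* S) {i j : Fin n} (hij : i ≠ j) (x : R) :
    SpecialLinearGroup.map f (SpecialLinearGroup.transvection hij x) =
      SpecialLinearGroup.transvection hij (f x) := by
  apply Subtype.ext
  change (1 + single i j x : Matrix _ _ R).map f = 1 + single i j (f x)
  rw [Matrix.map_add f (map_add f), Matrix.map_one f (map_zero f) (map_one f), map_single]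

theorem map_mem_relElem (n : ℕ) (f : R →+* S) {I : Ideal R} {J : Ideal S} (hf : I ≤ J.comap f)
    {g : SpecialLinearGroup (Fin n) R} (hg : g ∈ RelElem n I) :
    SpecialLinearGroup.map f g ∈ RelElem n J := by
  have h : RelElem n I ≤ (RelElem n J).comap (SpecialLinearGroup.map f) := by
    refine (Subgroup.closure_le _).2 ?_
    rintro _ ⟨h, hh, i, j, hij, x, hx, rfl⟩
    refine Subgroup.subset_closure ⟨_, map_mem_elem n f hh, i, j, hij, f x, hf hx, ?_⟩
    rw [map_mul, map_mul, map_inv, map_transvection]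
  exact h hg

end Elementary

section Orbits

variable {R : Type u} [CommRing R] {S : Type v} [CommRing S]

/-- `v` is a unimodular row. -/
def IsUnimodular {n : ℕ} (v : Fin n → R) : Prop := ∃ w : Fin n → R, v ⬝ᵥ w = 1

/-- `Um_n(R, I)`: the unimodular rows congruent to `e₁ = (1, 0, …, 0)` mod `I`. For `I = ⊤` this
is `Um_n(R)`. -/
def Um (n : ℕ) [NeZero n] (I : Ideal R) : Type u :=
  {v : Fin n → R // IsUnimodular v ∧ ∀ i, v i - (Pi.single 0 1 : Fin n → R) i ∈ I}

/-- Two rows are equivalent if `v g = w` for some `g ∈ E_n(R, I)`. -/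
def orbitSetoid (n : ℕ) [NeZero n] (I : Ideal R) : Setoid (Um n I) where
  r v w := ∃ g ∈ RelElem n I, v.1 ᵥ* g.1 = w.1
  iseqv :=
    { refl := fun v => ⟨1, one_mem _, vecMul_one v.1⟩
      symm := by
        rintro v w ⟨g, hg, h⟩
        refine ⟨g⁻¹, inv_mem hg, ?_⟩
        rw [← h, vecMul_vecMul]
        have : g.1 * (g⁻¹).1 = 1 := congrArg Subtype.val (mul_inv_cancel g)
        rw [this, vecMul_one]
      trans := by
        rintro u v w ⟨g, hg, h⟩ ⟨g', hg', h'⟩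
        refine ⟨g * g', mul_mem hg hg', ?_⟩
        rw [← h', ← h, vecMul_vecMul]
        rfl }

/-- The orbit space `MSE_n(R, I) = Um_n(R, I) / E_n(R, I)`; for `I = ⊤` it is
`MSE_n(R) = Um_n(R) / E_n(R)`. -/
def MSE (n : ℕ) [NeZero n] (I : Ideal R) : Type u := Quotient (orbitSetoid n I)

/-- The class in `MSE_n(R)` of a unimodular row. -/
def absClass {n : ℕ} [NeZero n] (v : Fin n → R) (hv : IsUnimodular v) :
    MSE n (⊤ : Ideal R) :=
  Quotient.mk (orbitSetoid n ⊤) ⟨v, hv, fun _ => Submodule.mem_top⟩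

/-- The map `Um_n(R, I) → Um_n(S, J)` induced by a ring homomorphism `f` with `f(I) ⊆ J`. -/
def Um.map (n : ℕ) [NeZero n] (f : R →+* S) {I : Ideal R} {J : Ideal S} (hf : I ≤ J.comap f)
    (v : Um n I) : Um n J :=
  ⟨fun i => f (v.1 i), by
    obtain ⟨w, hw⟩ := v.2.1
    refine ⟨fun i => f (w i), ?_⟩
    have := congrArg f hw
    rw [map_one] at this
    rw [← this]
    simp [dotProduct], by
    intro i
    have h : f (v.1 i - (Pi.single 0 1 : Fin n → R) i) ∈ J := hf (v.2.2 i)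
    have e : f ((Pi.single 0 1 : Fin n → R) i) = (Pi.single 0 1 : Fin n → S) i := by
      by_cases hi : i = 0
      · subst hi; simp
      · simp [hi]
    rwa [map_sub, e] at h⟩

/-- The map `MSE_n(R, I) → MSE_n(S, J)`, `[(aᵢ)] ↦ [(f(aᵢ))]`. -/
def MSE.map (n : ℕ) [NeZero n] (f : R →+* S) {I : Ideal R} {J : Ideal S} (hf : I ≤ J.comap f) :
    MSE n I → MSE n J :=
  Quotient.map (Um.map n f hf) (by
    rintro v w ⟨g, hg, h⟩
    refine ⟨SpecialLinearGroup.map f g, map_mem_relElem n f hf hg, ?_⟩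
    funext i
    have := congrArg f (congrFun h i)
    simpa [vecMul, dotProduct, Um.map] using this)

end Orbits

section Excision

variable {R : Type u} [CommRing R]

/-- The excision ring `ℤ ⊕ I`, with `(m, i)(n, j) = (mn, mj + ni + ij)`. -/
abbrev Exc (I : Ideal R) : Type u := Unitization ℤ I

/-- The ideal `0 ⊕ I` of `ℤ ⊕ I`. -/
def Exc.ideal (I : Ideal R) : Ideal (Exc I) := RingHom.ker (Unitization.fstHom ℤ I)

/-- The ring homomorphism `f : ℤ ⊕ I → R`, `(m, i) ↦ m + i`. -/
def Exc.toRing (I : Ideal R) : Exc I →+* R where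
  toFun x := (x.fst : R) + (x.snd : R)
  map_one' := by simp
  map_zero' := by simp
  map_add' x y := by simp; ring
  map_mul' x y := by simp; ring

/-- `F : MSE_n(ℤ ⊕ I, 0 ⊕ I) → MSE_n(R, I)`, `[(aᵢ)] ↦ [(f(aᵢ))]`. -/
def Exc.F (n : ℕ) [NeZero n] (I : Ideal R) : MSE n (Exc.ideal I) → MSE n I :=
  MSE.map n (Exc.toRing I) (by
    intro x hx
    have h0 : x.fst = 0 := hx
    change (x.fst : R) + (x.snd : R) ∈ I
    rw [h0, Int.cast_zero, zero_add]
    exact x.snd.2)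

/-- `G : MSE_n(ℤ ⊕ I, 0 ⊕ I) → MSE_n(ℤ ⊕ I)`, `[(aᵢ)] ↦ [(aᵢ)]`. -/
def Exc.G (n : ℕ) [NeZero n] (I : Ideal R) :
    MSE n (Exc.ideal I) → MSE n (⊤ : Ideal (Exc I)) :=
  MSE.map n (RingHom.id (Exc I)) (fun _ _ => Submodule.mem_top)

/-- The identification `G ∘ F⁻¹ : MSE_n(R, I) ≃ MSE_n(ℤ ⊕ I)`, when `F` and `G` are bijective. -/
noncomputable def Exc.equiv {n : ℕ} [NeZero n] {I : Ideal R}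
    (hF : Function.Bijective (Exc.F n I)) (hG : Function.Bijective (Exc.G n I)) :
    MSE n I ≃ MSE n (⊤ : Ideal (Exc I)) :=
  (Equiv.ofBijective _ hF).symm.trans (Equiv.ofBijective _ hG)

/-- The operation `op` on `MSE₃(R)` is given by the Vaserstein-van der Kallen rule: if
`v = (a, c, d)` and `w = (b, c, d)` are unimodular and `a p ≡ 1` mod `(c, d)`, then
`(a(b + p) - 1, c(b + p), d)` is unimodular, and its class is `[w] * [v]`. -/
def IsVvRule (op : MSE 3 (⊤ : Ideal R) → MSE 3 (⊤ : Ideal R) → MSE 3 (⊤ : Ideal R)) : Prop :=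
  ∀ (a b c d p : R) (hv : IsUnimodular ![a, c, d]) (hw : IsUnimodular ![b, c, d]),
    a * p - 1 ∈ Ideal.span {c, d} →
    ∃ h : IsUnimodular ![a * (b + p) - 1, c * (b + p), d],
      op (absClass _ hw) (absClass _ hv) = absClass _ h

end Excision

section Witt

variable {A : Type u} [CommRing A]

/-- The Pfaffian, by expansion along the first row. -/
def pf : (n : ℕ) → Matrix (Fin n) (Fin n) A → A
  | 0, _ => 1
  | 1, _ => 0
  | n + 2, M => ∑ j : Fin (n + 1), (-1) ^ (j : ℕ) * M 0 j.succ *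
      pf n (M.submatrix (fun i => (j.succAbove i).succ) (fun i => (j.succAbove i).succ))

theorem pf_cast {m n : ℕ} (h : m = n) (M : Matrix (Fin n) (Fin n) A) :
    pf m (M.submatrix (Fin.cast h) (Fin.cast h)) = pf n M := by
  subst h; rfl

theorem pf_succ_succ {n : ℕ} (M : Matrix (Fin (n + 2)) (Fin (n + 2)) A) :
    pf (n + 2) M = ∑ j : Fin (n + 1), (-1) ^ (j : ℕ) * M 0 j.succ *
      pf n (M.submatrix (fun i => (j.succAbove i).succ) (fun i => (j.succAbove i).succ)) := rfl

theorem val_succAbove {n : ℕ} (j : Fin (n + 1)) (z : Fin n) :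
    (j.succAbove z : ℕ) = if (z : ℕ) < j then (z : ℕ) else z + 1 := by
  rw [Fin.succAbove]
  split_ifs <;> simp_all [Fin.lt_def]

theorem pf_perp {n : ℕ} (N : Matrix (Fin n) (Fin n) A) : (m : ℕ) → Even m →
    (M : Matrix (Fin m) (Fin m) A) → pf _ (perp M N) = pf _ M * pf _ N
  | 0, _, M => by
    rw [← pf_cast (show n = 0 + n by omega)]
    change _ = 1 * pf n N
    rw [one_mul]
    congr 1
    ext i j
    rw [submatrix_apply, perp_ge _ _ _ _ (by simp) (by simp)]
    rfl
  | 1, h, _ => by simp at h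
  | m + 2, h, M => by
    have ih := pf_perp N m (by simpa [Nat.even_add] using h)
    have hc : (m + n) + 2 = m + 2 + n := by omega
    have hd : m + 1 + n = m + n + 1 := by omega
    rw [← pf_cast hc, pf_succ_succ, pf_succ_succ, ← (finCongr hd).sum_comp, Fin.sum_univ_add,
      Finset.sum_mul]
    conv_rhs => rw [← add_zero (Finset.sum _ _)]
    congr 1
    · refine Finset.sum_congr rfl fun j _ => ?_
      have hj := j.2
      rw [mul_assoc _ (pf _ _) (pf _ _), ← ih]
      congr 1
      · rw [submatrix_apply, perp_lt _ _ _ _ (by simp) (by simp; omega)]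
        rfl
      · congr 1
        ext x y
        have key : ∀ z : Fin (m + n),
            (Fin.cast hc (((finCongr hd) (Fin.castAdd n j)).succAbove z).succ : ℕ) =
              if (z : ℕ) < j then (z : ℕ) + 1 else z + 2 := by
          intro z
          rw [Fin.val_cast, Fin.val_succ, val_succAbove]
          simp only [finCongr_apply, Fin.val_cast, Fin.val_castAdd]
          split_ifs <;> rfl
        rw [submatrix_apply, submatrix_apply]
        have kx := key x
        have ky := key y
        by_cases hx : (x : ℕ) < m <;> by_cases hy : (y : ℕ) < m
        · rw [perp_lt M N _ _ (by rw [kx]; split_ifs <;> omega) (by rw [ky]; split_ifs <;> omega),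
            perp_lt _ _ _ _ hx hy, submatrix_apply]
          congr 1 <;> apply Fin.ext <;> simp only [kx, ky, Fin.val_succ, val_succAbove] <;>
            split_ifs <;> rfl
        · rw [perp_lt_ge M N _ _ (by rw [kx]; split_ifs <;> omega)
            (by rw [ky]; split_ifs <;> omega), perp_lt_ge _ _ _ _ hx (by omega)]
        · rw [perp_ge_lt M N _ _ (by rw [kx]; split_ifs <;> omega)
            (by rw [ky]; split_ifs <;> omega), perp_ge_lt _ _ _ _ (by omega) hy]
        · rw [perp_ge M N _ _ (by rw [kx]; split_ifs <;> omega)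
            (by rw [ky]; split_ifs <;> omega), perp_ge _ _ _ _ (by omega) (by omega)]
          congr 1 <;> apply Fin.ext <;> simp only [kx, ky] <;> split_ifs <;> omega
    · refine Finset.sum_eq_zero fun j _ => ?_
      rw [submatrix_apply, perp_lt_ge _ _ _ _ (by simp) (by simp), mul_zero, zero_mul]

/-- The alternating matrices (skew-symmetric, with zero diagonal) of even size and Pfaffian `1`. -/
structure AltForm (A : Type u) [CommRing A] where
  /-- the size of the matrix -/
  size : ℕ
  even : Even size
  /-- the matrix -/
  mat : Matrix (Fin size) (Fin size) A
  skew : matᵀ = -mat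
  diag : ∀ i, mat i i = 0
  pf_eq : pf size mat = 1

/-- The entries of the standard alternating matrices `ψ_r = ψ₁ ⊥ … ⊥ ψ₁` (`r` summands), where
`ψ₁` has rows `(0, 1)` and `(-1, 0)`; indices start at `0`. -/
def stdEntry (A : Type u) [CommRing A] (i j : ℕ) : A :=
  if Even i ∧ j = i + 1 then 1 else if Even j ∧ i = j + 1 then -1 else 0

/-- For `M` of even size `n` and an even `N ≥ n`, the matrix `M ⊥ ψ_{(N-n)/2}` of size `N`. -/
def stab {n : ℕ} (M : Matrix (Fin n) (Fin n) A) (N : ℕ) : Matrix (Fin N) (Fin N) A :=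
  of fun i j => if h : (i : ℕ) < n ∧ (j : ℕ) < n then M ⟨i, h.1⟩ ⟨j, h.2⟩ else stdEntry A i j

/-- Stable equivalence of alternating matrices: `M ⊥ ψ_k = εᵗ (M' ⊥ ψ_l) ε` for some `k`, `l`,
with both sides of the same size `N`, and some `ε ∈ E_N(A)`. -/
def StabEquiv {m n : ℕ} (M : Matrix (Fin m) (Fin m) A) (M' : Matrix (Fin n) (Fin n) A) : Prop :=
  ∃ N : ℕ, Even N ∧ m ≤ N ∧ n ≤ N ∧ ∃ ε ∈ Elem N A, stab M N = ε.1ᵀ * stab M' N * ε.1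

theorem stab_stab {n N N' : ℕ} (h : n ≤ N) (M : Matrix (Fin n) (Fin n) A) :
    stab (stab M N) N' = stab M N' := by
  ext i j
  simp only [stab, of_apply]
  by_cases h1 : (i : ℕ) < n ∧ (j : ℕ) < n
  · rw [dif_pos h1, dif_pos (by omega), dif_pos h1]
  · rw [dif_neg h1]
    split_ifs <;> rfl

theorem stdEntry_off {n i j : ℕ} (hn : Even n) (hi : i < n) (hj : n ≤ j) :
    stdEntry A i j = 0 ∧ stdEntry A j i = 0 := by
  obtain ⟨c, rfl⟩ := hn
  constructor
  · rw [stdEntry, if_neg, if_neg]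
    · omega
    · rintro ⟨⟨d, rfl⟩, h⟩; omega
  · rw [stdEntry, if_neg, if_neg]
    · rintro ⟨⟨d, rfl⟩, h⟩; omega
    · omega

theorem stab_add {n : ℕ} (hn : Even n) (M : Matrix (Fin n) (Fin n) A) (k : ℕ) :
    stab M (n + k) =
      perp M (of fun i j : Fin k => stdEntry A (i + n) (j + n)) := by
  ext i j
  by_cases hi : (i : ℕ) < n <;> by_cases hj : (j : ℕ) < n
  · rw [perp_lt _ _ _ _ hi hj]
    simp [stab, hi, hj]
  · rw [perp_lt_ge _ _ _ _ hi (by omega)]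
    simp [stab, hj, (stdEntry_off (A := A) hn hi (not_lt.1 hj)).1]
  · rw [perp_ge_lt _ _ _ _ (by omega) hj]
    simp [stab, hi, (stdEntry_off (A := A) hn hj (not_lt.1 hi)).2]
  · rw [perp_ge _ _ _ _ (by omega) (by omega)]
    simp [stab, hi, Nat.sub_add_cancel (not_lt.1 hi), Nat.sub_add_cancel (not_lt.1 hj)]

theorem transvection_mem {n : ℕ} {i j : Fin n} (hij : i ≠ j) (x : A) :
    SpecialLinearGroup.transvection hij x ∈ Elem n A :=
  Subgroup.subset_closure ⟨i, j, hij, x, rfl⟩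

theorem stabSL_mem {n k : ℕ} {g : SpecialLinearGroup (Fin n) A} (hg : g ∈ Elem n A) :
    stabSL n k A g ∈ Elem (n + k) A := by
  have h : Elem n A ≤ (Elem (n + k) A).comap (stabSL n k A) := by
    refine (Subgroup.closure_le _).2 ?_
    rintro _ ⟨i, j, hij, x, rfl⟩
    refine Subgroup.subset_closure ⟨Fin.castAdd k i, Fin.castAdd k j, by simpa using hij, x, ?_⟩
    apply Subtype.ext
    change perp (1 + single i j x) 1 = 1 + single (Fin.castAdd k i) (Fin.castAdd k j) x
    rw [← perp_one_one]
    ext a b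
    refine Fin.addCases (fun a => ?_) (fun a => ?_) a <;>
      refine Fin.addCases (fun b => ?_) (fun b => ?_) b <;>
      simp only [Matrix.add_apply, single_apply, perp, submatrix_apply, Fin.ext_iff,
        Fin.val_castAdd, Fin.val_natAdd, finSumFinEquiv_symm_apply_castAdd,
        finSumFinEquiv_symm_apply_natAdd, fromBlocks_apply₁₁, fromBlocks_apply₁₂,
        fromBlocks_apply₂₁, fromBlocks_apply₂₂] <;> grind
  exact h hg

/-- Block sum with an identity matrix on the left, for elementary matrices. -/
theorem perp_one_mem {n k : ℕ} {g : SpecialLinearGroup (Fin n) A} (hg : g ∈ Elem n A) :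
    ∃ g' ∈ Elem (k + n) A, g'.1 = perp (1 : Matrix (Fin k) (Fin k) A) g.1 := by
  let f : SpecialLinearGroup (Fin n) A →* SpecialLinearGroup (Fin (k + n)) A :=
    { toFun := fun α => ⟨perp 1 α.1, by rw [perp_det, α.2, det_one, one_mul]⟩
      map_one' := Subtype.ext perp_one_one
      map_mul' := fun α β => Subtype.ext (by
        change perp 1 (α.1 * β.1) = perp 1 α.1 * perp 1 β.1
        rw [perp_mul, one_mul]) }
  have h : Elem n A ≤ (Elem (k + n) A).comap f := by
    refine (Subgroup.closure_le _).2 ?_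
    rintro _ ⟨i, j, hij, x, rfl⟩
    refine Subgroup.subset_closure ⟨Fin.natAdd k i, Fin.natAdd k j, by simpa using hij, x, ?_⟩
    apply Subtype.ext
    change perp 1 (1 + single i j x) = 1 + single (Fin.natAdd k i) (Fin.natAdd k j) x
    rw [← perp_one_one]
    ext a b
    refine Fin.addCases (fun a => ?_) (fun a => ?_) a <;>
      refine Fin.addCases (fun b => ?_) (fun b => ?_) b <;>
      simp only [Matrix.add_apply, single_apply, perp, submatrix_apply, Fin.ext_iff,
        Fin.val_castAdd, Fin.val_natAdd, finSumFinEquiv_symm_apply_castAdd,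
        finSumFinEquiv_symm_apply_natAdd, fromBlocks_apply₁₁, fromBlocks_apply₁₂,
        fromBlocks_apply₂₁, fromBlocks_apply₂₂] <;> grind
  exact ⟨f g, h hg, rfl⟩

theorem stab_conj {N N' : ℕ} (hN : Even N) (hNN' : N ≤ N')
    {ε : SpecialLinearGroup (Fin N) A} (hε : ε ∈ Elem N A) :
    ∃ ε' ∈ Elem N' A, ∀ M : Matrix (Fin N) (Fin N) A,
      stab (ε.1ᵀ * M * ε.1) N' = ε'.1ᵀ * stab M N' * ε'.1 := by
  obtain ⟨k, rfl⟩ := Nat.exists_eq_add_of_le hNN'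
  refine ⟨stabSL N k A ε, stabSL_mem hε, fun M => ?_⟩
  change _ = (perp ε.1 1)ᵀ * _ * perp ε.1 1
  rw [stab_add hN, stab_add hN, perp_transpose, perp_mul, perp_mul, transpose_one, one_mul,
    mul_one]

theorem StabEquiv.refl {m : ℕ} (hm : Even m) (M : Matrix (Fin m) (Fin m) A) : StabEquiv M M :=
  ⟨m, hm, le_rfl, le_rfl, 1, one_mem _, by simp⟩

theorem StabEquiv.symm {m n : ℕ} {M : Matrix (Fin m) (Fin m) A} {M' : Matrix (Fin n) (Fin n) A}
    (h : StabEquiv M M') : StabEquiv M' M := by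
  obtain ⟨N, hN, hm, hn, ε, hε, h⟩ := h
  refine ⟨N, hN, hn, hm, ε⁻¹, inv_mem hε, ?_⟩
  have h1 : ε.1 * (ε⁻¹).1 = 1 := congrArg Subtype.val (mul_inv_cancel ε)
  have h2 : (ε⁻¹).1ᵀ * ε.1ᵀ = 1 := by rw [← transpose_mul, h1, transpose_one]
  rw [h]
  calc stab M' N = ((ε⁻¹).1ᵀ * ε.1ᵀ) * stab M' N * (ε.1 * (ε⁻¹).1) := by
        rw [h1, h2, one_mul, mul_one]
    _ = _ := by simp only [Matrix.mul_assoc]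

theorem StabEquiv.trans {m n p : ℕ} {M : Matrix (Fin m) (Fin m) A}
    {M' : Matrix (Fin n) (Fin n) A} {M'' : Matrix (Fin p) (Fin p) A}
    (h : StabEquiv M M') (h' : StabEquiv M' M'') : StabEquiv M M'' := by
  obtain ⟨N₁, hN₁, hm, hn, ε₁, hε₁, h⟩ := h
  obtain ⟨N₂, hN₂, hn', hp, ε₂, hε₂, h'⟩ := h'
  obtain ⟨δ₁, hδ₁, e₁⟩ := stab_conj hN₁ (Nat.le_add_right N₁ N₂) hε₁
  obtain ⟨δ₂, hδ₂, e₂⟩ := stab_conj hN₂ (Nat.le_add_left N₂ N₁) hε₂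
  refine ⟨N₁ + N₂, hN₁.add hN₂, by omega, by omega, δ₂ * δ₁, mul_mem hδ₂ hδ₁, ?_⟩
  rw [← stab_stab hm, h, e₁, stab_stab hn, ← stab_stab hn', h', e₂, stab_stab hp]
  change _ = (δ₂.1 * δ₁.1)ᵀ * _ * (δ₂.1 * δ₁.1)
  rw [transpose_mul]
  simp only [Matrix.mul_assoc]

/-- The matrix of a permutation. -/
def permMat {n : ℕ} (σ : Equiv.Perm (Fin n)) : Matrix (Fin n) (Fin n) A :=
  (1 : Matrix (Fin n) (Fin n) A).submatrix id σ

theorem permMat_mul {n : ℕ} (σ τ : Equiv.Perm (Fin n)) :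
    permMat (A := A) σ * permMat τ = permMat (σ * τ) := by
  ext i j
  simp [permMat, mul_apply, one_apply]

theorem permMat_conj {n : ℕ} (σ : Equiv.Perm (Fin n)) (X : Matrix (Fin n) (Fin n) A) :
    (permMat σ)ᵀ * X * permMat σ = X.submatrix σ σ := by
  ext i j
  simp [permMat, mul_apply, one_apply]

theorem swap_mul_swap_mem {n : ℕ} {a b c d : Fin n} (hab : a ≠ b) (hcd : c ≠ d) :
    ∃ g ∈ Elem n A, g.1 = permMat (Equiv.swap a b * Equiv.swap c d) := by
  let D : Fin n → Matrix (Fin n) (Fin n) A := fun i => diagonal fun k => if k = i then -1 else 1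
  let W : ∀ {a b : Fin n}, a ≠ b → SpecialLinearGroup (Fin n) A := fun h =>
    SpecialLinearGroup.transvection h 1 * SpecialLinearGroup.transvection h.symm (-1) *
      SpecialLinearGroup.transvection h 1
  have hW : ∀ {a b : Fin n} (h : a ≠ b), W h ∈ Elem n A := fun h =>
    mul_mem (mul_mem (transvection_mem _ _) (transvection_mem _ _)) (transvection_mem _ _)
  have hD : ∀ i, D i * D i = 1 := by
    intro i
    rw [diagonal_mul_diagonal, ← diagonal_one]
    congr 1
    funext k
    split_ifs <;> simp
  have hDP : ∀ (σ : Equiv.Perm (Fin n)) (d : Fin n), permMat σ * D d = D (σ d) * permMat σ := by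
    intro σ d
    ext i j
    simp only [D, mul_diagonal, diagonal_mul, permMat, submatrix_apply, one_apply, id]
    by_cases h : i = σ j
    · subst h; simp
    · simp [h]
  have hWP : ∀ {a b : Fin n} (h : a ≠ b), (W h).1 = D b * permMat (Equiv.swap a b) := by
    intro a b h
    have e1 : (W h).1 = 1 + single a b 1 - single b a 1 - single a a 1 - single b b 1 := by
      change (1 + single a b 1) * (1 + single b a (-1)) * (1 + single a b 1) = _
      have e : single b a (-1 : A) = - single b a 1 := by
        ext; simp [single_apply]; split_ifs <;> simp
      rw [e]
      simp only [add_mul, mul_add, one_mul, mul_one, mul_neg, neg_mul, single_mul_single_same]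
      rw [single_mul_single_of_ne _ _ _ _ h.symm]
      abel
    rw [e1]
    ext i j
    simp only [D, diagonal_mul, permMat, submatrix_apply, one_apply, id, Equiv.swap_apply_def,
      single_apply, Matrix.sub_apply, Matrix.add_apply]
    by_cases hia : a = i <;> by_cases hib : b = i <;> by_cases hja : a = j <;>
      by_cases hjb : b = j <;> grind
  have hDD : ∀ i j, ∃ g ∈ Elem n A, g.1 = D i * D j := by
    intro i j
    by_cases h : j = i
    · subst h
      exact ⟨1, one_mem _, (hD j).symm⟩
    · refine ⟨W h * W h, mul_mem (hW h) (hW h), ?_⟩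
      change (W h).1 * (W h).1 = _
      rw [hWP h, Matrix.mul_assoc, ← Matrix.mul_assoc (permMat _), hDP, Matrix.mul_assoc,
        permMat_mul, Equiv.swap_mul_self, Equiv.swap_apply_right]
      simp [permMat]
  obtain ⟨g, hg, hg'⟩ := hDD (Equiv.swap a b d) b
  refine ⟨g * W hab * W hcd, mul_mem (mul_mem hg (hW _)) (hW _), ?_⟩
  change g.1 * (W hab).1 * (W hcd).1 = _
  rw [hg', hWP, hWP, ← permMat_mul]
  calc _ = D (Equiv.swap a b d) * (D b * D b) * (permMat (Equiv.swap a b) * D d)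
        * permMat (Equiv.swap c d) := by simp only [Matrix.mul_assoc]
    _ = _ := by
      rw [hD, mul_one, hDP, ← Matrix.mul_assoc, hD, one_mul]

/-- Even permutation matrices are elementary. -/
theorem permMat_mem {n : ℕ} (σ : Equiv.Perm (Fin n)) (hσ : Equiv.Perm.sign σ = 1) :
    ∃ g ∈ Elem n A, g.1 = permMat σ := by
  have mul : ∀ σ τ : Equiv.Perm (Fin n), (∃ g ∈ Elem n A, g.1 = permMat σ) →
      (∃ g ∈ Elem n A, g.1 = permMat τ) → ∃ g ∈ Elem n A, g.1 = permMat (σ * τ) := by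
    rintro σ τ ⟨g, hg, h⟩ ⟨g', hg', h'⟩
    exact ⟨g * g', mul_mem hg hg', by rw [← permMat_mul, ← h, ← h']; rfl⟩
  have key : (Equiv.Perm.sign σ = 1 → ∃ g ∈ Elem n A, g.1 = permMat σ) ∧
      (Equiv.Perm.sign σ = -1 → ∀ a b, a ≠ b →
        ∃ g ∈ Elem n A, g.1 = permMat (Equiv.swap a b * σ)) := by
    clear hσ
    induction σ using Equiv.Perm.swap_induction_on with
    | one =>
      refine ⟨fun _ => ⟨1, one_mem _, by simp [permMat]⟩, fun h => ?_⟩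
      simp at h
    | swap_mul f x y hxy ih =>
      rw [Equiv.Perm.sign_mul, Equiv.Perm.sign_swap hxy]
      refine ⟨fun h => ih.2 ?_ x y hxy, fun h a b hab => ?_⟩
      · simpa [neg_eq_iff_eq_neg] using h
      · rw [← mul_assoc]
        exact mul _ _ (swap_mul_swap_mem hab hxy) (ih.1 (by simpa using h))
  exact key.1 hσ

theorem stab_self {n : ℕ} (M : Matrix (Fin n) (Fin n) A) : stab M n = M := by
  ext i j
  simp [stab]

theorem stab_cast {n N : ℕ} (h : N = n) (M : Matrix (Fin n) (Fin n) A) :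
    stab M N = M.submatrix (Fin.cast h) (Fin.cast h) := by
  subst h
  rw [stab_self]
  rfl

theorem perp_comm {m n : ℕ} (hm : Even m) (hn : Even n) (M : Matrix (Fin m) (Fin m) A)
    (M' : Matrix (Fin n) (Fin n) A) : StabEquiv (perp M M') (perp M' M) := by
  have hh := hn
  obtain ⟨c, hc⟩ := hh
  rcases Nat.eq_zero_or_pos (m + n) with h0 | h0
  · exact ⟨m + n, hm.add hn, le_rfl, by omega, 1, one_mem _, by ext i; have := i.2; omega⟩
  have : NeZero (m + n) := ⟨by omega⟩
  let τ : Equiv.Perm (Fin (m + n)) := Equiv.addRight (Fin.ofNat (m + n) c)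
  have hτ : ∀ i, ((τ * τ) i : ℕ) = (i + n) % (m + n) := by
    intro i
    simp [τ, Fin.val_add, Fin.ofNat, hc, add_assoc]
  obtain ⟨g, hg, h⟩ := permMat_mem (A := A) (τ * τ) (by
    rw [Equiv.Perm.sign_mul]; exact Int.units_mul_self _)
  generalize τ * τ = σ at hτ h
  refine ⟨m + n, hm.add hn, le_rfl, by omega, g, hg, ?_⟩
  rw [h, permMat_conj, stab_self, stab_cast (by omega)]
  ext i j
  rw [submatrix_apply, submatrix_apply]
  have lt : ∀ i : Fin (m + n), (i : ℕ) < m → (σ i : ℕ) = i + n := fun i hi => by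
    rw [hτ, Nat.mod_eq_of_lt (by omega)]
  have ge : ∀ i : Fin (m + n), m ≤ (i : ℕ) → (σ i : ℕ) = i - m := fun i hi => by
    rw [hτ, show (i : ℕ) + n = (i - m) + (m + n) by omega, Nat.add_mod_right,
      Nat.mod_eq_of_lt (by omega)]
  by_cases hi : (i : ℕ) < m <;> by_cases hj : (j : ℕ) < m
  · rw [perp_lt _ _ _ _ hi hj, perp_ge M' _ _ _ (by simp [lt i hi]) (by simp [lt j hj])]
    congr 1 <;> apply Fin.ext <;> simp [lt i hi, lt j hj]
  · have := ge j (by omega)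
    rw [perp_lt_ge _ _ _ _ hi (by omega),
      perp_ge_lt M' _ _ _ (by simp [lt i hi]) (by rw [Fin.val_cast, this]; omega)]
  · have := ge i (by omega)
    rw [perp_ge_lt _ _ _ _ (by omega) hj,
      perp_lt_ge M' _ _ _ (by rw [Fin.val_cast, this]; omega) (by simp [lt j hj])]
  · have h1 := ge i (by omega)
    have h2 := ge j (by omega)
    rw [perp_ge _ _ _ _ (by omega) (by omega),
      perp_lt M' _ _ _ (by rw [Fin.val_cast, h1]; omega) (by rw [Fin.val_cast, h2]; omega)]
    congr 1 <;> apply Fin.ext <;> simp [h1, h2]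

theorem stdEntry_shift {k i j : ℕ} (hk : Even k) (hi : k ≤ i) (hj : k ≤ j) :
    stdEntry A (i - k) (j - k) = stdEntry A i j := by
  have h1 : Even (i - k) ↔ Even i := by rw [Nat.even_sub hi]; simp [hk]
  have h2 : Even (j - k) ↔ Even j := by rw [Nat.even_sub hj]; simp [hk]
  have h3 : j - k = i - k + 1 ↔ j = i + 1 := by omega
  have h4 : i - k = j - k + 1 ↔ i = j + 1 := by omega
  simp only [stdEntry, h1, h2, h3, h4]

theorem stab_perp {k n N : ℕ} (hk : Even k) (K : Matrix (Fin k) (Fin k) A)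
    (M : Matrix (Fin n) (Fin n) A) : stab (perp K M) (k + N) = perp K (stab M N) := by
  ext i j
  by_cases hi : (i : ℕ) < k <;> by_cases hj : (j : ℕ) < k
  · rw [perp_lt _ _ _ _ hi hj, stab, of_apply, dif_pos (by omega)]
    exact perp_lt K M ⟨i, by omega⟩ ⟨j, by omega⟩ hi hj
  · rw [perp_lt_ge _ _ _ _ hi (by omega), stab, of_apply]
    split_ifs with h
    · exact perp_lt_ge _ _ _ _ hi (not_lt.1 hj)
    · exact (stdEntry_off hk hi (not_lt.1 hj)).1
  · rw [perp_ge_lt _ _ _ _ (by omega) hj, stab, of_apply]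
    split_ifs with h
    · exact perp_ge_lt _ _ _ _ (not_lt.1 hi) hj
    · exact (stdEntry_off hk hj (not_lt.1 hi)).2
  · rw [perp_ge _ _ _ _ (by omega) (by omega), stab, stab, of_apply, of_apply]
    by_cases h : (i : ℕ) < k + n ∧ (j : ℕ) < k + n
    · rw [dif_pos h, dif_pos ⟨by simp; omega, by simp; omega⟩]
      exact perp_ge K M ⟨i, h.1⟩ ⟨j, h.2⟩ (not_lt.1 hi) (not_lt.1 hj)
    · rw [dif_neg h, dif_neg (by simp; omega)]
      exact (stdEntry_shift hk (not_lt.1 hi) (not_lt.1 hj)).symm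

theorem StabEquiv.perp_left {k m n : ℕ} (hk : Even k) (K : Matrix (Fin k) (Fin k) A)
    {M : Matrix (Fin m) (Fin m) A} {M' : Matrix (Fin n) (Fin n) A} (h : StabEquiv M M') :
    StabEquiv (perp K M) (perp K M') := by
  obtain ⟨N, hN, hm, hn, ε, hε, h⟩ := h
  obtain ⟨g, hg, hg'⟩ := perp_one_mem (k := k) hε
  refine ⟨k + N, hk.add hN, by omega, by omega, g, hg, ?_⟩
  rw [stab_perp hk, stab_perp hk, hg', h, perp_transpose, perp_mul, perp_mul]
  simp

/-- The orthogonal sum of alternating matrices. -/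
def AltForm.perp (φ ψ : AltForm A) : AltForm A where
  size := φ.size + ψ.size
  even := φ.even.add ψ.even
  mat := WittOrbit.perp φ.mat ψ.mat
  skew := by
    rw [perp_transpose, φ.skew, ψ.skew]
    ext i j
    simp only [perp_apply, Matrix.neg_apply]
    split_ifs <;> simp
  diag i := by
    rw [perp_apply]
    split_ifs <;> simp [φ.diag, ψ.diag]
  pf_eq := by rw [pf_perp _ _ φ.even, φ.pf_eq, ψ.pf_eq, one_mul]

/-- Stable elementary equivalence on the alternating matrices of Pfaffian `1`. -/
def wittSetoid (A : Type u) [CommRing A] : Setoid (AltForm A) where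
  r φ ψ := StabEquiv φ.mat ψ.mat
  iseqv := ⟨fun φ => StabEquiv.refl φ.even φ.mat, StabEquiv.symm, StabEquiv.trans⟩

/-- The elementary symplectic Witt group `W_E(A)`: alternating matrices of Pfaffian `1` up to
stable elementary equivalence, with the operation induced by the orthogonal sum. -/
def WE (A : Type u) [CommRing A] : Type u := Quotient (wittSetoid A)

/-- The class of an alternating matrix in the Witt group. -/
def WE.mk (φ : AltForm A) : WE A := Quotient.mk (wittSetoid A) φ

instance : Mul (WE A) where
  mul := Quotient.map₂ AltForm.perp (by
    intro φ φ' h ψ ψ' h'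
    have h1 : StabEquiv φ.mat φ'.mat := h
    have h2 : StabEquiv ψ.mat ψ'.mat := h'
    change StabEquiv (WittOrbit.perp φ.mat ψ.mat) (WittOrbit.perp φ'.mat ψ'.mat)
    exact ((perp_comm φ.even ψ.even _ _).trans
      ((h1.perp_left ψ.even ψ.mat).trans (perp_comm ψ.even φ'.even _ _))).trans
      (h2.perp_left φ'.even φ'.mat))

/-- For `a b^t = 1`, the alternating matrix of Pfaffian `1` whose class is the Vaserstein symbol
of the unimodular row `a`. -/
def vaserstein (a b : Fin 3 → A) (h : a ⬝ᵥ b = 1) : AltForm A where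
  size := 4
  even := ⟨2, rfl⟩
  mat := !![0, a 0, a 1, a 2;
            -a 0, 0, b 2, -b 1;
            -a 1, -b 2, 0, b 0;
            -a 2, b 1, -b 0, 0]
  skew := by
    ext i j
    fin_cases i <;> fin_cases j <;> simp
  diag i := by fin_cases i <;> simp
  pf_eq := by
    rw [← h]
    simp [pf, Fin.sum_univ_succ, dotProduct, Fin.succAbove]

end Witt

end WittOrbit

namespace WittOrbit

universe u v

/-! ### Calculus of the rank one transvections 1 + x p q. -/

section MatrixSubmonoid

variable {R : Type u} [CommRing R] {n : ℕ}

/-- The matrices underlying the elements of a subgroup of `SL_n(R)`. -/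
def mats (K : Subgroup (SpecialLinearGroup (Fin n) R)) : Submonoid (Matrix (Fin n) (Fin n) R) where
  carrier := {M | ∃ g ∈ K, g.1 = M}
  one_mem' := ⟨1, one_mem _, rfl⟩
  mul_mem' := by
    rintro _ _ ⟨g, hg, rfl⟩ ⟨h, hh, rfl⟩
    exact ⟨g * h, mul_mem hg hh, rfl⟩

theorem coe_mem_mats {K : Subgroup (SpecialLinearGroup (Fin n) R)}
    {g : SpecialLinearGroup (Fin n) R} : g.1 ∈ mats K ↔ g ∈ K :=
  ⟨fun ⟨_, hh, e⟩ => Subtype.ext e ▸ hh, fun h => ⟨g, h, rfl⟩⟩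

theorem mats_mono {K K' : Subgroup (SpecialLinearGroup (Fin n) R)} (h : K ≤ K') :
    mats K ≤ mats K' := by
  rintro _ ⟨g, hg, rfl⟩
  exact ⟨g, h hg, rfl⟩

theorem coe_mul_inv (g : SpecialLinearGroup (Fin n) R) : g.1 * (g⁻¹).1 = 1 :=
  congrArg Subtype.val (mul_inv_cancel g)

theorem coe_inv_mul (g : SpecialLinearGroup (Fin n) R) : (g⁻¹).1 * g.1 = 1 :=
  congrArg Subtype.val (inv_mul_cancel g)

/-- The standard basis vector. -/
def e (i : Fin n) : Fin n → R := Pi.single i 1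

theorem e_dot (i : Fin n) (q : Fin n → R) : e i ⬝ᵥ q = q i := by simp [e]

theorem dot_e (i : Fin n) (q : Fin n → R) : q ⬝ᵥ e i = q i := by simp [e]

theorem e_self (i : Fin n) : (e i : Fin n → R) i = 1 := by simp [e]

theorem e_ne {i j : Fin n} (h : i ≠ j) : (e i : Fin n → R) j = 0 := by simp [e, h.symm]

theorem vecMulVec_e_e (i j : Fin n) (x : R) :
    x • vecMulVec (e i) (e j) = single i j x := by
  ext a b
  simp only [e, vecMulVec_apply, Matrix.smul_apply, Pi.single_apply, single_apply, smul_eq_mul]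
  split_ifs <;> grind

theorem transvection_val {i j : Fin n} (hij : i ≠ j) (x : R) :
    (SpecialLinearGroup.transvection hij x).1 = 1 + x • vecMulVec (e i) (e j) := by
  rw [vecMulVec_e_e]; rfl

theorem vmv_mul (p q p' q' : Fin n → R) :
    vecMulVec p q * vecMulVec p' q' = (q ⬝ᵥ p') • vecMulVec p q' := by
  rw [vecMulVec_mul_vecMulVec, vecMulVec_smul]

theorem one_add_mul_right (p q q' : Fin n → R) (x : R) (h : q ⬝ᵥ p = 0) :
    (1 + x • vecMulVec p q) * (1 + x • vecMulVec p q') = 1 + x • vecMulVec p (q + q') := by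
  rw [vecMulVec_add, add_mul, mul_add, mul_add, smul_mul_smul_comm, vmv_mul, h]
  simp [smul_add, add_assoc, add_comm]

theorem one_add_mul_left (p p' q : Fin n → R) (x : R) (h : q ⬝ᵥ p' = 0) :
    (1 + x • vecMulVec p q) * (1 + x • vecMulVec p' q) = 1 + x • vecMulVec (p + p') q := by
  rw [add_vecMulVec, add_mul, mul_add, mul_add, smul_mul_smul_comm, vmv_mul, h]
  simp [smul_add, add_assoc, add_comm]

theorem one_add_mul_coeff (p q : Fin n → R) (x y : R) (h : q ⬝ᵥ p = 0) :
    (1 + x • vecMulVec p q) * (1 + y • vecMulVec p q) = 1 + (x + y) • vecMulVec p q := by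
  rw [add_smul, add_mul, mul_add, mul_add, smul_mul_smul_comm, vmv_mul, h]
  simp [add_assoc, add_comm]

theorem det_one_add_vmv (p q : Fin n → R) (h : q ⬝ᵥ p = 0) : (1 + vecMulVec p q).det = 1 := by
  rw [vecMulVec_eq Unit, det_one_add_replicateCol_mul_replicateRow, h, add_zero]

/-- Conjugation of `1 + x p q`. -/
theorem conj_one_add (g g' : Matrix (Fin n) (Fin n) R) (h : g * g' = 1) (p q : Fin n → R) (x : R) :
    g * (1 + x • vecMulVec p q) * g' = 1 + x • vecMulVec (g *ᵥ p) (q ᵥ* g') := by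
  rw [mul_add, add_mul, mul_one, h, mul_smul_comm, smul_mul_assoc, mul_vecMulVec, vecMulVec_mul]

/-- `1 + x p q` lies in `S` for all `x ∈ I`. -/
def Good (S : Submonoid (Matrix (Fin n) (Fin n) R)) (I : Ideal R) (p q : Fin n → R) : Prop :=
  ∀ x ∈ I, 1 + x • vecMulVec p q ∈ S

variable {S : Submonoid (Matrix (Fin n) (Fin n) R)} {I : Ideal R} {p p' q q' : Fin n → R}

theorem Good.add_right (h : Good S I p q) (h' : Good S I p q') (o : q ⬝ᵥ p = 0) :
    Good S I p (q + q') := fun x hx => by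
  rw [← one_add_mul_right p q q' x o]; exact mul_mem (h x hx) (h' x hx)

theorem Good.add_left (h : Good S I p q) (h' : Good S I p' q) (o : q ⬝ᵥ p' = 0) :
    Good S I (p + p') q := fun x hx => by
  rw [← one_add_mul_left p p' q x o]; exact mul_mem (h x hx) (h' x hx)

theorem Good.smul_left (h : Good S I p q) (r : R) : Good S I (r • p) q := fun x hx => by
  rw [smul_vecMulVec, smul_smul]; exact h _ (I.mul_mem_right r hx)

theorem Good.smul_right (h : Good S I p q) (r : R) : Good S I p (r • q) := fun x hx => by
  rw [vecMulVec_smul, smul_smul]; exact h _ (I.mul_mem_right r hx)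

theorem Good.zero_right (p : Fin n → R) : Good S I p 0 := fun x _ => by
  simp [one_mem]

theorem Good.zero_left (q : Fin n → R) : Good S I 0 q := fun x _ => by
  simp [one_mem]

theorem Good.sum_right {ι : Type*} (s : Finset ι) (f : ι → Fin n → R)
    (h : ∀ i ∈ s, Good S I p (f i)) (o : ∀ i ∈ s, f i ⬝ᵥ p = 0) : Good S I p (∑ i ∈ s, f i) := by
  classical
  induction s using Finset.induction_on with
  | empty => simpa using Good.zero_right p
  | insert a s ha ih =>
    rw [Finset.sum_insert ha]
    exact (h a (by simp)).add_right (ih (fun i hi => h i (by simp [hi]))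
      fun i hi => o i (by simp [hi])) (o a (by simp))

theorem Good.sum_left {ι : Type*} (s : Finset ι) (f : ι → Fin n → R)
    (h : ∀ i ∈ s, Good S I (f i) q) (o : ∀ i ∈ s, q ⬝ᵥ f i = 0) : Good S I (∑ i ∈ s, f i) q := by
  classical
  induction s using Finset.induction_on with
  | empty => simpa using Good.zero_left q
  | insert a s ha ih =>
    rw [Finset.sum_insert ha]
    refine (h a (by simp)).add_left (ih (fun i hi => h i (by simp [hi]))
      fun i hi => o i (by simp [hi])) ?_
    rw [dotProduct_sum]
    exact Finset.sum_eq_zero fun i hi => o i (by simp [hi])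

theorem eq_sum_e (q : Fin n → R) : q = ∑ j, q j • e j := by
  ext k
  simp [e, Finset.sum_apply, Pi.single_apply]

/-- A row operation is a product of elementary ones. -/
theorem Good.row (i : Fin n) (h : ∀ j, j ≠ i → Good S I (e i) (e j)) (hq : q i = 0) :
    Good S I (e i) q := by
  rw [eq_sum_e q]
  refine Good.sum_right _ _ (fun j _ => ?_) fun j _ => ?_
  · by_cases hj : j = i
    · subst hj; rw [hq, zero_smul]; exact Good.zero_right _
    · exact (h j hj).smul_right _
  · rw [dot_e]
    by_cases hj : j = i
    · subst hj; simp [hq]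
    · simp [e_ne hj]

/-- A column operation is a product of elementary ones. -/
theorem Good.col (j : Fin n) (h : ∀ i, i ≠ j → Good S I (e i) (e j)) (hp : p j = 0) :
    Good S I p (e j) := by
  rw [eq_sum_e p]
  refine Good.sum_left _ _ (fun i _ => ?_) fun i _ => ?_
  · by_cases hi : i = j
    · subst hi; rw [hp, zero_smul]; exact Good.zero_left _
    · exact (h i hi).smul_left _
  · rw [e_dot]
    by_cases hi : i = j
    · subst hi; simp [hp]
    · simp [e_ne hi]

/-- If all `1 + x (e_i + a e_l)(e_l - a e_i)` are available, so are all `1 + x p q` with `p`, `q`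
orthogonal and supported off `l`. -/
theorem Good.of_row_index (l : Fin n) (he : ∀ i j, i ≠ j → Good S I (e i) (e j))
    (hz : ∀ i, i ≠ l → ∀ a : R, Good S I (e i + a • e l) (e l - a • e i))
    (hp : p l = 0) (hq : q l = 0) (o : q ⬝ᵥ p = 0) : Good S I p q := by
  have h1 : Good S I p (e l) := Good.col l (fun i hi => he i l hi) hp
  have h2 : Good S I p (e l - q) := by
    -- The added multiple of e_l is q · p = 0, while each summand is now orthogonal to e_l - q.
    have hp' : p = ∑ i, p i • (e i + q i • e l) := by
      simp_rw [smul_add, smul_smul]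
      rw [Finset.sum_add_distrib, ← eq_sum_e, ← Finset.sum_smul]
      have : ∑ i, p i * q i = 0 := by
        rw [dotProduct_comm] at o; exact o
      rw [this, zero_smul, add_zero]
    have ho : ∀ i, i ≠ l → (e l - q) ⬝ᵥ (e i + q i • e l) = 0 := by
      intro i hi
      simp [sub_dotProduct, dotProduct_add, dotProduct_smul, dot_e, e_self, e_ne hi.symm, hq]
    rw [hp']
    refine Good.sum_left _ _ (fun i _ => ?_) fun i _ => ?_
    · by_cases hi : i = l
      · subst hi; rw [hp, zero_smul]; exact Good.zero_left _
      · refine Good.smul_left ?_ _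
        -- The first part is an assumed matrix; the second is supported off both i and l, hence made
        -- of row operations.
        have hs : e l - q = (e l - q i • e i) + -(q - q i • e i) := by abel
        rw [hs]
        refine (hz i hi (q i)).add_right ?_ ?_
        · have : Good S I (e i + q i • e l) (q - q i • e i) := by
            refine (Good.row i (fun j hj => he i j hj.symm) ?_).add_left
              ((Good.row l (fun j hj => he l j hj.symm) ?_).smul_left _) ?_
            · simp [e_self]
            · simp [hq, e_ne hi]
            · rw [dotProduct_smul, dot_e]; simp [hq, e_ne hi]
          have := this.smul_right (-1)
          rwa [neg_one_smul] at this
        · simp [sub_dotProduct, dotProduct_add, dotProduct_smul, dot_e, e_self, e_ne hi,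
            e_ne (Ne.symm hi), smul_dotProduct]
    · by_cases hi : i = l
      · subst hi; simp [hp]
      · rw [dotProduct_smul, ho i hi, smul_zero]
  -- q is recovered as e_l - (e_l - q).
  have h3 := h1.add_right (h2.smul_right (-1)) (by rw [e_dot, hp])
  convert h3 using 1
  simp

/-- The transposed variant: `1 + x (e_l + a e_i)(e_i - a e_l)` suffice on the support of `p`, `q`. -/
theorem Good.of_col_index (l : Fin n) (he : ∀ i j, i ≠ j → Good S I (e i) (e j))
    (hz : ∀ i, i ≠ l → q i = 0 ∨ ∀ a : R, Good S I (e l + a • e i) (e i - a • e l))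
    (hp : p l = 0) (hq : q l = 0) (o : q ⬝ᵥ p = 0) : Good S I p q := by
  have h1 : Good S I (e l) q := Good.row l (fun i hi => he l i hi.symm) hq
  have h2 : Good S I (p + e l) q := by
    have hq' : q = ∑ i, q i • (e i - p i • e l) := by
      simp_rw [smul_sub, smul_smul]
      rw [Finset.sum_sub_distrib, ← eq_sum_e, ← Finset.sum_smul]
      have : ∑ i, q i * p i = 0 := o
      rw [this, zero_smul, sub_zero]
    have ho : ∀ i, i ≠ l → (e i - p i • e l) ⬝ᵥ (p + e l) = 0 := by
      intro i hi
      simp [sub_dotProduct, dotProduct_add, smul_dotProduct, e_dot, e_self, e_ne hi.symm, hp]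
    rw [hq']
    refine Good.sum_right _ _ (fun i _ => ?_) fun i _ => ?_
    · by_cases hi : i = l
      · subst hi; rw [hq, zero_smul]; exact Good.zero_right _
      · rcases hz i hi with h0 | hzi
        · rw [h0, zero_smul]; exact Good.zero_right _
        refine Good.smul_right ?_ _
        have hs : p + e l = (e l + p i • e i) + (p - p i • e i) := by abel
        rw [hs]
        refine (hzi (p i)).add_left ?_ ?_
        · have hs' : (e i - p i • e l : Fin n → R) = e i + (- p i) • e l := by rw [neg_smul, sub_eq_add_neg]
          rw [hs']
          refine (Good.col i (fun j hj => he j i hj) ?_).add_right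
            ((Good.col l (fun j hj => he j l hj) ?_).smul_right _) ?_
          · simp [e_self]
          · simp [hp, e_ne hi]
          · simp [e_dot, e_self]
        · simp [sub_dotProduct, dotProduct_sub, dotProduct_smul, e_dot, e_self, e_ne hi,
            smul_dotProduct, hp]
    · by_cases hi : i = l
      · subst hi; simp [hq]
      · rw [smul_dotProduct, ho i hi, smul_zero]
  have h3 := h2.add_left (h1.smul_left (-1)) (by rw [dotProduct_smul, dot_e, hq, smul_zero])
  convert h3 using 1
  simp

end MatrixSubmonoid

/-! ### Generators of the relative elementary group. -/

section RelativeGenerators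

variable {R : Type u} [CommRing R] {n : ℕ}

theorem trans_mulVec (k l : Fin n) (r : R) (p : Fin n → R) :
    (1 + r • vecMulVec (e k) (e l)) *ᵥ p = p + (r * p l) • e k := by
  rw [add_mulVec, one_mulVec, smul_mulVec, vecMulVec_mulVec, e_dot]
  ext i; simp [mul_assoc]

theorem trans_vecMul (k l : Fin n) (r : R) (q : Fin n → R) :
    q ᵥ* (1 + r • vecMulVec (e k) (e l)) = q + (r * q k) • e l := by
  rw [vecMul_add, vecMul_one, vecMul_smul, vecMul_vecMulVec, dot_e, smul_smul]

theorem transvection_inv_val {k l : Fin n} (h : k ≠ l) (r : R) :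
    ((SpecialLinearGroup.transvection h r)⁻¹).1 = 1 + (-r) • vecMulVec (e k) (e l) := by
  rw [SpecialLinearGroup.transvection_inv, transvection_val]

theorem conj_transvection {k l : Fin n} (h : k ≠ l) (r x : R) (p q : Fin n → R) :
    (SpecialLinearGroup.transvection h r).1 * (1 + x • vecMulVec p q) *
      ((SpecialLinearGroup.transvection h r)⁻¹).1 =
      1 + x • vecMulVec (p + (r * p l) • e k) (q - (r * q k) • e l) := by
  rw [conj_one_add _ _ (coe_mul_inv _), transvection_val, transvection_inv_val, trans_mulVec,
    trans_vecMul, neg_mul, neg_smul, sub_eq_add_neg]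

/-- Generators of `E_n(R, I)` relative to an index `o`. -/
def zGen (o : Fin n) (I : Ideal R) : Set (SpecialLinearGroup (Fin n) R) :=
  {g | ∃ x ∈ I, (∃ i j : Fin n, i ≠ j ∧ g.1 = 1 + x • vecMulVec (e i) (e j)) ∨
    ∃ (j : Fin n) (a : R), j ≠ o ∧ g.1 = 1 + x • vecMulVec (e j + a • e o) (e o - a • e j)}

theorem good_e_e {K : Subgroup (SpecialLinearGroup (Fin n) R)} {I : Ideal R}
    (h : ∀ (i j : Fin n) (hij : i ≠ j), ∀ x ∈ I, SpecialLinearGroup.transvection hij x ∈ K)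
    (i j : Fin n) (hij : i ≠ j) : Good (mats K) I (e i) (e j) := fun x hx =>
  ⟨_, h i j hij x hx, transvection_val hij x⟩

variable (o : Fin n) (I : Ideal R)

theorem zGen_good_e (i j : Fin n) (hij : i ≠ j) :
    Good (mats (Subgroup.closure (zGen o I))) I (e i) (e j) :=
  good_e_e (K := Subgroup.closure (zGen o I)) (fun i j hij x hx =>
    Subgroup.subset_closure ⟨x, hx, Or.inl ⟨i, j, hij, transvection_val hij x⟩⟩) i j hij

theorem zGen_good_z (j : Fin n) (hj : j ≠ o) (a : R) :
    Good (mats (Subgroup.closure (zGen o I))) I (e j + a • e o) (e o - a • e j) := by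
  intro x hx
  have hdet : (1 + x • vecMulVec (e j + a • e o) (e o - a • e j) : Matrix (Fin n) (Fin n) R).det = 1 := by
    rw [← smul_vecMulVec]
    apply det_one_add_vmv
    simp [sub_dotProduct, dotProduct_add, dotProduct_smul, dot_e, e_self, e_ne hj,
      e_ne hj.symm, smul_dotProduct]
  exact ⟨⟨_, hdet⟩, Subgroup.subset_closure ⟨x, hx, Or.inr ⟨j, a, hj, rfl⟩⟩, rfl⟩

theorem exists_third (hn : 3 ≤ n) (i j : Fin n) : ∃ l : Fin n, l ≠ i ∧ l ≠ j := by
  have : (({i, j} : Finset (Fin n))ᶜ).Nonempty := by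
    rw [← Finset.card_pos, Finset.card_compl, Fintype.card_fin]
    have := Finset.card_le_two (a := i) (b := j)
    omega
  obtain ⟨l, hl⟩ := this
  exact ⟨l, by simpa using hl⟩

/-- The case of vectors in the plane of `o` and `m`. A third index `l` reduces it, by
`Good.of_col_index`, to the vectors e_l + a e_i, e_i - a e_l. For i = o this is a generator. For i =
m both vectors vanish at `o`, and `Good.of_row_index` applies with index `o`. -/
theorem zGen_good_pair (hn : 3 ≤ n) (m : Fin n) (hm : m ≠ o) (p₀ p₁ q₀ q₁ : R)
    (h : q₀ * p₀ + q₁ * p₁ = 0) :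
    Good (mats (Subgroup.closure (zGen o I))) I (p₀ • e o + p₁ • e m) (q₀ • e o + q₁ • e m) := by
  obtain ⟨l, hlo, hlm⟩ := exists_third hn o m
  refine Good.of_col_index l (zGen_good_e o I) (fun i hi => ?_) ?_ ?_ ?_
  · by_cases hio : i = o
    · subst hio
      exact Or.inr fun a => zGen_good_z _ I l hlo a
    by_cases him : i = m
    · subst him
      refine Or.inr fun a => Good.of_row_index o (zGen_good_e o I) (zGen_good_z o I) ?_ ?_ ?_
      · simp [e_ne hlo, e_ne hm]
      · simp [e_ne hlo, e_ne hm]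
      · simp [sub_dotProduct, dotProduct_add, dotProduct_smul, dot_e, e_self, e_ne hi,
          e_ne hlm, smul_dotProduct]
    · left; simp [e_ne (Ne.symm hio), e_ne (Ne.symm him)]
  · simp [e_ne hlo.symm, e_ne hlm.symm]
  · simp [e_ne hlo.symm, e_ne hlm.symm]
  · simp only [add_dotProduct, dotProduct_add, dotProduct_smul, dot_e, e_self, e_ne hm,
      e_ne hm.symm, smul_dotProduct, smul_eq_mul]
    linear_combination h

/-- Conjugation by E_{ko}(r) is the hard direction of the normalizer argument. The vectors that end
up in the plane of `o` and `k` are of neither generating shape and are handled by `zGen_good_pair`;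
the other cases split into generators and row or column operations. -/
theorem zGen_conj_out (hn : 3 ≤ n) (k : Fin n) (hk : k ≠ o) (r : R)
    {g : SpecialLinearGroup (Fin n) R} (hg : g ∈ zGen o I) :
    SpecialLinearGroup.transvection hk r * g * (SpecialLinearGroup.transvection hk r)⁻¹ ∈
      Subgroup.closure (zGen o I) := by
  have he := zGen_good_e o I
  obtain ⟨x, hx, ⟨i, j, hij, hg⟩ | ⟨j, a, hj, hg⟩⟩ := hg
  · rw [← coe_mem_mats]
    change (_ * g.1) * _ ∈ _
    rw [hg, conj_transvection]
    refine (?_ : Good _ I _ _) x hx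
    by_cases hio : i = o
    · subst hio
      by_cases hjk : j = k
      · subst hjk
        convert zGen_good_pair i I hn j hk 1 r (-r) 1 (by ring) using 1
        · simp [e_self]
        · simp [e_self]; abel
      · rw [e_ne hjk, mul_zero, zero_smul, sub_zero]
        refine (he i j hij).add_left ((he k j (Ne.symm hjk)).smul_left _) ?_
        simp [dotProduct_smul, dot_e, e_ne hjk]
    · rw [e_ne hio, mul_zero, zero_smul, add_zero]
      by_cases hjk : j = k
      · subst hjk
        rw [sub_eq_add_neg, ← neg_smul]
        exact (he i j hij).add_right ((he i o hio).smul_right _) (by rw [dot_e, e_ne hij.symm])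
      · rw [e_ne hjk, mul_zero, zero_smul, sub_zero]
        exact he i j hij
  · rw [← coe_mem_mats]
    change (_ * g.1) * _ ∈ _
    rw [hg, conj_transvection]
    refine (?_ : Good _ I _ _) x hx
    by_cases hjk : j = k
    · subst hjk
      convert zGen_good_pair o I hn j hk a (1 + r * a) (1 + r * a) (-a) (by ring) using 1
      · ext i; simp [e_self, e_ne hk]; ring
      · ext i; simp [e_self, e_ne hk.symm]; ring
    · have h1 : (e j + a • e o : Fin n → R) o = a := by simp [e_ne hj, e_self]
      have h2 : (e o - a • e j : Fin n → R) k = 0 := by simp [e_ne hjk, e_ne hk.symm]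
      rw [h1, h2, mul_zero, zero_smul, sub_zero]
      refine (zGen_good_z o I j hj a).add_left ((?_ : Good _ I (e k) _).smul_left _) ?_
      · exact Good.row k (fun j hj => he k j hj.symm) h2
      · rw [dotProduct_smul, dot_e, h2, smul_zero]

/-- Conjugation by E_{ok}(r) is harmless: it shifts the parameter a of the generators with j = k by
r, makes E_{ko}(x) the one with parameter r, and alters the others by row or column operations. -/
theorem zGen_conj_in (k : Fin n) (hk : o ≠ k) (r : R)
    {g : SpecialLinearGroup (Fin n) R} (hg : g ∈ zGen o I) :
    SpecialLinearGroup.transvection hk r * g * (SpecialLinearGroup.transvection hk r)⁻¹ ∈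
      Subgroup.closure (zGen o I) := by
  have he := zGen_good_e o I
  obtain ⟨x, hx, ⟨i, j, hij, hg⟩ | ⟨j, a, hj, hg⟩⟩ := hg
  · rw [← coe_mem_mats]
    change (_ * g.1) * _ ∈ _
    rw [hg, conj_transvection]
    refine (?_ : Good _ I _ _) x hx
    by_cases hik : i = k
    · subst hik
      by_cases hjo : j = o
      · subst hjo
        convert zGen_good_z j I i hij r using 2
        · simp [e_self]
        · simp [e_self]
      · rw [e_ne hjo, mul_zero, zero_smul, sub_zero]
        refine (he i j hij).add_left ((he o j (Ne.symm hjo)).smul_left _) ?_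
        simp [dotProduct_smul, dot_e, e_ne hjo]
    · rw [e_ne hik, mul_zero, zero_smul, add_zero]
      by_cases hjo : j = o
      · subst hjo
        rw [sub_eq_add_neg, ← neg_smul]
        exact (he i j hij).add_right ((he i k hik).smul_right _) (by rw [dot_e, e_ne hij.symm])
      · rw [e_ne hjo, mul_zero, zero_smul, sub_zero]
        exact he i j hij
  · rw [← coe_mem_mats]
    change (_ * g.1) * _ ∈ _
    rw [hg, conj_transvection]
    refine (?_ : Good _ I _ _) x hx
    by_cases hjk : j = k
    · subst hjk
      convert zGen_good_z o I j hj (a + r) using 1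
      · ext i; simp [e_self, e_ne hk]; ring
      · ext i; simp [e_self, e_ne hk.symm]; ring
    · have h1 : (e j + a • e o : Fin n → R) k = 0 := by simp [e_ne hjk, e_ne hk]
      have h2 : (e o - a • e j : Fin n → R) o = 1 := by simp [e_ne hj, e_self]
      rw [h1, h2, mul_zero, zero_smul, add_zero, sub_eq_add_neg, ← neg_smul]
      refine (zGen_good_z o I j hj a).add_right ((?_ : Good _ I _ (e k)).smul_right _) ?_
      · exact Good.col k (fun j hj => he j k hj) h1
      · simp [sub_dotProduct, dotProduct_add, dotProduct_smul, dot_e, e_self, e_ne hj,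
          e_ne hj.symm, smul_dotProduct]

theorem mem_normalizer_of_conj {G : Type*} [Group G] {s : Set G} {g : G}
    (h : ∀ x ∈ s, g * x * g⁻¹ ∈ Subgroup.closure s)
    (h' : ∀ x ∈ s, g⁻¹ * x * g ∈ Subgroup.closure s) :
    g ∈ Subgroup.normalizer (Subgroup.closure s : Set G) := by
  have aux : ∀ g : G, (∀ x ∈ s, g * x * g⁻¹ ∈ Subgroup.closure s) →
      ∀ x ∈ Subgroup.closure s, g * x * g⁻¹ ∈ Subgroup.closure s := by
    intro g h x hx
    have : Subgroup.closure s ≤ (Subgroup.closure s).comap (MulAut.conj g).toMonoidHom :=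
      (Subgroup.closure_le _).2 h
    exact this hx
  rw [Subgroup.mem_normalizer_iff]
  refine fun x => ⟨aux g h x, fun hx => ?_⟩
  have := aux g⁻¹ (by simpa using h') _ hx
  simpa [mul_assoc] using this

/-- The commutator formula for transvections. -/
theorem transvection_commutator {i j k : Fin n} (hij : i ≠ j) (hjk : j ≠ k) (hik : i ≠ k)
    (a b : R) :
    SpecialLinearGroup.transvection hij a * SpecialLinearGroup.transvection hjk b *
      (SpecialLinearGroup.transvection hij a)⁻¹ * (SpecialLinearGroup.transvection hjk b)⁻¹ =
      SpecialLinearGroup.transvection hik (a * b) := by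
  apply Subtype.ext
  change (_ * _ * _) * _ = _
  rw [transvection_val hjk b, conj_transvection, transvection_inv_val, transvection_val, e_self,
    e_ne (Ne.symm hik), mul_zero, zero_smul, sub_zero, mul_one]
  have h1 : (1 + b • vecMulVec (e j + a • e i) (e k) : Matrix (Fin n) (Fin n) R) =
      (1 + b • vecMulVec (a • e i) (e k)) * (1 + b • vecMulVec (e j) (e k)) := by
    rw [one_add_mul_left _ _ _ _ (by rw [dot_e, e_ne hjk.symm]), add_comm (e j)]
  rw [h1, mul_assoc, one_add_mul_coeff _ _ _ _ (by rw [dot_e, e_ne hjk.symm]), add_neg_cancel,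
    zero_smul, add_zero, mul_one, smul_vecMulVec, smul_smul, mul_comm]

/-- `E_n(R)` is generated by the transvections in a given row and column. -/
theorem elem_le_of_index (o : Fin n) (K : Subgroup (SpecialLinearGroup (Fin n) R))
    (h1 : ∀ (k : Fin n) (hk : o ≠ k) (r : R), SpecialLinearGroup.transvection hk r ∈ K)
    (h2 : ∀ (k : Fin n) (hk : k ≠ o) (r : R), SpecialLinearGroup.transvection hk r ∈ K) :
    Elem n R ≤ K := by
  refine (Subgroup.closure_le _).2 ?_
  rintro _ ⟨i, j, hij, x, rfl⟩
  by_cases hi : i = o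
  · subst hi; exact h1 j hij x
  by_cases hj : j = o
  · subst hj; exact h2 i hij x
  rw [← mul_one x]
  rw [← transvection_commutator hi (Ne.symm hj) hij x 1]
  exact mul_mem (mul_mem (mul_mem (h2 _ _ _) (h1 _ _ _)) (inv_mem (h2 _ _ _))) (inv_mem (h1 _ _ _))

/-- For `n ≥ 3`, the group `E_n(R, I)` is generated by the `E_{ij}(x)` and the
`E_{oj}(a) E_{jo}(x) E_{oj}(-a)` with `x ∈ I`, for any fixed index `o`. -/
theorem relElem_le_zGen (hn : 3 ≤ n) : RelElem n I ≤ Subgroup.closure (zGen o I) := by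
  -- Once the generated subgroup is normalized by E_n(R), it contains all conjugates of its
  -- E_{ij}(x).
  have hN : Elem n R ≤ Subgroup.normalizer
      (Subgroup.closure (zGen o I) : Set (SpecialLinearGroup (Fin n) R)) := by
    refine elem_le_of_index o _ (fun k hk r => ?_) fun k hk r => ?_
    · refine mem_normalizer_of_conj (fun x hx => zGen_conj_in o I k hk r hx) fun x hx => ?_
      have := zGen_conj_in o I k hk (-r) hx
      rwa [← SpecialLinearGroup.transvection_inv, inv_inv] at this
    · refine mem_normalizer_of_conj (fun x hx => zGen_conj_out o I hn k hk r hx) fun x hx => ?_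
      have := zGen_conj_out o I hn k hk (-r) hx
      rwa [← SpecialLinearGroup.transvection_inv, inv_inv] at this
  refine (Subgroup.closure_le _).2 ?_
  rintro _ ⟨h, hh, i, j, hij, x, hx, rfl⟩
  exact (Subgroup.mem_normalizer_iff.1 (hN hh) _).1
    (Subgroup.subset_closure ⟨x, hx, Or.inl ⟨i, j, hij, transvection_val hij x⟩⟩)

end RelativeGenerators

/-! ### Normality, congruence and transposition for relative elementary groups. -/

section RelativeBasics

variable {R : Type u} [CommRing R] {n : ℕ} {I : Ideal R}

theorem transvection_mem_relElem {i j : Fin n} (hij : i ≠ j) {x : R} (hx : x ∈ I) :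
    SpecialLinearGroup.transvection hij x ∈ RelElem n I :=
  Subgroup.subset_closure ⟨1, one_mem _, i, j, hij, x, hx, by simp⟩

theorem relElem_le_elem : RelElem n I ≤ Elem n R := by
  refine (Subgroup.closure_le _).2 ?_
  rintro _ ⟨h, hh, i, j, hij, x, hx, rfl⟩
  exact mul_mem (mul_mem hh (transvection_mem hij x)) (inv_mem hh)

theorem relElem_conj {g h : SpecialLinearGroup (Fin n) R} (hh : h ∈ Elem n R)
    (hg : g ∈ RelElem n I) : h * g * h⁻¹ ∈ RelElem n I := by
  have : RelElem n I ≤ (RelElem n I).comap (MulAut.conj h).toMonoidHom := by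
    refine (Subgroup.closure_le _).2 ?_
    rintro _ ⟨k, hk, i, j, hij, x, hx, rfl⟩
    refine Subgroup.subset_closure ⟨h * k, mul_mem hh hk, i, j, hij, x, hx, ?_⟩
    simp [mul_assoc]
  exact this hg

theorem relElem_top : RelElem n (⊤ : Ideal R) = Elem n R := by
  refine le_antisymm relElem_le_elem ((Subgroup.closure_le _).2 ?_)
  rintro _ ⟨i, j, hij, x, rfl⟩
  exact transvection_mem_relElem hij Submodule.mem_top

theorem relElem_le_relSL : RelElem n I ≤ RelSL n I := by
  refine (Subgroup.closure_le _).2 ?_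
  rintro _ ⟨h, hh, i, j, hij, x, hx, rfl⟩
  change SpecialLinearGroup.map _ _ = 1
  rw [map_mul, map_mul, map_inv, map_transvection, Ideal.Quotient.eq_zero_iff_mem.2 hx,
    SpecialLinearGroup.transvection_coeff_zero, mul_one, mul_inv_cancel]

theorem good_relElem (i j : Fin n) (hij : i ≠ j) : Good (mats (RelElem n I)) I (e i) (e j) :=
  good_e_e (fun _ _ hij _ hx => transvection_mem_relElem hij hx) i j hij

theorem transvection_transpose {i j : Fin n} (hij : i ≠ j) (x : R) :
    (SpecialLinearGroup.transvection hij x).1ᵀ =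
      (SpecialLinearGroup.transvection hij.symm x).1 := by
  rw [transvection_val, transvection_val, transpose_add, transpose_one, transpose_smul,
    transpose_vecMulVec]

theorem transpose_mem_closure {s : Set (SpecialLinearGroup (Fin n) R)}
    {g : SpecialLinearGroup (Fin n) R} (hg : g ∈ Subgroup.closure s) :
    g.transpose ∈ Subgroup.closure {g | g.transpose ∈ s} := by
  induction hg using Subgroup.closure_induction with
  | mem x hx =>
    refine Subgroup.subset_closure ?_
    have : x.transpose.transpose = x := Subtype.ext (transpose_transpose x.1)
    rwa [Set.mem_ofPred_eq, this]
  | one =>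
    have : (1 : SpecialLinearGroup (Fin n) R).transpose = 1 := Subtype.ext transpose_one
    rw [this]; exact one_mem _
  | mul x y _ _ hx hy =>
    have : (x * y).transpose = y.transpose * x.transpose := Subtype.ext (transpose_mul x.1 y.1)
    rw [this]; exact mul_mem hy hx
  | inv x _ hx =>
    have : (x⁻¹).transpose = x.transpose⁻¹ := eq_inv_of_mul_eq_one_left (Subtype.ext (by
      change (x⁻¹).1ᵀ * x.1ᵀ = 1
      rw [← transpose_mul, coe_mul_inv, transpose_one]))
    rw [this]; exact inv_mem hx

theorem transpose_transpose_SL (g : SpecialLinearGroup (Fin n) R) : g.transpose.transpose = g :=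
  Subtype.ext (transpose_transpose g.1)

theorem elem_transpose {g : SpecialLinearGroup (Fin n) R} (hg : g ∈ Elem n R) :
    g.transpose ∈ Elem n R := by
  refine Subgroup.closure_mono ?_ (transpose_mem_closure hg)
  rintro g ⟨i, j, hij, x, h⟩
  refine ⟨j, i, hij.symm, x, ?_⟩
  rw [← transpose_transpose_SL g, h]
  exact Subtype.ext (transvection_transpose hij x)

theorem relElem_transpose {g : SpecialLinearGroup (Fin n) R} (hg : g ∈ RelElem n I) :
    g.transpose ∈ RelElem n I := by
  refine (Subgroup.closure_le (RelElem n I)).2 ?_ (transpose_mem_closure hg)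
  rintro g ⟨h, hh, i, j, hij, x, hx, hg⟩
  have : g = (h⁻¹).transpose * SpecialLinearGroup.transvection hij.symm x *
      ((h⁻¹).transpose)⁻¹ := by
    rw [← transpose_transpose_SL g, hg, eq_mul_inv_iff_mul_eq]
    apply Subtype.ext
    change (h.1 * (SpecialLinearGroup.transvection hij x).1 * (h⁻¹).1)ᵀ * (h⁻¹).1ᵀ =
      (h⁻¹).1ᵀ * (SpecialLinearGroup.transvection hij.symm x).1
    rw [← transpose_mul, ← transvection_transpose hij, ← transpose_mul, ← mul_assoc,
      ← mul_assoc, coe_inv_mul, one_mul]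
  rw [this]
  exact relElem_conj (elem_transpose (inv_mem hh)) (transvection_mem_relElem _ hx)

theorem zGen_subset (o : Fin n) : zGen o I ⊆ RelElem n I := by
  rintro g ⟨x, hx, ⟨i, j, hij, h⟩ | ⟨j, a, hj, h⟩⟩
  · rw [← transvection_val hij] at h
    rw [Subtype.ext h]
    exact transvection_mem_relElem hij hx
  · have := relElem_conj (transvection_mem hj.symm a) (transvection_mem_relElem hj hx)
    have e1 : g = SpecialLinearGroup.transvection hj.symm a * SpecialLinearGroup.transvection hj x *
        (SpecialLinearGroup.transvection hj.symm a)⁻¹ := by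
      apply Subtype.ext
      change _ = (_ * _) * _
      rw [h, transvection_val hj, conj_transvection, e_self, e_self, mul_one]
    rw [e1]
    exact this

end RelativeBasics

/-! ### Orbits of rows. -/

section OrbitRelation

variable {R : Type u} [CommRing R] {S : Type v} [CommRing S] {n : ℕ}

/-- Two rows lie in the same orbit of `K`. -/
def Orb (K : Subgroup (SpecialLinearGroup (Fin n) R)) (v w : Fin n → R) : Prop :=
  ∃ M ∈ mats K, v ᵥ* M = w

variable {K : Subgroup (SpecialLinearGroup (Fin n) R)} {u' v w : Fin n → R}

theorem Orb.refl (v : Fin n → R) : Orb K v v := ⟨1, one_mem _, vecMul_one v⟩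

theorem Orb.symm (h : Orb K v w) : Orb K w v := by
  obtain ⟨_, ⟨g, hg, rfl⟩, rfl⟩ := h
  exact ⟨_, ⟨g⁻¹, inv_mem hg, rfl⟩, by rw [vecMul_vecMul, coe_mul_inv, vecMul_one]⟩

theorem Orb.trans (h : Orb K u' v) (h' : Orb K v w) : Orb K u' w := by
  obtain ⟨M, hM, rfl⟩ := h
  obtain ⟨N, hN, rfl⟩ := h'
  exact ⟨M * N, mul_mem hM hN, by rw [vecMul_vecMul]⟩

theorem Orb.mono {K' : Subgroup (SpecialLinearGroup (Fin n) R)} (h : K ≤ K') (hv : Orb K v w) :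
    Orb K' v w := by
  obtain ⟨M, hM, e⟩ := hv
  exact ⟨M, mats_mono h hM, e⟩

theorem Orb.of_mem {g : SpecialLinearGroup (Fin n) R} (hg : g ∈ K) (v : Fin n → R) :
    Orb K v (v ᵥ* g.1) := ⟨g.1, coe_mem_mats.2 hg, rfl⟩

/-- Adding `c v_i` to `v_j`. -/
theorem Orb.add {i j : Fin n} (hij : i ≠ j) {c : R}
    (hc : SpecialLinearGroup.transvection hij c ∈ K) (v : Fin n → R) :
    Orb K v (v + (c * v i) • e j) := by
  have := Orb.of_mem hc v
  rwa [transvection_val, trans_vecMul] at this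

/-- Adding `(v · p) q` to `v`. -/
theorem Orb.add_vmv {p q : Fin n → R} (h : 1 + vecMulVec p q ∈ mats K) (v : Fin n → R) :
    Orb K v (v + (v ⬝ᵥ p) • q) := by
  refine ⟨_, h, ?_⟩
  rw [vecMul_add, vecMul_one, vecMul_vecMulVec]

theorem Orb.conj {g : SpecialLinearGroup (Fin n) R} (hg : ∀ k ∈ K, g⁻¹ * k * g ∈ K)
    (h : Orb K v w) : Orb K (v ᵥ* g.1) (w ᵥ* g.1) := by
  obtain ⟨_, ⟨k, hk, rfl⟩, rfl⟩ := h
  refine ⟨_, ⟨_, hg k hk, rfl⟩, ?_⟩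
  change _ ᵥ* ((g⁻¹).1 * k.1 * g.1) = _
  rw [vecMul_vecMul, vecMul_vecMul, ← mul_assoc, ← mul_assoc, coe_mul_inv, one_mul]

/-- If the generators of a group move the elements of `U` within their `K`-orbits, so does the
whole group. -/
theorem orb_of_closure {s : Set (SpecialLinearGroup (Fin n) R)} {U : Set (Fin n → R)}
    (hU : ∀ g ∈ s, ∀ v, v ∈ U ↔ v ᵥ* g.1 ∈ U) (h : ∀ g ∈ s, ∀ v ∈ U, Orb K v (v ᵥ* g.1))
    {g : SpecialLinearGroup (Fin n) R} (hg : g ∈ Subgroup.closure s) {v : Fin n → R}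
    (hv : v ∈ U) : Orb K v (v ᵥ* g.1) := by
  suffices ∀ v, (v ∈ U ↔ v ᵥ* g.1 ∈ U) ∧ (v ∈ U → Orb K v (v ᵥ* g.1)) from (this v).2 hv
  clear hv v
  induction hg using Subgroup.closure_induction with
  | mem x hx => exact fun v => ⟨hU x hx v, h x hx v⟩
  | one =>
    intro v
    have : v ᵥ* (1 : SpecialLinearGroup (Fin n) R).1 = v := vecMul_one v
    rw [this]
    exact ⟨Iff.rfl, fun _ => Orb.refl v⟩
  | mul x y _ _ hx hy =>
    intro v
    have : v ᵥ* (x * y).1 = (v ᵥ* x.1) ᵥ* y.1 := by rw [vecMul_vecMul]; rfl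
    rw [this]
    exact ⟨(hx v).1.trans (hy _).1, fun hv => ((hx v).2 hv).trans ((hy _).2 ((hx v).1.1 hv))⟩
  | inv x _ hx =>
    intro v
    have := hx (v ᵥ* (x⁻¹).1)
    rw [vecMul_vecMul, coe_inv_mul, vecMul_one] at this
    exact ⟨this.1.symm, fun hv => (this.2 (this.1.2 hv)).symm⟩

theorem IsUnimodular.vecMul {v : Fin n → R} (hv : IsUnimodular v)
    (g : SpecialLinearGroup (Fin n) R) : IsUnimodular (v ᵥ* g.1) := by
  obtain ⟨w, hw⟩ := hv
  refine ⟨(g⁻¹).1 *ᵥ w, ?_⟩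
  rw [dotProduct_mulVec, vecMul_vecMul, coe_mul_inv, vecMul_one, hw]

theorem isUnimodular_vecMul_iff {v : Fin n → R} (g : SpecialLinearGroup (Fin n) R) :
    IsUnimodular (v ᵥ* g.1) ↔ IsUnimodular v := by
  refine ⟨fun h => ?_, fun h => h.vecMul g⟩
  have := h.vecMul g⁻¹
  rwa [vecMul_vecMul, coe_mul_inv, vecMul_one] at this

theorem Orb.isUnimodular (h : Orb K v w) (hv : IsUnimodular v) : IsUnimodular w := by
  obtain ⟨_, ⟨g, _, rfl⟩, rfl⟩ := h
  exact hv.vecMul g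

theorem IsUnimodular.map (f : R →+* S) {v : Fin n → R} (hv : IsUnimodular v) :
    IsUnimodular (f ∘ v) := by
  obtain ⟨w, hw⟩ := hv
  refine ⟨f ∘ w, ?_⟩
  have := congrArg f hw
  rw [map_one] at this
  rw [← this]
  simp [dotProduct]

end OrbitRelation

/-! ### Rows congruent to e₁. -/

section Congruence

variable {R : Type u} [CommRing R] {n : ℕ} [NeZero n] {I : Ideal R}

/-- The row `v` is congruent to `e₁` mod `I`. -/
def Congr (I : Ideal R) (v : Fin n → R) : Prop := ∀ i, v i - (e 0 : Fin n → R) i ∈ I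

theorem Congr.zero {v : Fin n → R} (h : Congr I v) : v 0 - 1 ∈ I := by
  simpa [e] using h 0

theorem Congr.ne {v : Fin n → R} (h : Congr I v) {i : Fin n} (hi : i ≠ 0) : v i ∈ I := by
  simpa [e, hi] using h i

theorem congr_iff {v : Fin n → R} : Congr I v ↔ v 0 - 1 ∈ I ∧ ∀ i, i ≠ 0 → v i ∈ I := by
  refine ⟨fun h => ⟨h.zero, fun i hi => h.ne hi⟩, fun h i => ?_⟩
  by_cases hi : i = 0
  · subst hi; simpa [e] using h.1
  · simpa [e, hi] using h.2 i hi

theorem congr_iff_mk {v : Fin n → R} :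
    Congr I v ↔ Ideal.Quotient.mk I ∘ v = e 0 := by
  rw [funext_iff]
  refine forall_congr' fun i => ?_
  rw [← Ideal.Quotient.eq, Function.comp]
  have : Ideal.Quotient.mk I ((e 0 : Fin n → R) i) = (e 0 : Fin n → R ⧸ I) i := by
    by_cases hi : i = 0
    · subst hi; simp [e]
    · simp [e, hi]
  rw [this]

theorem congr_e_zero : Congr I (e 0 : Fin n → R) := fun i => by simp

/-- A relative unimodular row has a relative dual. -/
theorem exists_congr_dual {v : Fin n → R} (hv : IsUnimodular v) (h : Congr I v) :
    ∃ w, v ⬝ᵥ w = 1 ∧ Congr I w := by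
  obtain ⟨w, hw⟩ := hv
  have h1 : ∀ i, i ≠ 0 → v i * w i ∈ I := fun i hi => I.mul_mem_right _ (h.ne hi)
  have ht : 1 - v 0 * w 0 ∈ I := by
    have : 1 - v 0 * w 0 = ∑ i ∈ Finset.univ.erase 0, v i * w i := by
      rw [← hw, dotProduct, ← Finset.add_sum_erase _ _ (Finset.mem_univ 0)]
      ring
    rw [this]
    exact Ideal.sum_mem _ fun i hi => h1 i (Finset.ne_of_mem_erase hi)
  -- Pairing with v gives (1 - v₀w₀) + v₀w₀ = 1, and modulo I only w₀ e₁ with w₀ ≡ 1 survives.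
  refine ⟨(1 - v 0 * w 0) • w + w 0 • e 0, ?_, congr_iff.2 ⟨?_, fun i hi => ?_⟩⟩
  · rw [dotProduct_add, dotProduct_smul, dotProduct_smul, hw, dot_e, smul_eq_mul, smul_eq_mul]
    ring
  · have : ((1 - v 0 * w 0) • w + w 0 • e 0 : Fin n → R) 0 - 1 =
        (1 - v 0 * w 0) * (w 0 - 1) - (v 0 - 1) * w 0 := by
      simp [e]; ring
    rw [this]
    exact I.sub_mem (I.mul_mem_right _ ht) (I.mul_mem_right _ h.zero)
  · simpa [e, hi] using I.mul_mem_right _ ht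

theorem congr_vecMul_iff {v : Fin n → R} {g : SpecialLinearGroup (Fin n) R} (hg : g ∈ RelSL n I) :
    Congr I (v ᵥ* g.1) ↔ Congr I v := by
  have h1 : Ideal.Quotient.mk I ∘ (v ᵥ* g.1) = Ideal.Quotient.mk I ∘ v := by
    have : (SpecialLinearGroup.map (Ideal.Quotient.mk I) g).1 = 1 := congrArg Subtype.val hg
    calc Ideal.Quotient.mk I ∘ (v ᵥ* g.1) =
        (Ideal.Quotient.mk I ∘ v) ᵥ* (SpecialLinearGroup.map (Ideal.Quotient.mk I) g).1 := by
          ext i; simp [vecMul, dotProduct]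
      _ = _ := by rw [this, vecMul_one]
  rw [congr_iff_mk, congr_iff_mk, h1]

theorem Orb.congr_iff {v w : Fin n → R} (h : Orb (RelElem n I) v w) : Congr I v ↔ Congr I w := by
  obtain ⟨_, ⟨g, hg, rfl⟩, rfl⟩ := h
  exact (congr_vecMul_iff (relElem_le_relSL hg)).symm

/-- Off the first row and column, elementary matrices act trivially on relative orbits. -/
theorem orb_transvection_off {i j : Fin n} (hi : i ≠ 0) (hj : j ≠ 0) (hij : i ≠ j) (a : R)
    {v : Fin n → R} (hv : Congr I v) :
    Orb (RelElem n I) v (v ᵥ* (SpecialLinearGroup.transvection hij a).1) := by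
  -- Adding a v_i to v_j is done in two steps with coefficients in I: first (a v_i) v₀, then -a(v₀ -
  -- 1) v_i.
  have h1 := Orb.add (K := RelElem n I) (Ne.symm hj)
    (transvection_mem_relElem _ (I.mul_mem_left a (hv.ne hi))) v
  have h2 := Orb.add (K := RelElem n I) hij
    (transvection_mem_relElem _ (I.mul_mem_left (-a) hv.zero)) (v + (a * v i * v 0) • e j)
  refine (h1.trans h2).trans ?_
  rw [transvection_val, trans_vecMul]
  convert Orb.refl _ using 1
  ext k
  simp only [Pi.add_apply, Pi.smul_apply, smul_eq_mul, e_ne (Ne.symm hij)]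
  ring

theorem congr_vecMul_transvection {i j : Fin n} (hi : i ≠ 0) (hij : i ≠ j) (a : R)
    {v : Fin n → R} (hv : Congr I v) :
    Congr I (v ᵥ* (SpecialLinearGroup.transvection hij a).1) := by
  rw [transvection_val, trans_vecMul]
  intro k
  have : (v + (a * v i) • e j : Fin n → R) k - (e 0 : Fin n → R) k =
      (v k - (e 0 : Fin n → R) k) + v i * (a * (e j : Fin n → R) k) := by
    simp; ring
  rw [this]
  exact I.add_mem (hv k) (I.mul_mem_right _ (hv.ne hi))

/-- Elementary matrices not in the first row act trivially on relative orbits. -/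
theorem orb_transvection_ne (hn : 3 ≤ n) {i j : Fin n} (hi : i ≠ 0) (hij : i ≠ j) (a : R)
    {v : Fin n → R} (hv : Congr I v) :
    Orb (RelElem n I) v (v ᵥ* (SpecialLinearGroup.transvection hij a).1) := by
  by_cases hj : j = 0
  swap
  · exact orb_transvection_off hi hj hij a hv
  subst hj
  obtain ⟨k, hk0, hki⟩ := exists_third hn 0 i
  -- E_{i0}(a) is the commutator of E_{ik}(a) and E_{k0}(1). The factors E_{ik}(±a) preserve
  -- relative orbits; the second of them is conjugated by E_{k0}(1), which normalizes E_n(R, I).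
  have hc := transvection_commutator (Ne.symm hki) hk0 hij a 1
  rw [mul_one] at hc
  set τ := SpecialLinearGroup.transvection hk0 (1 : R) with hτ
  set σ := SpecialLinearGroup.transvection (Ne.symm hki) a with hσ
  rw [← hc]
  have h1 : Orb (RelElem n I) v (v ᵥ* σ.1) := orb_transvection_off hi hk0 _ a hv
  have hv1 : Congr I (v ᵥ* σ.1) := congr_vecMul_transvection hi _ a hv
  have hv2 : Congr I (v ᵥ* σ.1 ᵥ* τ.1) := congr_vecMul_transvection hk0 _ 1 hv1
  have h2 : Orb (RelElem n I) (v ᵥ* σ.1 ᵥ* τ.1) (v ᵥ* σ.1 ᵥ* τ.1 ᵥ* (σ⁻¹).1) := by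
    rw [hσ, SpecialLinearGroup.transvection_inv]
    exact orb_transvection_off hi hk0 _ _ hv2
  have h3 := h2.conj (g := τ⁻¹) (fun k hk => by
    rw [inv_inv]; exact relElem_conj (transvection_mem _ _) hk)
  have h4 : v ᵥ* σ.1 ᵥ* τ.1 ᵥ* (τ⁻¹).1 = v ᵥ* σ.1 := by
    rw [vecMul_vecMul, coe_mul_inv, vecMul_one]
  rw [h4] at h3
  refine (h1.trans h3).trans ?_
  convert Orb.refl _ using 1
  change v ᵥ* (σ.1 * τ.1 * (σ⁻¹).1 * (τ⁻¹).1) = _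
  simp only [vecMul_vecMul]

end Congruence

/-! ### Elementary matrices and a retraction. -/

section Split

variable {A : Type u} [CommRing A] {B : Type v} [CommRing B] {n : ℕ}

/-- The assignment g ↦ g r(g)⁻¹ is a crossed homomorphism, so normality of the relative group
reduces the claim to generators. In particular an elementary g with r(g) = 1 is relative elementary.
-/
theorem split_mem_relElem {J : Ideal A} (r : A →+* A) (hr : ∀ x, x - r x ∈ J)
    {g : SpecialLinearGroup (Fin n) A} (hg : g ∈ Elem n A) :
    g * (SpecialLinearGroup.map r g)⁻¹ ∈ RelElem n J := by
  induction hg using Subgroup.closure_induction with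
  | mem x hx =>
    obtain ⟨i, j, hij, x, rfl⟩ := hx
    rw [map_transvection, SpecialLinearGroup.transvection_inv,
      ← SpecialLinearGroup.transvection_add, ← sub_eq_add_neg]
    exact transvection_mem_relElem hij (hr x)
  | one => simp [one_mem]
  | mul x y hx _ ihx ihy =>
    have : x * y * (SpecialLinearGroup.map r (x * y))⁻¹ =
        (x * (y * (SpecialLinearGroup.map r y)⁻¹) * x⁻¹) * (x * (SpecialLinearGroup.map r x)⁻¹) := by
      rw [map_mul]; group
    rw [this]
    exact mul_mem (relElem_conj hx ihy) ihx
  | inv x hx ih =>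
    have : x⁻¹ * (SpecialLinearGroup.map r x⁻¹)⁻¹ =
        x⁻¹ * (x * (SpecialLinearGroup.map r x)⁻¹)⁻¹ * x⁻¹⁻¹ := by
      rw [map_inv]; group
    rw [this]
    exact relElem_conj (inv_mem hx) (inv_mem ih)

end Split

/-! ### Euclid's algorithm and the stabilizer of e₁ in SL₃(ℤ). -/

section Integers

variable {n : ℕ}

/-- Euclidean reduction of an integral row. -/
theorem orb_int_smul [NeZero n] (v : Fin n → ℤ) :
    ∃ k : ℤ, Orb (Elem n ℤ) v (k • e 0) := by
  induction hs : ∑ i, (v i).natAbs using Nat.strong_induction_on generalizing v with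
  | _ s ih =>
    -- Division of the larger of two nonzero entries by the smaller lowers the sum of absolute
    -- values; if no such pair exists, at most one entry is nonzero.
    by_cases h : ∃ i j, i ≠ j ∧ v i ≠ 0 ∧ v j ≠ 0 ∧ (v i).natAbs ≤ (v j).natAbs
    · obtain ⟨i, j, hij, hi, hj, hle⟩ := h
      have h1 := Orb.add (K := Elem n ℤ) hij (transvection_mem hij (-(v j / v i))) v
      have hlt : ∑ l, ((v + (-(v j / v i) * v i) • e j : Fin n → ℤ) l).natAbs < s := by
        rw [← hs]
        refine Finset.sum_lt_sum (fun l _ => ?_) ⟨j, Finset.mem_univ j, ?_⟩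
        · by_cases hl : l = j
          · subst hl
            have : (v + (-(v l / v i) * v i) • e l : Fin n → ℤ) l = v l % v i := by
              simp [e_self, Int.emod_def]; ring
            rw [this]
            have := Int.emod_nonneg (v l) hi
            have := Int.emod_lt_abs (v l) hi
            rw [Int.abs_eq_natAbs] at this
            omega
          · simp [e_ne (Ne.symm hl)]
        · have : (v + (-(v j / v i) * v i) • e j : Fin n → ℤ) j = v j % v i := by
            simp [e_self, Int.emod_def]; ring
          rw [this]
          have := Int.emod_nonneg (v j) hi
          have := Int.emod_lt_abs (v j) hi
          rw [Int.abs_eq_natAbs] at this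
          omega
      obtain ⟨k, hk⟩ := ih _ hlt _ rfl
      exact ⟨k, h1.trans hk⟩
    · have hu : ∃ i, ∀ j, j ≠ i → v j = 0 := by
        by_cases h0 : ∃ i, v i ≠ 0
        · obtain ⟨i, hi⟩ := h0
          refine ⟨i, fun j hj => ?_⟩
          by_contra hvj
          rcases le_total (v i).natAbs (v j).natAbs with hle | hle
          · exact h ⟨i, j, hj.symm, hi, hvj, hle⟩
          · exact h ⟨j, i, hj, hvj, hi, hle⟩
        · push Not at h0
          exact ⟨0, fun j _ => h0 j⟩
      obtain ⟨i, hi⟩ := hu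
      have hv : v = v i • e i := by
        ext j
        by_cases hj : j = i
        · subst hj; simp [e_self]
        · simp [hi j hj, e_ne (Ne.symm hj)]
      refine ⟨v i, ?_⟩
      by_cases hi0 : i = 0
      · subst hi0; rw [← hv]; exact Orb.refl _
      have h1 := Orb.add (K := Elem n ℤ) hi0 (transvection_mem hi0 1) v
      have h2 := Orb.add (K := Elem n ℤ) (Ne.symm hi0) (transvection_mem (Ne.symm hi0) (-1))
        (v + (1 * v i) • e 0)
      refine (h1.trans h2).trans ?_
      convert Orb.refl _ using 1
      ext j
      by_cases hj : j = i
      · subst hj; simp [e_ne (Ne.symm hi0), e_self, hi 0 (Ne.symm hi0)]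
      · simp [hi j hj, e_ne (Ne.symm hj), hi 0 (Ne.symm hi0), e_self]

theorem orb_int_unimodular [NeZero n] (hn : 2 ≤ n) {v : Fin n → ℤ} (hv : IsUnimodular v) :
    Orb (Elem n ℤ) v (e 0) := by
  obtain ⟨k, hk⟩ := orb_int_smul v
  refine hk.trans ?_
  obtain ⟨w, hw⟩ := hk.isUnimodular hv
  rw [smul_dotProduct, e_dot] at hw
  have hk1 : k = 1 ∨ k = -1 := Int.isUnit_iff.1 (.of_mul_eq_one _ hw)
  rcases hk1 with rfl | rfl
  · rw [one_smul]; exact Orb.refl _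
  have h01 : (0 : Fin n) ≠ ⟨1, by omega⟩ := by
    rw [Ne, Fin.ext_iff]; simp
  set j : Fin n := ⟨1, by omega⟩
  -- On the entries 0 and j the row runs through (-1, 0), (-1, 1), (1, 1), (1, 0).
  refine (Orb.add h01 (transvection_mem h01 (-1)) _).trans
    ((Orb.add h01.symm (transvection_mem h01.symm 2) _).trans
    ((Orb.add h01 (transvection_mem h01 (-1)) _).trans ?_))
  convert Orb.refl _ using 1
  ext l
  simp only [Pi.add_apply, Pi.smul_apply, smul_eq_mul, e_self, e_ne h01, e_ne h01.symm]
  ring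

/-- The inclusion `SL₂ → SL₃`, `α ↦ 1 ⊥ α`. -/
def sl2Hom (R : Type*) [CommRing R] :
    SpecialLinearGroup (Fin 2) R →* SpecialLinearGroup (Fin 3) R where
  toFun α := ⟨!![1, 0, 0; 0, α.1 0 0, α.1 0 1; 0, α.1 1 0, α.1 1 1], by
    have := α.2
    rw [det_fin_two] at this
    simp [det_fin_three]
    linear_combination this⟩
  map_one' := by
    apply Subtype.ext
    ext i j
    fin_cases i <;> fin_cases j <;> simp
  map_mul' α β := by
    apply Subtype.ext
    change _ = _ * _
    ext i j
    fin_cases i <;> fin_cases j <;>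
      simp [mul_apply, Fin.sum_univ_succ]

theorem sl2Hom_val {R : Type*} [CommRing R] (α : SpecialLinearGroup (Fin 2) R) :
    (sl2Hom R α).1 = !![1, 0, 0; 0, α.1 0 0, α.1 0 1; 0, α.1 1 0, α.1 1 1] := rfl

/-- The elementary matrices outside the first row. -/
def lowerGen (n : ℕ) [NeZero n] (R : Type*) [CommRing R] :
    Set (SpecialLinearGroup (Fin n) R) :=
  {g | ∃ (i j : Fin n) (_ : i ≠ 0) (hij : i ≠ j) (x : R), g = SpecialLinearGroup.transvection hij x}

theorem sl2Hom_mem (α : SpecialLinearGroup (Fin 2) ℤ) :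
    sl2Hom ℤ α ∈ Subgroup.closure (lowerGen 3 ℤ) := by
  have h12 : (1 : Fin 3) ≠ 2 := by decide
  have hg : ∀ {i j : Fin 3} (_ : i ≠ 0) (hij : i ≠ j) (x : ℤ),
      SpecialLinearGroup.transvection hij x ∈ Subgroup.closure (lowerGen 3 ℤ) :=
    fun hi hij x => Subgroup.subset_closure ⟨_, _, hi, hij, x, rfl⟩
  have hT : sl2Hom ℤ ModularGroup.T = SpecialLinearGroup.transvection h12 1 := by
    apply Subtype.ext
    rw [sl2Hom_val, transvection_val, vecMulVec_e_e]
    ext i j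
    fin_cases i <;> fin_cases j <;> simp [ModularGroup.T]
  have hS : sl2Hom ℤ ModularGroup.S = SpecialLinearGroup.transvection h12 (-1) *
      SpecialLinearGroup.transvection h12.symm 1 * SpecialLinearGroup.transvection h12 (-1) := by
    apply Subtype.ext
    change _ = _ * _ * _
    rw [sl2Hom_val, transvection_val, transvection_val, vecMulVec_e_e, vecMulVec_e_e]
    ext i j
    fin_cases i <;> fin_cases j <;>
      simp [ModularGroup.S, single_apply, mul_apply, Fin.sum_univ_succ, one_apply]
  have : (⊤ : Subgroup (SpecialLinearGroup (Fin 2) ℤ)) ≤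
      (Subgroup.closure (lowerGen 3 ℤ)).comap (sl2Hom ℤ) := by
    rw [← SpecialLinearGroup.SL2Z_generators]
    refine (Subgroup.closure_le _).2 ?_
    rintro g (rfl | rfl)
    · rw [SetLike.mem_coe, Subgroup.mem_comap]
      rw [hS]
      exact mul_mem (mul_mem (hg (by decide) _ _) (hg (by decide) _ _)) (hg (by decide) _ _)
    · rw [SetLike.mem_coe, Subgroup.mem_comap]
      rw [hT]
      exact hg (by decide) _ _
  exact this (Subgroup.mem_top α)

/-- The stabilizer of `e₁` in `SL₃(ℤ)`. -/
theorem mem_lowerGen_of_stabilizer {g : SpecialLinearGroup (Fin 3) ℤ}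
    (h : (e 0 : Fin 3 → ℤ) ᵥ* g.1 = e 0) : g ∈ Subgroup.closure (lowerGen 3 ℤ) := by
  have h0 : ∀ j, g.1 0 j = (e 0 : Fin 3 → ℤ) j := fun j => by
    have := congrFun h j
    rwa [vecMul, e_dot] at this
  have h00 : g.1 0 0 = 1 := by rw [h0]; simp [e]
  have h01 : g.1 0 1 = 0 := by rw [h0]; simp [e]
  have h02 : g.1 0 2 = 0 := by rw [h0]; simp [e]
  have hd : g.1 1 1 * g.1 2 2 - g.1 1 2 * g.1 2 1 = 1 := by
    have := g.2
    rw [det_fin_three, h00, h01, h02] at this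
    linear_combination this
  let α : SpecialLinearGroup (Fin 2) ℤ := ⟨!![g.1 1 1, g.1 1 2; g.1 2 1, g.1 2 2], by
    rw [det_fin_two]; simpa using hd⟩
  have h10 : (1 : Fin 3) ≠ 0 := by decide
  have h20 : (2 : Fin 3) ≠ 0 := by decide
  have : g = SpecialLinearGroup.transvection h10 (g.1 1 0) *
      SpecialLinearGroup.transvection h20 (g.1 2 0) * sl2Hom ℤ α := by
    apply Subtype.ext
    change _ = _ * _ * _
    rw [sl2Hom_val, transvection_val, transvection_val, vecMulVec_e_e, vecMulVec_e_e]
    ext i j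
    fin_cases i <;> fin_cases j <;>
      simp [α, single_apply, mul_apply, Fin.sum_univ_succ, h00, h01, h02, one_apply]
  rw [this]
  exact mul_mem (mul_mem (Subgroup.subset_closure ⟨1, 0, h10, h10, _, rfl⟩)
    (Subgroup.subset_closure ⟨2, 0, h20, h20, _, rfl⟩)) (sl2Hom_mem α)

end Integers

/-! ### Relative orbits over R and over the excision ring. -/

section Excision

variable {R : Type u} [CommRing R] {I : Ideal R}

theorem Exc.mem_ideal {x : Exc I} : x ∈ Exc.ideal I ↔ x.fst = 0 := Iff.rfl

theorem Exc.toRing_apply (x : Exc I) : Exc.toRing I x = (x.fst : R) + (x.snd : R) := rfl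

/-- The retraction of `ℤ ⊕ I` onto `ℤ`. -/
def Exc.retr (I : Ideal R) : Exc I →+* Exc I :=
  (Int.castRingHom (Exc I)).comp (Unitization.fstHom ℤ I : Exc I →+* ℤ)

theorem Exc.fst_intCast (m : ℤ) : (m : Exc I).fst = m :=
  map_intCast (Unitization.fstHom ℤ I) m

theorem Exc.sub_retr (x : Exc I) : x - Exc.retr I x ∈ Exc.ideal I := by
  rw [Exc.mem_ideal]
  change x.fst - ((x.fst : ℤ) : Exc I).fst = 0
  rw [Exc.fst_intCast, sub_self]

theorem Exc.toRing_inr (x : I) : Exc.toRing I (Unitization.inr x) = x := by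
  simp [Exc.toRing_apply]

theorem Exc.inr_mem (x : I) : (Unitization.inr x : Exc I) ∈ Exc.ideal I := by
  simp [Exc.mem_ideal]

theorem Exc.toRing_mem {x : Exc I} (hx : x ∈ Exc.ideal I) : Exc.toRing I x ∈ I := by
  rw [Exc.mem_ideal] at hx
  simp [Exc.toRing_apply, hx]

/-- The two homomorphisms to ℤ and to R are jointly injective; equations over ℤ ⊕ I are checked in
both places. -/
theorem Exc.ext_of {x y : Exc I} (h : x - y ∈ Exc.ideal I)
    (h' : Exc.toRing I x = Exc.toRing I y) : x = y := by
  rw [Exc.mem_ideal] at h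
  have h1 : x.fst = y.fst := sub_eq_zero.1 h
  refine Unitization.ext h1 (Subtype.ext ?_)
  simpa [Exc.toRing_apply, h1] using h'

theorem Exc.le_comap (I : Ideal R) : Exc.ideal I ≤ I.comap (Exc.toRing I) :=
  fun _ hx => Exc.toRing_mem hx

variable {n : ℕ}

/-- The image of `E_n(ℤ ⊕ I, 0 ⊕ I)` in `SL_n(R)`. -/
def excImage (n : ℕ) (I : Ideal R) : Subgroup (SpecialLinearGroup (Fin n) R) :=
  (RelElem n (Exc.ideal I)).map (SpecialLinearGroup.map (Exc.toRing I))

theorem excImage_le : excImage n I ≤ RelElem n I := by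
  rintro _ ⟨g, hg, rfl⟩
  exact map_mem_relElem n _ (Exc.le_comap I) hg

theorem transvection_mem_excImage {i j : Fin n} (hij : i ≠ j) {x : R} (hx : x ∈ I) :
    SpecialLinearGroup.transvection hij x ∈ excImage n I :=
  ⟨SpecialLinearGroup.transvection hij (Unitization.inr ⟨x, hx⟩),
    transvection_mem_relElem hij (Exc.inr_mem _), by rw [map_transvection, Exc.toRing_inr]⟩

theorem good_excImage (i j : Fin n) (hij : i ≠ j) : Good (mats (excImage n I)) I (e i) (e j) :=
  good_e_e (fun _ _ hij _ hx => transvection_mem_excImage hij hx) i j hij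

theorem excImage_conj {i j : Fin n} (hij : i ≠ j) (m : ℤ) {g : SpecialLinearGroup (Fin n) R}
    (hg : g ∈ excImage n I) :
    SpecialLinearGroup.transvection hij (m : R) * g *
      (SpecialLinearGroup.transvection hij (m : R))⁻¹ ∈ excImage n I := by
  obtain ⟨g, hg, rfl⟩ := hg
  refine ⟨_, relElem_conj (transvection_mem hij ((m : ℤ) : Exc I)) hg, ?_⟩
  rw [map_mul, map_mul, map_inv, map_transvection, map_intCast]

/-- Conjugation by an integral elementary matrix preserves the image from ℤ ⊕ I, so the generator
with parameter 1 is available, although those with arbitrary parameter a in R need not be. -/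
theorem good_excImage_one {i j : Fin n} (hij : i ≠ j) :
    Good (mats (excImage n I)) I (e i + e j) (e j - e i) := by
  intro x hx
  have h := coe_mem_mats.2 (excImage_conj hij.symm 1 (transvection_mem_excImage hij hx))
  change (_ * _) * _ ∈ _ at h
  rw [transvection_val hij, conj_transvection] at h
  simpa [e_self] using h

/-- Lifting a relative row to the excision ring. -/
theorem exists_lift {n : ℕ} [NeZero n] {v : Fin n → R} (hv : Congr I v) :
    ∃ u : Fin n → Exc I, Congr (Exc.ideal I) u ∧ Exc.toRing I ∘ u = v := by
  refine ⟨fun i => (e 0 : Fin n → Exc I) i + Unitization.inr ⟨_, hv i⟩, fun i => ?_, ?_⟩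
  · simpa using Exc.inr_mem _
  · ext i
    rw [Function.comp, map_add, Exc.toRing_inr]
    by_cases hi : i = 0
    · subst hi; simp [e]
    · simp [e, hi]

theorem eq_of_toRing {n : ℕ} [NeZero n] {u v : Fin n → Exc I} (hu : Congr (Exc.ideal I) u)
    (hv : Congr (Exc.ideal I) v) (h : Exc.toRing I ∘ u = Exc.toRing I ∘ v) : u = v := by
  ext1 i
  refine Exc.ext_of ?_ (congrFun h i)
  have := (Exc.ideal I).sub_mem (hu i) (hv i)
  rwa [sub_sub_sub_cancel_right] at this

theorem Congr.toRing {n : ℕ} [NeZero n] {u : Fin n → Exc I} (hu : Congr (Exc.ideal I) u) :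
    Congr I (Exc.toRing I ∘ u) := by
  rw [congr_iff] at hu ⊢
  refine ⟨?_, fun i hi => Exc.toRing_mem (hu.2 i hi)⟩
  have := Exc.toRing_mem hu.1
  rwa [map_sub, map_one] at this

theorem isUnimodular_lift {n : ℕ} [NeZero n] {u : Fin n → Exc I} (hu : Congr (Exc.ideal I) u)
    (h : IsUnimodular (Exc.toRing I ∘ u)) : IsUnimodular u := by
  obtain ⟨w, hw, hc⟩ := exists_congr_dual h hu.toRing
  obtain ⟨w', hw', rfl⟩ := exists_lift hc
  refine ⟨w', Exc.ext_of ?_ ?_⟩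
  · have h1 : u ⬝ᵥ w' - 1 = (u 0 * w' 0 - 1) + ∑ i ∈ Finset.univ.erase 0, u i * w' i := by
      rw [dotProduct, ← Finset.add_sum_erase _ _ (Finset.mem_univ 0)]
      ring
    rw [h1]
    refine Ideal.add_mem _ ?_ (Ideal.sum_mem _ fun i hi =>
      Ideal.mul_mem_right _ _ (hu.ne (Finset.ne_of_mem_erase hi)))
    have : u 0 * w' 0 - 1 = (u 0 - 1) * w' 0 + (w' 0 - 1) := by ring
    rw [this]
    exact Ideal.add_mem _ (Ideal.mul_mem_right _ _ hu.zero) hw'.zero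
  · rw [map_one, ← hw]
    simp [dotProduct]

/-- Orbits under the image of `E_n(ℤ ⊕ I, 0 ⊕ I)` lift. -/
theorem orb_lift {n : ℕ} [NeZero n] {u v : Fin n → Exc I} (hu : Congr (Exc.ideal I) u)
    (hv : Congr (Exc.ideal I) v)
    (h : Orb (excImage n I) (Exc.toRing I ∘ u) (Exc.toRing I ∘ v)) :
    Orb (RelElem n (Exc.ideal I)) u v := by
  obtain ⟨_, ⟨_, ⟨g, hg, rfl⟩, rfl⟩, h⟩ := h
  refine ⟨_, ⟨g, hg, rfl⟩, eq_of_toRing ((congr_vecMul_iff (relElem_le_relSL hg)).2 hu) hv ?_⟩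
  rw [← h]
  ext i
  simp [vecMul, dotProduct]

/-- The generators of `E₃(R, I)` move relative unimodular rows within their orbits under the
image of `E₃(ℤ ⊕ I, 0 ⊕ I)`. -/
theorem orb_excImage_z {n : ℕ} [NeZero n] {i k : Fin n} (hi : i ≠ 0) (hk : k ≠ 0) (hik : k ≠ i)
    (a : R) {x : R} (hx : x ∈ I) {v : Fin n → R} (hv : IsUnimodular v) (hc : Congr I v) :
    Orb (excImage n I) v (v ᵥ* (1 + x • vecMulVec (e 0 + a • e i) (e i - a • e 0))) := by
  have he := good_excImage (I := I) (n := n)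
  set S := mats (excImage n I) with hS
  obtain ⟨w, hw, hcw⟩ := exists_congr_dual hv hc
  -- the part of the matrix lying in the group
  set t := 1 - v 0 * w 0 with ht
  have htI : t ∈ I := by
    have : t = -((v 0 - 1) * w 0 + (w 0 - 1)) := by rw [ht]; ring
    rw [this]
    exact I.neg_mem (I.add_mem (I.mul_mem_right _ hc.zero) hcw.zero)
  -- The third index k replaces 0, so that q and p = a e_i + e_k are orthogonal and vanish at 0:
  -- then 1 + y e₀ q and 1 + y p e₀ lie in the image for all y in I.
  set q : Fin n → R := e i - a • e k with hq
  set p : Fin n → R := a • e i + e k with hp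
  have hq0 : q 0 = 0 := by simp [hq, e_ne hi, e_ne hk]
  have hqp : q ⬝ᵥ p = 0 := by
    simp [hq, hp, sub_dotProduct, dotProduct_add, dotProduct_smul, dot_e, e_self, e_ne hik,
      e_ne hik.symm, smul_dotProduct]
  have hp0 : p 0 = 0 := by simp [hp, e_ne hi, e_ne hk]
  have hrow : ∀ y ∈ I, 1 + y • vecMulVec (e 0) q ∈ S :=
    Good.row 0 (fun j hj => he 0 j hj.symm) hq0
  have hcol : ∀ y ∈ I, 1 + y • vecMulVec p (e 0) ∈ S :=
    Good.col 0 (fun j hj => he j 0 hj) hp0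
  -- `1 + x t p q` is a commutator
  have h1 : 1 + (x * t) • vecMulVec p q ∈ S := by
    have hc1 : (1 + x • vecMulVec p (e 0)) * (1 + t • vecMulVec (e 0) q) *
        (1 + (-x) • vecMulVec p (e 0)) * (1 + (-t) • vecMulVec (e 0) q) =
        1 + (x * t) • vecMulVec p q := by
      have e1 : vecMulVec p (e 0) * vecMulVec (e 0) q = vecMulVec p q := by
        rw [vmv_mul, e_dot, e_self, one_smul]
      have e2 : vecMulVec (e 0) q * vecMulVec p (e 0) = (0 : Matrix (Fin n) (Fin n) R) := by
        rw [vmv_mul, hqp, zero_smul]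
      have e3 : vecMulVec p (e 0) * vecMulVec p (e 0) = (0 : Matrix (Fin n) (Fin n) R) := by
        rw [vmv_mul, e_dot, hp0, zero_smul]
      have e4 : vecMulVec (e 0) q * vecMulVec (e 0) q = (0 : Matrix (Fin n) (Fin n) R) := by
        rw [vmv_mul, dot_e, hq0, zero_smul]
      have e5 : vecMulVec p q * vecMulVec p (e 0) = (0 : Matrix (Fin n) (Fin n) R) := by
        rw [vmv_mul, hqp, zero_smul]
      have e6 : vecMulVec p q * vecMulVec (e 0) q = (0 : Matrix (Fin n) (Fin n) R) := by
        rw [vmv_mul, dot_e, hq0, zero_smul]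
      simp only [mul_add, add_mul, mul_one, one_mul, smul_mul_smul_comm, e1, e2, e3, e4, e5, e6,
        smul_zero, add_zero, neg_smul, neg_mul, mul_neg]
      abel
    rw [← hc1]
    exact mul_mem (mul_mem (mul_mem (hcol x hx) (hrow t htI)) (hcol _ (I.neg_mem hx)))
      (hrow _ (I.neg_mem htI))
  -- the action of `1 + x p q`
  have h2 : Orb (excImage n I) v (v ᵥ* (1 + x • vecMulVec p q)) := by
    have e1 : (1 + x • vecMulVec p q) =
        (1 + (x * (v 0 * w 0)) • vecMulVec p q) * (1 + (x * t) • vecMulVec p q) := by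
      rw [one_add_mul_coeff _ _ _ _ hqp]
      congr 2
      rw [ht]; ring
    rw [e1, ← vecMul_vecMul]
    refine Orb.trans ?_ ⟨_, h1, rfl⟩
    -- On this v the factor with coefficient x v₀ w₀ adds x v₀ w₀ (v · p) q, which is also what a
    -- row operation with e₀ adds. The equality concerns the row only, not the matrices.
    refine ⟨_, hrow ((v ⬝ᵥ p) * w 0 * x) (I.mul_mem_left _ hx), ?_⟩
    rw [vecMul_add, vecMul_one, vecMul_smul, vecMul_vecMulVec, dot_e, vecMul_add, vecMul_one,
      vecMul_smul, vecMul_vecMulVec, smul_smul, smul_smul]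
    congr 2
    ring
  -- passing from `1 + x p q` to the given matrix
  have h3 : ∃ M ∈ S, (1 + x • vecMulVec (e 0 + a • e i) (e i - a • e 0)) =
      (1 + x • vecMulVec p q) * M := by
    set p' : Fin n → R := e 0 + a • e i + e k with hp'
    have o1 : q ⬝ᵥ p' = 0 := by
      simp [hq, hp', sub_dotProduct, dotProduct_add, dotProduct_smul, dot_e, e_self, e_ne hik,
        e_ne hik.symm, smul_dotProduct, e_ne hi, e_ne hk]
    have o2 : (e i - a • e 0) ⬝ᵥ e k = (0 : R) := by
      simp [dot_e, e_ne hik.symm, e_ne hk.symm]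
    -- The three factors change (p, q) in turn: p becomes p', q becomes e_i - a e₀, and finally e_k
    -- is removed from p'. The middle one uses the generator with parameter 1.
    refine ⟨(1 + x • vecMulVec (e 0) q) * ((1 + (a * x) • vecMulVec p' (e k - e 0)) *
      (1 + (-x) • vecMulVec (e k) (e i - a • e 0))), mul_mem (hrow x hx) (mul_mem ?_ ?_), ?_⟩
    · refine (?_ : Good S I _ _) _ (I.mul_mem_left a hx)
      have g1 : Good S I (e 0 + e k) (e k - e 0) := good_excImage_one hk.symm
      have g2 : Good S I (e i) (e k - e 0) :=
        Good.row i (fun j hj => he i j hj.symm) (by simp [e_ne hik, e_ne hi.symm])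
      convert g1.add_left (g2.smul_left a) ?_ using 1
      · rw [hp']; abel
      · simp [dotProduct_smul, dot_e, e_ne hik, e_ne hi.symm]
    · refine (Good.row k (fun j hj => he k j hj.symm) ?_ : Good S I _ _) _ (I.neg_mem hx)
      simp [e_ne hik.symm, e_ne hk.symm]
    · have f1 : (1 + x • vecMulVec p q) * (1 + x • vecMulVec (e 0) q) =
          1 + x • vecMulVec p' q := by
        rw [one_add_mul_left _ _ _ _ (by rw [dot_e, hq0])]
        congr 3
        rw [hp, hp']; abel
      have f2 : (1 + x • vecMulVec p' q) * (1 + (a * x) • vecMulVec p' (e k - e 0)) =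
          1 + x • vecMulVec p' (e i - a • e 0) := by
        have : (a * x) • vecMulVec p' (e k - e 0 : Fin n → R) =
            x • vecMulVec p' (a • (e k - e 0)) := by
          rw [vecMulVec_smul, smul_smul, mul_comm]
        rw [this, one_add_mul_right _ _ _ _ o1]
        congr 3
        rw [hq, smul_sub]; abel
      have f3 : (1 + x • vecMulVec p' (e i - a • e 0)) *
          (1 + (-x) • vecMulVec (e k) (e i - a • e 0)) =
          1 + x • vecMulVec (e 0 + a • e i) (e i - a • e 0) := by
        rw [hp', ← one_add_mul_left _ _ _ _ o2, mul_assoc,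
          one_add_mul_coeff _ _ _ _ o2, add_neg_cancel, zero_smul, add_zero, mul_one]
      rw [← mul_assoc, f1, ← mul_assoc, f2, f3]
  obtain ⟨M, hM, h3⟩ := h3
  rw [h3, ← vecMul_vecMul]
  exact h2.trans ⟨M, hM, rfl⟩

/-- The orbits of `E_n(R, I)` on relative unimodular rows are those of `E_n(ℤ ⊕ I, 0 ⊕ I)`. -/
theorem orb_excImage {n : ℕ} [NeZero n] (hn : 3 ≤ n) {g : SpecialLinearGroup (Fin n) R}
    (hg : g ∈ RelElem n I) {v : Fin n → R} (hv : IsUnimodular v) (hc : Congr I v) :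
    Orb (excImage n I) v (v ᵥ* g.1) := by
  -- Transposed generators are used, as `orb_excImage_z` wants the vector e₀ + a e_j on the left.
  have h1 := relElem_le_zGen 0 I hn (relElem_transpose hg)
  have h2 := transpose_mem_closure h1
  rw [transpose_transpose_SL] at h2
  refine orb_of_closure (U := {v | IsUnimodular v ∧ Congr I v}) ?_ ?_ h2 ⟨hv, hc⟩
  · intro g hg v
    have hg : g ∈ RelElem n I := by
      rw [← transpose_transpose_SL g]
      exact relElem_transpose (zGen_subset 0 hg)
    exact and_congr (isUnimodular_vecMul_iff g).symm
      (congr_vecMul_iff (relElem_le_relSL hg)).symm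
  · rintro g ⟨x, hx, ⟨i, j, hij, h⟩ | ⟨j, a, hj, h⟩⟩ v hv
    · have : g = SpecialLinearGroup.transvection hij.symm x := by
        apply Subtype.ext
        rw [← transvection_transpose hij, transvection_val, ← h]
        exact (transpose_transpose _).symm
      rw [this]
      exact Orb.of_mem (transvection_mem_excImage _ hx) v
    · obtain ⟨k, hk0, hkj⟩ := exists_third hn 0 j
      have : g.1 = 1 + x • vecMulVec (e 0 + (-a) • e j) (e j - (-a) • e 0) := by
        have : g.1 = (g.transpose.1)ᵀ := (transpose_transpose _).symm
        rw [this, h, transpose_add, transpose_one, transpose_smul, transpose_vecMulVec,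
          neg_smul, neg_smul, sub_neg_eq_add, ← sub_eq_add_neg]
      rw [this]
      exact orb_excImage_z hj hk0 hkj _ hx hv.1 hv.2

end Excision

/-! ### Bijectivity of F and G. -/

section Bijectivity

variable {R : Type u} [CommRing R] {S : Type v} [CommRing S] {I : Ideal R}

theorem comp_vecMul {n : ℕ} (f : R →+* S) (v : Fin n → R) (g : SpecialLinearGroup (Fin n) R) :
    f ∘ (v ᵥ* g.1) = (f ∘ v) ᵥ* (SpecialLinearGroup.map f g).1 := by
  ext i; simp [vecMul, dotProduct]

theorem mk_eq_mk_iff {n : ℕ} [NeZero n] {v w : Um n I} :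
    (Quotient.mk (orbitSetoid n I) v = Quotient.mk (orbitSetoid n I) w) ↔
      Orb (RelElem n I) v.1 w.1 := by
  rw [Quotient.eq]
  constructor
  · rintro ⟨g, hg, h⟩
    exact ⟨g.1, ⟨g, hg, rfl⟩, h⟩
  · rintro ⟨_, ⟨g, hg, rfl⟩, h⟩
    exact ⟨g, hg, h⟩

theorem Exc.F_bijective {n : ℕ} [NeZero n] (hn : 3 ≤ n) (I : Ideal R) :
    Function.Bijective (Exc.F n I) := by
  constructor
  · rintro ⟨v⟩ ⟨w⟩ h
    have h1 : Orb (RelElem n I) (Exc.toRing I ∘ v.1) (Exc.toRing I ∘ w.1) := mk_eq_mk_iff.1 h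
    obtain ⟨_, ⟨g, hg, rfl⟩, h2⟩ := h1
    have h3 := orb_excImage hn hg (v.2.1.map (Exc.toRing I)) (Congr.toRing v.2.2)
    rw [h2] at h3
    exact mk_eq_mk_iff.2 (orb_lift v.2.2 w.2.2 h3)
  · rintro ⟨v⟩
    obtain ⟨u, hu, h⟩ := exists_lift (I := I) (v := v.1) v.2.2
    refine ⟨Quotient.mk _ ⟨u, isUnimodular_lift hu (by rw [h]; exact v.2.1), hu⟩, ?_⟩
    exact congrArg (Quotient.mk _) (Subtype.ext h)

/-- The projection `ℤ ⊕ I → ℤ`. -/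
def Exc.toInt (I : Ideal R) : Exc I →+* ℤ := (Unitization.fstHom ℤ I : Exc I →+* ℤ)

theorem congr_iff_toInt {n : ℕ} [NeZero n] {v : Fin n → Exc I} :
    Congr (Exc.ideal I) v ↔ Exc.toInt I ∘ v = e 0 := by
  rw [funext_iff]
  refine forall_congr' fun i => ?_
  have : (e 0 : Fin n → ℤ) i = Exc.toInt I ((e 0 : Fin n → Exc I) i) := by
    by_cases hi : i = 0
    · subst hi; simp [e]
    · simp [e, hi]
  rw [this, Function.comp, ← sub_eq_zero, ← map_sub]
  rfl

theorem map_toInt_cast {n : ℕ} (g : SpecialLinearGroup (Fin n) ℤ) :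
    SpecialLinearGroup.map (Exc.toInt I)
      (SpecialLinearGroup.map (Int.castRingHom (Exc I)) g) = g := by
  apply Subtype.ext
  ext i j
  simp

/-- Every unimodular row over `ℤ ⊕ I` is elementarily equivalent to a relative one. -/
theorem exists_orb_congr {n : ℕ} [NeZero n] (hn : 2 ≤ n) {v : Fin n → Exc I}
    (hv : IsUnimodular v) : ∃ w, Orb (Elem n (Exc I)) v w ∧ Congr (Exc.ideal I) w := by
  obtain ⟨_, ⟨g, hg, rfl⟩, h⟩ := orb_int_unimodular hn (hv.map (Exc.toInt I))
  refine ⟨_, Orb.of_mem (map_mem_elem n (Int.castRingHom (Exc I)) hg) v, ?_⟩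
  rw [congr_iff_toInt, comp_vecMul, map_toInt_cast, h]

theorem map_lowerGen {g : SpecialLinearGroup (Fin 3) R} (f : R →+* S)
    (hg : g ∈ Subgroup.closure (lowerGen 3 R)) :
    SpecialLinearGroup.map f g ∈ Subgroup.closure (lowerGen 3 S) := by
  have : Subgroup.closure (lowerGen 3 R) ≤
      (Subgroup.closure (lowerGen 3 S)).comap (SpecialLinearGroup.map f) := by
    refine (Subgroup.closure_le _).2 ?_
    rintro _ ⟨i, j, hi, hij, x, rfl⟩
    exact Subgroup.subset_closure ⟨i, j, hi, hij, f x, map_transvection 3 f hij x⟩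
  exact this hg

/-- Relative rows that are equivalent over `ℤ ⊕ I` are relatively equivalent. -/
theorem orb_rel_of_orb {v w : Fin 3 → Exc I} (hv : Congr (Exc.ideal I) v)
    (hw : Congr (Exc.ideal I) w) (h : Orb (Elem 3 (Exc I)) v w) :
    Orb (RelElem 3 (Exc.ideal I)) v w := by
  obtain ⟨_, ⟨g, hg, rfl⟩, h⟩ := h
  -- The integral part of g. Since v and w both reduce to e₁ over ℤ, it stabilizes e₁ there.
  set s := SpecialLinearGroup.map (Exc.retr I) g with hs
  have hs' : s = SpecialLinearGroup.map (Int.castRingHom (Exc I))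
      (SpecialLinearGroup.map (Exc.toInt I) g) := rfl
  have h1 : g * s⁻¹ ∈ RelElem 3 (Exc.ideal I) := split_mem_relElem _ Exc.sub_retr hg
  have h2 := Orb.of_mem h1 v
  have h3 : s ∈ Subgroup.closure (lowerGen 3 (Exc I)) := by
    rw [hs']
    refine map_lowerGen _ (mem_lowerGen_of_stabilizer ?_)
    rw [congr_iff_toInt] at hv hw
    rw [← h, comp_vecMul, hv] at hw
    exact hw
  have h4 : Congr (Exc.ideal I) (v ᵥ* (g * s⁻¹).1) :=
    (congr_vecMul_iff (relElem_le_relSL h1)).2 hv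
  have h5 := orb_of_closure (K := RelElem 3 (Exc.ideal I)) (U := {v | Congr (Exc.ideal I) v})
    (s := lowerGen 3 (Exc I)) ?_ ?_ h3 h4
  · have : v ᵥ* (g * s⁻¹).1 ᵥ* s.1 = w := by
      rw [vecMul_vecMul, ← h]
      change v ᵥ* (g * s⁻¹ * s).1 = _
      rw [inv_mul_cancel_right]
    rw [this] at h5
    exact h2.trans h5
  · rintro _ ⟨i, j, hi, hij, x, rfl⟩ v
    refine ⟨fun hv => congr_vecMul_transvection hi hij x hv, fun hv => ?_⟩
    have := congr_vecMul_transvection hi hij (-x) hv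
    rwa [← SpecialLinearGroup.transvection_inv, vecMul_vecMul, coe_mul_inv, vecMul_one] at this
  · rintro _ ⟨i, j, hi, hij, x, rfl⟩ v hv
    exact orb_transvection_ne le_rfl hi hij x hv

theorem Exc.G_bijective (I : Ideal R) : Function.Bijective (Exc.G 3 I) := by
  constructor
  · rintro ⟨v⟩ ⟨w⟩ h
    have h1 : Orb (RelElem 3 ⊤) v.1 w.1 := mk_eq_mk_iff.1 h
    rw [relElem_top] at h1
    exact mk_eq_mk_iff.2 (orb_rel_of_orb v.2.2 w.2.2 h1)
  · rintro ⟨v⟩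
    obtain ⟨w, h, hw⟩ := exists_orb_congr (by norm_num) v.2.1
    refine ⟨Quotient.mk _ ⟨w, h.isUnimodular v.2.1, hw⟩, ?_⟩
    rw [← relElem_top] at h
    exact mk_eq_mk_iff.2 h.symm

end Bijectivity

/-! ### Bass' stable range through the Krull boundary. -/

section StableRange

/-- The ideal `cR + (√0 : c)`. -/
def krullBoundary {R : Type u} [CommRing R] (c : R) : Ideal R :=
  Ideal.span {c} ⊔ (nilradical R).colon {c}

/-- An element of a minimal prime is killed, up to nilpotents, by an element outside of it. -/
theorem exists_mul_nilpotent_of_mem_minimalPrimes {R : Type u} [CommRing R] {p : Ideal R}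
    (hp : p ∈ minimalPrimes R) {c : R} (hc : c ∈ p) : ∃ s ∉ p, IsNilpotent (s * c) := by
  have hpp : p.IsPrime := hp.1.1
  -- If the monoid generated by c and the complement of p misses 0, a prime avoiding it is strictly
  -- below p, against minimality.
  by_cases h0 : (0 : R) ∈ p.primeCompl ⊔ Submonoid.powers c
  · obtain ⟨s, hs, _, ⟨k, rfl⟩, h⟩ := Submonoid.mem_sup.1 h0
    refine ⟨s, hs, k + 1, ?_⟩
    calc (s * c) ^ (k + 1) = (s * c ^ k) * (s ^ k * c) := by ring
      _ = 0 := by rw [h, zero_mul]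
  · obtain ⟨q, hq, -, hd⟩ := Ideal.exists_le_prime_disjoint (⊥ : Ideal R)
      (p.primeCompl ⊔ Submonoid.powers c) (by
        rw [Set.disjoint_left]
        intro x hx hx'
        rw [SetLike.mem_coe, Ideal.mem_bot] at hx
        exact h0 (hx ▸ hx'))
    have hqp : q ≤ p := fun x hx => by
      by_contra hxp
      exact Set.disjoint_left.1 hd hx (Submonoid.mem_sup_left hxp)
    have hpq := hp.2 ⟨hq, bot_le⟩ hqp
    exact absurd (Submonoid.mem_sup_right (Submonoid.mem_powers c))
      (Set.disjoint_left.1 hd (hpq hc))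

/-- A chain of primes containing the boundary extends downwards. A minimal prime p below its head
cannot be the head: it would contain c, hence not contain some s with s c nilpotent, whereas such s
belong to the boundary. -/
theorem ringKrullDim_boundary_succ_le {R : Type u} [CommRing R] (c : R) :
    ringKrullDim (R ⧸ krullBoundary c) + 1 ≤ ringKrullDim R := by
  by_cases h : krullBoundary c = ⊤
  · rw [h, ringKrullDim_eq_bot_of_subsingleton]
    simp
  have : Nonempty (PrimeSpectrum.zeroLocus (R := R) (krullBoundary c)) := by
    rwa [Set.nonempty_coe_sort, Set.nonempty_iff_ne_empty, ne_eq,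
      PrimeSpectrum.zeroLocus_empty_iff_eq_top]
  have := Ideal.Quotient.nontrivial_iff.mpr h
  have := (Ideal.Quotient.mk (krullBoundary c)).domain_nontrivial
  rw [ringKrullDim_quotient, Order.krullDim_eq_iSup_length, ringKrullDim,
    Order.krullDim_eq_iSup_length, ← WithBot.coe_one, ← WithBot.coe_add,
    ENat.iSup_add, WithBot.coe_le_coe, iSup_le_iff]
  intro l
  obtain ⟨p, hp, hp'⟩ := Ideal.exists_minimalPrimes_le (J := l.head.1.asIdeal) bot_le
  let p' : PrimeSpectrum R := ⟨p, hp.1.1⟩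
  have hle : krullBoundary c ≤ l.head.1.asIdeal := l.head.2
  have hp' : p' < l.head := lt_of_le_of_ne hp' fun h ↦ by
    have hpl : p = l.head.1.asIdeal := congrArg PrimeSpectrum.asIdeal h
    rw [← hpl] at hle
    have hc : c ∈ p := hle (Ideal.mem_sup_left (Ideal.mem_span_singleton_self c))
    obtain ⟨y, hy, hxy⟩ := exists_mul_nilpotent_of_mem_minimalPrimes hp hc
    refine hy (hle (Ideal.mem_sup_right ?_))
    rw [Submodule.mem_colon_singleton]
    exact hxy
  refine le_trans ?_ (le_iSup _ ((l.map Subtype.val (fun _ _ ↦ id)).cons p' hp'))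
  have hl : ((l.map Subtype.val (fun _ _ ↦ id)).cons p' hp').length = l.length + 1 :=
    RelSeries.cons_length _ _ _
  rw [hl, Nat.cast_add, Nat.cast_one]

theorem isUnimodular_iff_prime {R : Type u} [CommRing R] {n : ℕ} {v : Fin n → R} :
    IsUnimodular v ↔ ∀ p : Ideal R, p.IsPrime → ∃ i, v i ∉ p := by
  constructor
  · rintro ⟨w, hw⟩ p hp
    by_contra! h
    exact hp.one_notMem (hw ▸ Ideal.sum_mem _ fun i _ => p.mul_mem_right _ (h i))
  · intro h
    have h1 : Ideal.span (Set.range v) = ⊤ := by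
      by_contra hne
      obtain ⟨m, hm, hle⟩ := Ideal.exists_le_maximal _ hne
      obtain ⟨i, hi⟩ := h m hm.isPrime
      exact hi (hle (Ideal.subset_span ⟨i, rfl⟩))
    have h2 : (1 : R) ∈ Ideal.span (Set.range v) := h1 ▸ Submodule.mem_top
    obtain ⟨c, hc⟩ := Ideal.mem_span_range_iff_exists_fun.1 h2
    exact ⟨c, by rw [dotProduct_comm]; exact hc⟩

/-- Bass' stable range theorem for rings of finite Krull dimension. -/
theorem stable_range (n : ℕ) : ∀ {R : Type u} [CommRing R], ringKrullDim R < n →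
    ∀ (a : R) (b : Fin n → R), (∀ p : Ideal R, p.IsPrime → a ∈ p → ∃ i, b i ∉ p) →
      ∃ x : Fin n → R, IsUnimodular (b + a • x) := by
  induction n with
  | zero =>
    intro R _ hR a b _
    refine ⟨0, 0, ?_⟩
    have : Subsingleton R := by
      by_contra hn
      rw [not_subsingleton_iff_nontrivial] at hn
      have := ringKrullDim_nonneg_of_nontrivial (R := R)
      exact absurd hR (not_lt.2 (by simpa using this))
    exact Subsingleton.elim _ _
  | succ n ih =>
    intro R _ hR a b h
    set N := krullBoundary (b 0) with hN
    have hdim : ringKrullDim (R ⧸ N) < n := by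
      have h1 := (ringKrullDim_boundary_succ_le (b 0)).trans_lt hR
      push_cast at h1
      exact lt_of_add_lt_add_right h1
    obtain ⟨x, hx⟩ := ih hdim (Ideal.Quotient.mk N a) (fun i => Ideal.Quotient.mk N (b i.succ)) (by
      intro p hp ha
      obtain ⟨i, hi⟩ := h (p.comap (Ideal.Quotient.mk N)) (hp.comap _) ha
      refine Fin.cases (fun hi => ?_) (fun i hi => ⟨i, hi⟩) i hi
      refine absurd ?_ hi
      have : Ideal.Quotient.mk N (b 0) = 0 := Ideal.Quotient.eq_zero_iff_mem.2
        (Ideal.mem_sup_left (Ideal.mem_span_singleton_self _))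
      rw [Ideal.mem_comap, this]
      exact p.zero_mem)
    choose x' hx' using fun i => Ideal.Quotient.mk_surjective (x i)
    obtain ⟨w, hw⟩ := hx
    choose w' hw' using fun i => Ideal.Quotient.mk_surjective (w i)
    have h1 : 1 - ∑ i, (b i.succ + a * x' i) * w' i ∈ N := by
      rw [← Ideal.Quotient.eq_zero_iff_mem, map_sub, map_one, ← hw, map_sum, sub_eq_zero]
      refine Finset.sum_congr rfl fun i _ => ?_
      simp [hx', hw']
    obtain ⟨r, hr, y, hy, hry⟩ := Submodule.mem_sup.1 h1
    have hyb : y * b 0 ∈ nilradical R := by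
      simpa [Submodule.mem_colon_singleton] using hy
    -- The coefficient for b₀ is the part y of the boundary element that kills b₀ up to nilpotents:
    -- a prime containing b₀ + a y then contains b₀ and a y separately.
    refine ⟨Fin.cons y x', isUnimodular_iff_prime.2 fun p hp => ?_⟩
    by_contra! hall
    have h0 : b 0 + a * y ∈ p := by simpa using hall 0
    have hs : ∀ i : Fin n, b i.succ + a * x' i ∈ p := fun i => by simpa using hall i.succ
    have hyb' : y * b 0 ∈ p := (nilradical_le_prime p) hyb
    have hb0 : b 0 ∈ p := by
      have : b 0 * b 0 ∈ p := by
        have e1 : b 0 * b 0 = (b 0 + a * y) * b 0 - a * (y * b 0) := by ring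
        rw [e1]
        exact p.sub_mem (p.mul_mem_right _ h0) (p.mul_mem_left _ hyb')
      exact (hp.mem_or_mem this).elim id id
    have hay : a * y ∈ p := (Ideal.add_mem_iff_right p hb0).1 h0
    have hrp : r ∈ p := (Ideal.span_singleton_le_iff_mem p).2 hb0 hr
    rcases hp.mem_or_mem hay with ha | hyp
    · obtain ⟨i, hi⟩ := h p hp ha
      refine hi (Fin.cases hb0 (fun i => ?_) i)
      exact (Ideal.add_mem_iff_left p (p.mul_mem_right _ ha)).1 (hs i)
    · refine hp.one_notMem ?_
      have : (1 : R) = (r + y) + ∑ i, (b i.succ + a * x' i) * w' i := by rw [hry]; ring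
      rw [this]
      exact p.add_mem (p.add_mem hrp hyp) (p.sum_mem fun i _ => p.mul_mem_right _ (hs i))

end StableRange

/-! ### Transitivity on long unimodular rows. -/

section Transitivity

variable {R : Type u} [CommRing R] {I : Ideal R} {n : ℕ}
  {S : Submonoid (Matrix (Fin n) (Fin n) R)}

/-- In contrast to `Good.row`, the entries of q are arbitrary elements of I, without a common factor
from I. -/
theorem row_mem (he : ∀ i j, i ≠ j → Good S I (e i) (e j)) (i : Fin n) {q : Fin n → R}
    (hi : q i = 0) (hq : ∀ j, q j ∈ I) : 1 + vecMulVec (e i) q ∈ S := by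
  have key : ∀ s : Finset (Fin n), 1 + vecMulVec (e i) (∑ j ∈ s, q j • e j) ∈ S := by
    intro s
    induction s using Finset.induction_on with
    | empty => simp [one_mem]
    | insert a s ha ih =>
      rw [Finset.sum_insert ha]
      have := one_add_mul_right (e i : Fin n → R) (q a • e a) (∑ j ∈ s, q j • e j) (1 : R) (by
        rw [dot_e]
        by_cases h : a = i
        · subst h; simp [hi]
        · simp [e_ne h])
      rw [one_smul, one_smul, one_smul] at this
      rw [← this]
      refine mul_mem ?_ ih
      by_cases h : a = i
      · subst h; simp [hi, one_mem]
      · rw [vecMulVec_smul]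
        exact he i a (Ne.symm h) _ (hq a)
  have := key Finset.univ
  rwa [← eq_sum_e] at this

theorem col_mem (he : ∀ i j, i ≠ j → Good S I (e i) (e j)) (j : Fin n) {p : Fin n → R}
    (hj : p j = 0) (hp : ∀ i, p i ∈ I) : 1 + vecMulVec p (e j) ∈ S := by
  have key : ∀ s : Finset (Fin n), 1 + vecMulVec (∑ i ∈ s, p i • e i) (e j) ∈ S := by
    intro s
    induction s using Finset.induction_on with
    | empty => simp [one_mem]
    | insert a s ha ih =>
      rw [Finset.sum_insert ha, add_comm (p a • e a)]
      have := one_add_mul_left (∑ i ∈ s, p i • e i) (p a • e a) (e j : Fin n → R) (1 : R) (by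
        rw [e_dot]
        by_cases h : a = j
        · subst h; simp [hj]
        · simp [e_ne h])
      rw [one_smul, one_smul, one_smul] at this
      rw [← this]
      refine mul_mem ih ?_
      by_cases h : a = j
      · subst h; simp [hj, one_mem]
      · rw [smul_vecMulVec]
        exact he a j h _ (hp a)
  have := key Finset.univ
  rwa [← eq_sum_e] at this

/-- `E_n(ℤ ⊕ I, 0 ⊕ I)` acts transitively on relative unimodular rows of large length. -/
theorem orb_excImage_e [NeZero n] (hR : ringKrullDim R < n) {v : Fin (n + 1) → R}
    (hv : IsUnimodular v) (hc : Congr I v) : Orb (excImage (n + 1) I) v (e 0) := by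
  have he := good_excImage (I := I) (n := n + 1)
  have hl0 : Fin.last n ≠ 0 := by
    rw [Ne, Fin.ext_iff]; simpa using NeZero.ne n
  have hcs : ∀ i : Fin n, Fin.castSucc i ≠ Fin.last n := fun i => (Fin.castSucc_lt_last i).ne
  set a := v (Fin.last n) with ha
  have haI : a ∈ I := hc.ne hl0
  -- The square leaves one factor a for the coefficients a x_i, which thus lie in I; the other is
  -- the last entry itself.
  obtain ⟨x, hx⟩ := stable_range n hR (a * a) (fun i => v i.castSucc) (fun p hp hap => by
    obtain ⟨i, hi⟩ := isUnimodular_iff_prime.1 hv p hp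
    refine Fin.lastCases (fun hi => ?_) (fun i hi => ⟨i, hi⟩) i hi
    exact absurd ((hp.mem_or_mem hap).elim id id) hi)
  set q : Fin (n + 1) → R := Fin.snoc (α := fun _ => R) (a • x) 0 with hq
  have hql : q (Fin.last n) = 0 := Fin.snoc_last _ _
  have hqc : ∀ i : Fin n, q i.castSucc = a * x i := fun i => by
    rw [hq, Fin.snoc_castSucc]; rfl
  have hqI : ∀ j, q j ∈ I := fun j => by
    refine Fin.lastCases ?_ (fun i => ?_) j
    · rw [hql]; exact I.zero_mem
    · rw [hqc]; exact I.mul_mem_right _ haI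
  have h1 := Orb.add_vmv (row_mem he (Fin.last n) hql hqI) v
  rw [dot_e, ← ha] at h1
  set v₁ := v + a • q with hv₁
  have hc₁ : Congr I v₁ := (h1.mono excImage_le).congr_iff.1 hc
  have hu₁ : IsUnimodular (fun i : Fin n => v₁ i.castSucc) := by
    convert hx using 1
    ext i
    simp [hv₁, hqc, mul_assoc]
  have hcu : Congr I (fun i : Fin n => v₁ i.castSucc) := by
    refine congr_iff.2 ⟨hc₁.zero, fun i hi => hc₁.ne ?_⟩
    rwa [Ne, Fin.castSucc_eq_zero_iff]
  obtain ⟨w, hw⟩ := hu₁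
  -- Adding δ, a relative operation since the other entries are unimodular, makes the last entry 1 -
  -- v₀. Then E_{l0}(1), with l the last index, produces 1 in position 0.
  set δ := 1 - v₁ 0 - v₁ (Fin.last n) with hδ
  have hδI : δ ∈ I := by
    have : δ = -(v₁ 0 - 1) - v₁ (Fin.last n) := by rw [hδ]; ring
    rw [this]
    exact I.sub_mem (I.neg_mem hc₁.zero) (hc₁.ne hl0)
  set c : Fin (n + 1) → R := Fin.snoc (α := fun _ => R) (δ • w) 0 with hcdef
  have hcl : c (Fin.last n) = 0 := Fin.snoc_last _ _
  have hcc : ∀ i : Fin n, c i.castSucc = δ * w i := fun i => by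
    rw [hcdef, Fin.snoc_castSucc]; rfl
  have hcI : ∀ j, c j ∈ I := fun j => by
    refine Fin.lastCases ?_ (fun i => ?_) j
    · rw [hcl]; exact I.zero_mem
    · rw [hcc]; exact I.mul_mem_right _ hδI
  have h2 := Orb.add_vmv (col_mem he (Fin.last n) hcl hcI) v₁
  have hdot : v₁ ⬝ᵥ c = δ := by
    rw [dotProduct, Fin.sum_univ_castSucc, hcl, mul_zero, add_zero]
    have : ∑ i : Fin n, v₁ i.castSucc * w i = 1 := hw
    calc ∑ i : Fin n, v₁ i.castSucc * c i.castSucc =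
        δ * ∑ i : Fin n, v₁ i.castSucc * w i := by
          rw [Finset.mul_sum]
          exact Finset.sum_congr rfl fun i _ => by rw [hcc]; ring
      _ = δ := by rw [this, mul_one]
  rw [hdot] at h2
  set v₂ := v₁ + δ • e (Fin.last n) with hv₂
  have hc₂ : Congr I v₂ := (h2.mono excImage_le).congr_iff.1 hc₁
  have h20 : v₂ 0 = v₁ 0 := by simp [hv₂, e_ne hl0]
  have h2l : v₂ (Fin.last n) = 1 - v₂ 0 := by
    rw [h20]; simp [hv₂, e_self, hδ]
  set τ := SpecialLinearGroup.transvection hl0 (((1 : ℤ) : R)) with hτ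
  have hz : v₂ ᵥ* τ.1 = v₂ + (1 - v₂ 0) • e 0 := by
    rw [hτ, transvection_val, trans_vecMul, h2l]; simp
  have h3 := Orb.add_vmv (row_mem he 0 (q := -(v₂ - v₂ 0 • e 0)) (by simp [e_self]) (by
    intro j
    by_cases hj : j = 0
    · subst hj; simp [e_self]
    · simpa [e_ne (Ne.symm hj)] using hc₂.ne hj)) (v₂ ᵥ* τ.1)
  rw [dot_e] at h3
  have h4 : v₂ ᵥ* τ.1 + (v₂ ᵥ* τ.1) 0 • -(v₂ - v₂ 0 • e 0) = e 0 := by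
    have : (v₂ ᵥ* τ.1) 0 = 1 := by rw [hz]; simp [e_self]
    rw [this, one_smul, hz, sub_smul, one_smul]
    abel
  rw [h4] at h3
  -- τ is integral but not relative; it fixes e₁ and normalizes the image, so it can be conjugated
  -- away.
  have h5 := h3.conj (g := τ⁻¹) (fun k hk => by
    rw [inv_inv]; exact excImage_conj hl0 1 hk)
  rw [vecMul_vecMul, coe_mul_inv, vecMul_one] at h5
  have h6 : (e 0 : Fin (n + 1) → R) ᵥ* (τ⁻¹).1 = e 0 := by
    rw [hτ, transvection_inv_val, trans_vecMul, e_ne hl0.symm, mul_zero, zero_smul, add_zero]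
  rw [h6] at h5
  exact h1.trans (h2.trans h5)

/-- `E_n(ℤ ⊕ I)` acts transitively on unimodular rows of large length. -/
theorem orb_exc_e [NeZero n] (hR : ringKrullDim R < n) {v : Fin (n + 1) → Exc I}
    (hv : IsUnimodular v) : Orb (Elem (n + 1) (Exc I)) v (e 0) := by
  obtain ⟨w, h, hw⟩ := exists_orb_congr (by have := NeZero.ne n; omega) hv
  refine h.trans ((orb_lift hw congr_e_zero ?_).mono relElem_le_elem)
  have : Exc.toRing I ∘ (e 0 : Fin (n + 1) → Exc I) = e 0 := by
    ext i
    by_cases hi : i = 0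
    · subst hi; simp [e]
    · simp [e, hi]
  rw [this]
  exact orb_excImage_e hR ((h.isUnimodular hv).map _) hw.toRing

end Transitivity

/-! ### Invariance of the Pfaffian under elementary congruence. -/

section Pfaffian

open CliffordAlgebra in
-- The signs and the omitted index are those of the Pfaffian expansion along the first row; this
-- identity drives the recursion below.
theorem contractLeft_ιMulti {A : Type u} [CommRing A] {V : Type v} [AddCommGroup V] [Module A V]
    (d : Module.Dual A V) : (n : ℕ) → (v : Fin (n + 1) → V) →
      contractLeft d (ExteriorAlgebra.ιMulti A (n + 1) v) =
        ∑ j : Fin (n + 1), ((-1) ^ (j : ℕ) * d (v j)) •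
          ExteriorAlgebra.ιMulti A n (fun i => v (j.succAbove i))
  | 0, v => by
    rw [ExteriorAlgebra.ιMulti_succ_apply]
    erw [contractLeft_ι_mul]
    simp [ExteriorAlgebra.ιMulti_zero_apply]
  | n + 1, v => by
    rw [ExteriorAlgebra.ιMulti_succ_apply]
    erw [contractLeft_ι_mul]
    rw [contractLeft_ιMulti d n, Finset.mul_sum, sub_eq_add_neg]
    conv_rhs => rw [Fin.sum_univ_succ]
    congr 1
    · simp [vecTail, Function.comp_def]
    · rw [← Finset.sum_neg_distrib]
      refine Finset.sum_congr rfl fun j _ => ?_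
      rw [ExteriorAlgebra.ιMulti_succ_apply, mul_smul_comm, ← neg_smul]
      congr 1
      · simp [vecTail, pow_succ]
      · rw [Fin.succ_succAbove_zero]
        congr 2
        funext i
        simp [vecTail, Fin.succ_succAbove_succ]

/-- The Pfaffian of the Gram matrix of an alternating form is an alternating map. -/
theorem exists_pf_alternatingMap {A : Type u} [CommRing A] {V : Type v} [AddCommGroup V]
    [Module A V] (B : LinearMap.BilinForm A V) (hB : ∀ x, B x x = 0) (n : ℕ) :
    ∃ f : V [⋀^Fin n]→ₗ[A] A, ∀ v : Fin n → V, f v = pf n (of fun i j => B (v i) (v j)) := by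
  -- As B is alternating, it deforms the exterior algebra into itself, without changing the zero
  -- quadratic form.
  have h : LinearMap.BilinMap.toQuadraticMap (-B) = (0 : QuadraticForm A V) - 0 := by
    ext x
    simp [hB]
  -- The scalar part after the deformation by B. Its value on v₁ ∧ … ∧ v_n is the Pfaffian of the
  -- Gram matrix, as in Wick's formula.
  let s : ExteriorAlgebra A V →ₗ[A] A :=
    ExteriorAlgebra.algebraMapInv.toLinearMap ∘ₗ CliffordAlgebra.changeForm h
  suffices key : ∀ (n : ℕ) (v : Fin n → V),
      s (ExteriorAlgebra.ιMulti A n v) = pf n (of fun i j => B (v i) (v j)) from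
    ⟨s.compAlternatingMap (ExteriorAlgebra.ιMulti A n), key n⟩
  -- Peeling off one vector leaves the contraction by B x only, since a product with a vector on the
  -- left has no scalar part.
  have hι : ∀ (x : V) (y : ExteriorAlgebra A V), s (ExteriorAlgebra.ι A x * y) =
      s (CliffordAlgebra.contractLeft (B x) y) := by
    intro x y
    change ExteriorAlgebra.algebraMapInv (CliffordAlgebra.changeForm h
      (CliffordAlgebra.ι _ x * y)) = _
    rw [CliffordAlgebra.changeForm_ι_mul, map_sub, map_mul, ← CliffordAlgebra.changeForm_contractLeft]
    have : ExteriorAlgebra.algebraMapInv (CliffordAlgebra.ι (0 : QuadraticForm A V) x) = (0 : A) := by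
      change ExteriorAlgebra.algebraMapInv (ExteriorAlgebra.ι A x) = (0 : A)
      simp [ExteriorAlgebra.algebraMapInv]
    rw [this]
    simp [s]
  intro n
  induction n using Nat.twoStepInduction with
  | zero =>
    intro v
    rw [ExteriorAlgebra.ιMulti_zero_apply]
    change ExteriorAlgebra.algebraMapInv (CliffordAlgebra.changeForm h 1) = 1
    rw [CliffordAlgebra.changeForm_one, map_one]
  | one =>
    intro v
    rw [ExteriorAlgebra.ιMulti_succ_apply, hι, ExteriorAlgebra.ιMulti_zero_apply]
    erw [CliffordAlgebra.contractLeft_one]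
    rw [map_zero]
    rfl
  | more n ih _ =>
    intro v
    rw [ExteriorAlgebra.ιMulti_succ_apply, hι, contractLeft_ιMulti, map_sum, pf_succ_succ]
    refine Finset.sum_congr rfl fun j _ => ?_
    rw [map_smul, ih]
    rfl

variable {A : Type u} [CommRing A]

/-- Alternating matrices: skew-symmetric, with zero diagonal. -/
def IsAlt {n : ℕ} (M : Matrix (Fin n) (Fin n) A) : Prop := Mᵀ = -M ∧ ∀ i, M i i = 0

theorem IsAlt.swap {n : ℕ} {M : Matrix (Fin n) (Fin n) A} (h : IsAlt M) (i j : Fin n) :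
    M i j = -M j i := by
  have := congrFun (congrFun h.1 j) i
  simpa using this

theorem IsAlt.of_swap {n : ℕ} {M : Matrix (Fin n) (Fin n) A} (h : ∀ i j, M i j = -M j i)
    (hd : ∀ i, M i i = 0) : IsAlt M :=
  ⟨by ext i j; exact h j i, hd⟩

theorem IsAlt.dot_self {n : ℕ} {M : Matrix (Fin n) (Fin n) A} (h : IsAlt M) (x : Fin n → A) :
    x ⬝ᵥ (M *ᵥ x) = 0 := by
  have h1 : x ⬝ᵥ (M *ᵥ x) = ∑ p : Fin n × Fin n, x p.1 * M p.1 p.2 * x p.2 := by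
    rw [Fintype.sum_prod_type]
    simp only [dotProduct, mulVec, Finset.mul_sum, mul_assoc]
  rw [h1]
  refine Finset.sum_involution (fun p _ => (p.2, p.1)) ?_ ?_ (by simp) (by simp)
  · rintro ⟨i, j⟩ -
    rw [h.swap i j]; ring
  · rintro ⟨i, j⟩ - hne heq
    simp only [Prod.mk.injEq] at heq
    obtain rfl := heq.1
    simp [h.2] at hne

theorem IsAlt.conj {m n : ℕ} {M : Matrix (Fin m) (Fin m) A} (h : IsAlt M)
    (g : Matrix (Fin m) (Fin n) A) : IsAlt (gᵀ * M * g) := by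
  refine ⟨?_, fun i => ?_⟩
  · rw [transpose_mul, transpose_mul, h.1, transpose_transpose]
    simp [Matrix.mul_assoc]
  · have := h.dot_self (fun k => g k i)
    rw [← this, Matrix.mul_assoc]
    simp only [mul_apply, dotProduct, mulVec, transpose_apply]

theorem IsAlt.submatrix {m n : ℕ} {M : Matrix (Fin m) (Fin m) A} (h : IsAlt M)
    (f : Fin n → Fin m) : IsAlt (M.submatrix f f) :=
  .of_swap (fun _ _ => h.swap _ _) fun _ => h.2 _

/-- The Pfaffian is an alternating function of the columns of the transforming matrix, so adding a
multiple of one column to another leaves it unchanged. Comparing determinants would only give the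
square of this identity. -/
theorem pf_conj_transvection {n : ℕ} {M : Matrix (Fin n) (Fin n) A} (hM : IsAlt M) {i j : Fin n}
    (hij : i ≠ j) (x : A) : pf n ((1 + single i j x)ᵀ * M * (1 + single i j x)) = pf n M := by
  have hB : ∀ y, Matrix.toBilin' M y y = 0 := fun y => by
    rw [toBilin'_apply']; exact hM.dot_self y
  obtain ⟨f, hf⟩ := exists_pf_alternatingMap (Matrix.toBilin' M) hB n
  let v : Fin n → Fin n → A := fun k => e k
  have hBv : ∀ g : Matrix (Fin n) (Fin n) A,
      (of fun a b => Matrix.toBilin' M (g.col a) (g.col b)) = gᵀ * M * g := by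
    intro g
    ext a b
    rw [of_apply, toBilin'_apply', Matrix.mul_assoc]
    simp only [mul_apply, dotProduct, mulVec, transpose_apply, col_apply]
  have h1 : f v = pf n M := by
    rw [hf]
    have := hBv 1
    rw [transpose_one, one_mul, mul_one] at this
    conv_rhs => rw [← this]
    congr 1
    ext a b
    simp only [of_apply]
    congr 2 <;> (ext; simp [v, e, one_apply, Pi.single_apply])
  have h2 : f (Function.update v j (v j + x • v i)) =
      pf n ((1 + single i j x)ᵀ * M * (1 + single i j x)) := by
    rw [hf, ← hBv]
    congr 1
    have : Function.update v j (v j + x • v i) = (1 + single i j x : Matrix _ _ A).col := by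
      ext a b
      by_cases ha : a = j
      · subst ha
        simp [v, e, one_apply, Pi.single_apply, single_apply, eq_comm]
      · simp [v, e, one_apply, Pi.single_apply, ha, Ne.symm ha]
    rw [this]
  rw [← h2, f.map_update_add, f.map_update_smul, Function.update_eq_self,
    f.map_update_self v hij.symm, smul_zero, add_zero, h1]

theorem pf_conj {n : ℕ} {M : Matrix (Fin n) (Fin n) A} (hM : IsAlt M)
    {g : SpecialLinearGroup (Fin n) A} (hg : g ∈ Elem n A) :
    pf n (g.1ᵀ * M * g.1) = pf n M := by
  suffices h : ∀ M, IsAlt M → pf n (g.1ᵀ * M * g.1) = pf n M from h M hM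
  induction hg using Subgroup.closure_induction with
  | mem g hg =>
    obtain ⟨i, j, hij, x, rfl⟩ := hg
    exact fun M hM => pf_conj_transvection hM hij x
  | one => intro M _; simp
  | mul g h _ _ ihg ihh =>
    intro M hM
    have : (g * h).1ᵀ * M * (g * h).1 = h.1ᵀ * (g.1ᵀ * M * g.1) * h.1 := by
      change (g.1 * h.1)ᵀ * M * (g.1 * h.1) = _
      rw [transpose_mul]; simp only [Matrix.mul_assoc]
    rw [this, ihh _ (hM.conj _), ihg _ hM]
  | inv g _ ih =>
    intro M hM
    rw [← ih _ (hM.conj _)]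
    congr 1
    calc _ = ((g⁻¹).1 * g.1)ᵀ * M * ((g⁻¹).1 * g.1) := by
          rw [transpose_mul]; simp only [Matrix.mul_assoc]
      _ = M := by rw [coe_inv_mul]; simp

end Pfaffian

/-! ### Congruence of alternating matrices. -/

section Congruence

variable {A : Type u} [CommRing A] {n : ℕ}

/-- Congruence `M' = gᵗ M g` by an element of `K`. -/
def Cong (K : Subgroup (SpecialLinearGroup (Fin n) A)) (M M' : Matrix (Fin n) (Fin n) A) : Prop :=
  ∃ g ∈ mats K, gᵀ * M * g = M'

variable {K : Subgroup (SpecialLinearGroup (Fin n) A)} {M M' M'' : Matrix (Fin n) (Fin n) A}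

theorem Cong.refl (M : Matrix (Fin n) (Fin n) A) : Cong K M M := ⟨1, one_mem _, by simp⟩

theorem Cong.trans (h : Cong K M M') (h' : Cong K M' M'') : Cong K M M'' := by
  obtain ⟨g, hg, rfl⟩ := h
  obtain ⟨k, hk, rfl⟩ := h'
  exact ⟨g * k, mul_mem hg hk, by rw [transpose_mul]; simp only [Matrix.mul_assoc]⟩

theorem Cong.symm (h : Cong K M M') : Cong K M' M := by
  obtain ⟨_, ⟨g, hg, rfl⟩, rfl⟩ := h
  refine ⟨_, ⟨g⁻¹, inv_mem hg, rfl⟩, ?_⟩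
  calc _ = (g.1 * (g⁻¹).1)ᵀ * M * (g.1 * (g⁻¹).1) := by
        rw [transpose_mul]; simp only [Matrix.mul_assoc]
    _ = M := by rw [coe_mul_inv]; simp

theorem Cong.isAlt (h : Cong K M M') (hM : IsAlt M) : IsAlt M' := by
  obtain ⟨g, -, rfl⟩ := h
  exact hM.conj g

theorem Cong.pf_eq (h : Cong (Elem n A) M M') (hM : IsAlt M) : pf n M' = pf n M := by
  obtain ⟨_, ⟨g, hg, rfl⟩, rfl⟩ := h
  exact pf_conj hM hg

theorem Cong.stabEquiv (h : Cong (Elem n A) M M') (hn : Even n) : StabEquiv M M' := by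
  obtain ⟨_, ⟨g, hg, rfl⟩, h⟩ := h.symm
  exact ⟨n, hn, le_rfl, le_rfl, g, hg, by rw [stab_self, stab_self, h]⟩

/-- Congruence by `1 + p q`. -/
theorem IsAlt.conj_vmv (hM : IsAlt M) (p q : Fin n → A) :
    (1 + vecMulVec p q)ᵀ * M * (1 + vecMulVec p q) =
      M + vecMulVec (M *ᵥ p) q - vecMulVec q (M *ᵥ p) := by
  have h1 : p ᵥ* M = -(M *ᵥ p) := by
    rw [← vecMul_transpose, hM.1, vecMul_neg, neg_neg]
  have h2 : vecMulVec q p * M * vecMulVec p q = 0 := by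
    rw [vecMulVec_mul, vmv_mul, h1, neg_dotProduct, dotProduct_comm, hM.dot_self]
    simp
  rw [transpose_add, transpose_one, transpose_vecMulVec, mul_add, add_mul, add_mul, mul_one,
    one_mul, add_mul, h2, mul_vecMulVec, vecMulVec_mul, h1, vecMulVec_neg]
  simp
  abel

theorem Cong.vmv (hM : IsAlt M) {p q : Fin n → A} (h : 1 + vecMulVec p q ∈ mats K) :
    Cong K M (M + vecMulVec (M *ᵥ p) q - vecMulVec q (M *ᵥ p)) :=
  ⟨_, h, hM.conj_vmv p q⟩

theorem good_elem (i j : Fin n) (hij : i ≠ j) : Good (mats (Elem n A)) ⊤ (e i) (e j) :=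
  good_e_e (fun _ _ hij x _ => transvection_mem hij x) i j hij

theorem row_mem_elem (i : Fin n) {q : Fin n → A} (hi : q i = 0) :
    1 + vecMulVec (e i) q ∈ mats (Elem n A) :=
  row_mem good_elem i hi fun _ => Submodule.mem_top

theorem stabEquiv_cast {m N : ℕ} (h : m = N) (hN : Even N) (M : Matrix (Fin N) (Fin N) A) :
    StabEquiv (M.submatrix (Fin.cast h) (Fin.cast h)) M := by
  subst h
  exact StabEquiv.refl hN M

theorem stabEquiv_stab {m N : ℕ} (h : m ≤ N) (hN : Even N) (M : Matrix (Fin m) (Fin m) A) :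
    StabEquiv (stab M N) M :=
  ⟨N, hN, le_rfl, h, 1, one_mem _, by simp [stab_self]⟩

end Congruence

/-! ### The Vaserstein symbol is well defined. -/

section Symbol

variable {A : Type u} [CommRing A]

theorem AltForm.isAlt (φ : AltForm A) : IsAlt φ.mat := ⟨φ.skew, φ.diag⟩

theorem WE.mk_eq {φ ψ : AltForm A} : WE.mk φ = WE.mk ψ ↔ StabEquiv φ.mat ψ.mat :=
  Quotient.eq (r := wittSetoid A)

/-- The matrix of the Vaserstein symbol. -/
def vmat (a b : Fin 3 → A) : Matrix (Fin 4) (Fin 4) A :=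
  !![0, a 0, a 1, a 2;
    -a 0, 0, b 2, -b 1;
    -a 1, -b 2, 0, b 0;
    -a 2, b 1, -b 0, 0]

theorem vmat_isAlt (a b : Fin 3 → A) : IsAlt (vmat a b) := by
  refine .of_swap (fun i j => ?_) fun i => ?_
  · fin_cases i <;> fin_cases j <;> simp [vmat]
  · fin_cases i <;> simp [vmat]

theorem pf_vmat (a b : Fin 3 → A) : pf 4 (vmat a b) = a ⬝ᵥ b := by
  simp [vmat, pf, Fin.sum_univ_succ, dotProduct, Fin.succAbove]

/-- Elementary operations on the first row of the symbol matrix change the dual only. -/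
theorem vmat_row_zero (a b q : Fin 3 → A) :
    (1 + vecMulVec (e 0) ![0, q 0, q 1, q 2])ᵀ * vmat a b *
      (1 + vecMulVec (e 0) ![0, q 0, q 1, q 2]) =
      vmat a (b + ![a 2 * q 1 - a 1 * q 2, a 0 * q 2 - a 2 * q 0, a 1 * q 0 - a 0 * q 1]) := by
  have h0 : vmat a b *ᵥ e 0 = ![0, -a 0, -a 1, -a 2] := by
    ext i
    fin_cases i <;> simp [vmat, e]
  rw [(vmat_isAlt a b).conj_vmv, h0]
  ext i j
  rw [Matrix.sub_apply, Matrix.add_apply, vecMulVec_apply, vecMulVec_apply]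
  fin_cases i <;> fin_cases j <;> simp [vmat] <;> ring

theorem vmat_dual {a b b' : Fin 3 → A} (h : a ⬝ᵥ b = 1) (h' : a ⬝ᵥ b' = 1) :
    Cong (Elem 4 A) (vmat a b) (vmat a b') := by
  simp only [dotProduct, Fin.sum_univ_three] at h h'
  let c := b' - b
  -- q = b × c, and the row operation adds q × a = (a · b) c - (a · c) b = c to the dual, because a
  -- · b = 1 and a · c = 0.
  let q : Fin 3 → A := ![c 2 * b 1 - c 1 * b 2, c 0 * b 2 - c 2 * b 0, c 1 * b 0 - c 0 * b 1]
  refine ⟨_, row_mem_elem 0 (q := ![0, q 0, q 1, q 2]) (by simp), ?_⟩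
  rw [vmat_row_zero]
  congr 1
  ext i
  fin_cases i <;> simp [q, c]
  · linear_combination (b' 0) * h - b 0 * h'
  · linear_combination (b' 1) * h - b 1 * h'
  · linear_combination (b' 2) * h - b 2 * h'

/-- The lower right block is the cross product matrix of the dual, so a congruence by a matrix of
determinant one acts on the dual through the inverse. -/
theorem vmat_transvection {i j : Fin 3} (hij : i ≠ j) (x : A) (a b : Fin 3 → A) :
    (1 + single i.succ j.succ x)ᵀ * vmat a b * (1 + single i.succ j.succ x) =
      vmat (a ᵥ* (1 + single i j x)) ((1 + single i j (-x)) *ᵥ b) := by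
  have e1 : (single i.succ j.succ x : Matrix (Fin 4) (Fin 4) A) =
      vecMulVec (e i.succ) (x • e j.succ) := by
    rw [vecMulVec_smul, vecMulVec_e_e]
  rw [e1, (vmat_isAlt a b).conj_vmv, ← vecMulVec_e_e, ← vecMulVec_e_e, trans_vecMul, trans_mulVec]
  fin_cases i <;> fin_cases j <;> first | exact absurd rfl hij | skip
  all_goals
    ext k l
    fin_cases k <;> fin_cases l <;>
      simp [vmat, vecMulVec_apply, e] <;> ring

theorem vmat_elem {g : SpecialLinearGroup (Fin 3) A} (hg : g ∈ Elem 3 A) (a : Fin 3 → A) :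
    ∀ b, Cong (Elem 4 A) (vmat a b) (vmat (a ᵥ* g.1) ((g⁻¹).1 *ᵥ b)) := by
  induction hg using Subgroup.closure_induction generalizing a with
  | mem g hg =>
    obtain ⟨i, j, hij, x, rfl⟩ := hg
    intro b
    have := vmat_transvection hij x a b
    refine ⟨_, ⟨_, transvection_mem (fun h => hij (Fin.succ_injective _ h)) x, rfl⟩, ?_⟩
    rw [SpecialLinearGroup.transvection_inv]
    exact this
  | one => intro b; simpa using Cong.refl _
  | mul g h _ _ ihg ihh =>
    intro b
    have := (ihg a b).trans (ihh _ _)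
    rw [vecMul_vecMul, mulVec_mulVec] at this
    rw [_root_.mul_inv_rev]
    exact this
  | inv g _ ih =>
    intro b
    have := (ih (a ᵥ* (g⁻¹).1) (g.1 *ᵥ b)).symm
    rw [vecMul_vecMul, mulVec_mulVec, coe_inv_mul, vecMul_one, one_mulVec] at this
    rw [inv_inv]
    exact this

/-- The Vaserstein symbol is well defined. -/
theorem vmat_cong_of_orb {a a' b b' : Fin 3 → A} (h : a ⬝ᵥ b = 1) (h' : a' ⬝ᵥ b' = 1)
    (ho : Orb (Elem 3 A) a a') : Cong (Elem 4 A) (vmat a b) (vmat a' b') := by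
  obtain ⟨_, ⟨g, hg, rfl⟩, rfl⟩ := ho
  refine (vmat_elem hg a b).trans (vmat_dual ?_ h')
  rw [dotProduct_mulVec, vecMul_vecMul, coe_mul_inv, vecMul_one, h]

theorem mk_vaserstein_eq {a a' b b' : Fin 3 → A} (h : a ⬝ᵥ b = 1) (h' : a' ⬝ᵥ b' = 1)
    (ho : Orb (Elem 3 A) a a') : WE.mk (vaserstein a b h) = WE.mk (vaserstein a' b' h') :=
  WE.mk_eq.2 ((vmat_cong_of_orb h h' ho).stabEquiv ⟨2, rfl⟩)

theorem IsAlt.eq_vmat {M : Matrix (Fin 4) (Fin 4) A} (hM : IsAlt M) :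
    M = vmat ![M 0 1, M 0 2, M 0 3] ![M 2 3, -M 1 3, M 1 2] := by
  have h0 := hM.2
  have h1 := hM.swap
  ext i j
  fin_cases i <;> fin_cases j <;> simp [vmat, h0] <;> exact h1 _ _

end Symbol

/-! ### Splitting off hyperbolic planes. -/

section Splitting

variable {A : Type u} [CommRing A]

/-- The matrix `1 ⊥ g`, with its blocks in terms of successors. -/
theorem exists_border {n : ℕ} {g : Matrix (Fin n) (Fin n) A} (hg : g ∈ mats (Elem n A)) :
    ∃ h ∈ mats (Elem (n + 1) A), h 0 0 = 1 ∧ (∀ j : Fin n, h 0 j.succ = 0) ∧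
      (∀ i : Fin n, h i.succ 0 = 0) ∧ ∀ i j : Fin n, h i.succ j.succ = g i j := by
  obtain ⟨g, hg, rfl⟩ := hg
  obtain ⟨g', hg', e'⟩ := perp_one_mem (k := 1) hg
  have cast : ∀ N, ∀ hN : N = 1 + n, (g'.1.submatrix (Fin.cast hN) (Fin.cast hN)) ∈
      mats (Elem N A) := by
    rintro N rfl
    exact ⟨g', hg', rfl⟩
  refine ⟨_, cast (n + 1) (by omega), ?_, fun j => ?_, fun i => ?_, fun i j => ?_⟩
  · rw [e', submatrix_apply, perp_lt _ _ _ _ (by simp) (by simp)]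
    rfl
  · rw [e', submatrix_apply, perp_lt_ge _ _ _ _ (by simp) (by simp)]
  · rw [e', submatrix_apply, perp_ge_lt _ _ _ _ (by simp) (by simp)]
  · rw [e', submatrix_apply, perp_ge _ _ _ _ (by simp) (by simp)]
    simp

/-- The signed sub-Pfaffians of the expansion along the first row form a dual. -/
theorem isUnimodular_row_of_pf {k : ℕ} {M : Matrix (Fin (k + 2)) (Fin (k + 2)) A}
    (hp : pf (k + 2) M = 1) : IsUnimodular fun j : Fin (k + 1) => M 0 j.succ := by
  rw [pf_succ_succ] at hp
  refine ⟨fun j => (-1) ^ (j : ℕ) *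
    pf k (M.submatrix (fun i => (j.succAbove i).succ) (fun i => (j.succAbove i).succ)), ?_⟩
  refine Eq.trans ?_ hp
  exact Finset.sum_congr rfl fun j _ => by ring

/-- If the first row is in the orbit of `e_1`, a hyperbolic plane splits off. -/
theorem exists_split {k : ℕ} (hk : Even k) {M : Matrix (Fin (k + 2)) (Fin (k + 2)) A}
    (hM : IsAlt M) (ho : Orb (Elem (k + 1) A) (fun j : Fin (k + 1) => M 0 j.succ) (e 0)) :
    ∃ M' : Matrix (Fin k) (Fin k) A, IsAlt M' ∧ pf k M' = pf (k + 2) M ∧ StabEquiv M M' := by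
  obtain ⟨g, hg, ho⟩ := ho
  obtain ⟨h, hh, h00, h0s, hs0, hss⟩ := exists_border hg
  have c1 : Cong (Elem (k + 2) A) M (hᵀ * M * h) := ⟨h, hh, rfl⟩
  set M₁ := hᵀ * M * h with hM₁
  have a1 : IsAlt M₁ := c1.isAlt hM
  have r1 : ∀ j : Fin (k + 1), M₁ 0 j.succ = (e 0 : Fin (k + 1) → A) j := by
    intro j
    rw [← ho, hM₁, mul_apply, Fin.sum_univ_succ, h0s, mul_zero, zero_add]
    refine Finset.sum_congr rfl fun l _ => ?_
    rw [hss, mul_apply, Fin.sum_univ_succ]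
    simp [h00, hs0]
  have r1' : ∀ j, M₁ 0 j = (e 1 : Fin (k + 2) → A) j := by
    intro j
    refine Fin.cases ?_ (fun j => ?_) j
    · rw [a1.2, e_ne (by simp)]
    · rw [r1, ← Fin.succ_zero_eq_one]
      by_cases hj : j = 0
      · subst hj; rw [e_self, e_self]
      · rw [e_ne (Ne.symm hj), e_ne fun h => hj (Fin.succ_injective _ h).symm]
  -- With the row of index 0 already equal to the basis vector of index 1, adding multiples of that
  -- row and column clears the rest of the row of index 1.
  let q : Fin (k + 2) → A := fun j => if (j : ℕ) < 2 then 0 else M₁ 1 j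
  have c2 := Cong.vmv a1 (row_mem_elem 0 (q := q) (by simp [q]))
  have hcol : M₁ *ᵥ e 0 = -e 1 := by
    ext i
    rw [mulVec, dot_e, a1.swap, r1', Pi.neg_apply]
  rw [hcol] at c2
  set M₂ := M₁ + vecMulVec (-e 1) q - vecMulVec q (-e 1) with hM₂
  have a2 : IsAlt M₂ := c2.isAlt a1
  have m2 : ∀ i j, M₂ i j = M₁ i j - (e 1 : Fin (k + 2) → A) i * q j +
      q i * (e 1 : Fin (k + 2) → A) j := by
    intro i j
    simp [hM₂, vecMulVec_apply, sub_eq_add_neg]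
  have r2 : ∀ j, M₂ 0 j = (e 1 : Fin (k + 2) → A) j := by
    intro j
    rw [m2, r1', e_ne (i := 1) (j := 0) (by simp)]
    simp [q]
  have r3 : ∀ j : Fin (k + 2), 2 ≤ (j : ℕ) → M₂ 1 j = 0 := by
    intro j hj
    have hq : q j = M₁ 1 j := if_neg (by omega)
    have hj1 : (1 : Fin (k + 2)) ≠ j := by
      rintro rfl
      simp at hj
    rw [m2, hq, e_self, e_ne hj1]
    ring
  set M' := M₂.submatrix (fun i : Fin k => i.succ.succ) (fun i : Fin k => i.succ.succ) with hM'
  have hpf : pf (k + 2) M₂ = pf k M' := by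
    rw [pf_succ_succ, Finset.sum_eq_single 0]
    · rw [r2, Fin.succ_zero_eq_one, e_self]
      simp [hM']
    · intro j _ hj
      rw [r2, ← Fin.succ_zero_eq_one, e_ne fun h => hj (Fin.succ_injective _ h).symm]
      ring
    · simp
  refine ⟨M', a2.submatrix _, ?_, ?_⟩
  · rw [← hpf, c2.pf_eq a1, c1.pf_eq hM]
  · have s1 := (c1.trans c2).stabEquiv (hk.add even_two)
    refine s1.trans ?_
    let ψ : Matrix (Fin 2) (Fin 2) A := of fun i j => stdEntry A (i + k) (j + k)
    have e1 : M₂ = (perp ψ M').submatrix (Fin.cast (by omega)) (Fin.cast (by omega)) := by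
      have hψ : ∀ i j : Fin 2, ψ i j = stdEntry A i j := fun i j => by
        have := stdEntry_shift (A := A) (i := i + k) (j := j + k) hk (by omega) (by omega)
        rw [Nat.add_sub_cancel, Nat.add_sub_cancel] at this
        exact this.symm
      have hge : ∀ i : Fin (k + 2), 2 ≤ (i : ℕ) → ∃ i' : Fin k, i = i'.succ.succ := fun i hi =>
        ⟨⟨i - 2, by omega⟩, by ext; simp; omega⟩
      have hlt : ∀ i : Fin (k + 2), (i : ℕ) < 2 → i = 0 ∨ i = 1 := fun i hi => by
        rcases (show (i : ℕ) = 0 ∨ (i : ℕ) = 1 by omega) with h | h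
        · left; ext; simpa using h
        · right; ext; simpa using h
      have h01 : M₂ 0 1 = 1 := by rw [r2, e_self]
      have h10 : M₂ 1 0 = -1 := by rw [a2.swap, h01]
      have z : ∀ i j : Fin (k + 2), (i : ℕ) < 2 → 2 ≤ (j : ℕ) → M₂ i j = 0 := by
        intro i j hi hj
        rcases hlt i hi with rfl | rfl
        · rw [r2, e_ne]
          rintro rfl
          simp at hj
        · exact r3 j hj
      ext i j
      rw [submatrix_apply]
      by_cases hi : (i : ℕ) < 2 <;> by_cases hj : (j : ℕ) < 2
      · rw [perp_lt _ _ _ _ (by rw [Fin.val_cast]; omega) (by rw [Fin.val_cast]; omega), hψ]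
        rcases hlt i hi with rfl | rfl <;> rcases hlt j hj with rfl | rfl <;>
          simp [stdEntry, a2.2, h01, h10]
      · rw [perp_lt_ge _ _ _ _ (by rw [Fin.val_cast]; omega) (by rw [Fin.val_cast]; omega), z i j hi (by omega)]
      · rw [perp_ge_lt _ _ _ _ (by rw [Fin.val_cast]; omega) (by rw [Fin.val_cast]; omega), a2.swap,
          z j i hj (by omega), neg_zero]
      · rw [perp_ge _ _ _ _ (by rw [Fin.val_cast]; omega) (by rw [Fin.val_cast]; omega)]
        obtain ⟨i, rfl⟩ := hge i (by omega)
        obtain ⟨j, rfl⟩ := hge j (by omega)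
        simp [hM']
    rw [e1]
    refine (stabEquiv_cast _ (even_two.add hk) _).trans ((perp_comm even_two hk _ _).trans ?_)
    rw [← stab_add hk]
    exact stabEquiv_stab (by omega) (hk.add even_two) M'

theorem stdEntry_swap (i j : ℕ) : stdEntry A i j = -stdEntry A j i := by
  unfold stdEntry
  by_cases h1 : Even i ∧ j = i + 1
  · have : ¬(Even j ∧ i = j + 1) := by omega
    rw [if_pos h1, if_neg this, if_pos h1, neg_neg]
  · by_cases h2 : Even j ∧ i = j + 1 <;> simp [h1, h2]

theorem stdEntry_self (i : ℕ) : stdEntry A i i = 0 := by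
  simp [stdEntry]

theorem IsAlt.stab {n : ℕ} {M : Matrix (Fin n) (Fin n) A} (hM : IsAlt M) (N : ℕ) :
    IsAlt (stab M N) := by
  refine .of_swap (fun i j => ?_) fun i => ?_
  · simp only [WittOrbit.stab, of_apply]
    by_cases h : (i : ℕ) < n ∧ (j : ℕ) < n
    · rw [dif_pos h, dif_pos h.symm, hM.swap]
    · rw [dif_neg h, dif_neg (by omega), stdEntry_swap]
  · simp only [WittOrbit.stab, of_apply]
    split_ifs with h
    · exact hM.2 _
    · exact stdEntry_self _

theorem pf_stab_add_two {n : ℕ} (hn : Even n) (M : Matrix (Fin n) (Fin n) A) :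
    pf (n + 2) (stab M (n + 2)) = pf n M := by
  rw [stab_add hn, pf_perp _ _ hn]
  simp [pf, stdEntry, hn, add_comm]

/-- Every alternating matrix of Pfaffian `1` is stably equivalent to a Vaserstein symbol, if
elementary groups act transitively on rows of length at least five. -/
theorem exists_vmat (H : ∀ n, 4 ≤ n → ∀ v : Fin (n + 1) → A, IsUnimodular v →
      Orb (Elem (n + 1) A) v (e 0)) : (m : ℕ) → Even m → (M : Matrix (Fin m) (Fin m) A) →
      IsAlt M → pf m M = 1 → ∃ a b : Fin 3 → A, a ⬝ᵥ b = 1 ∧ StabEquiv M (vmat a b) := by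
  have h4 : ∀ M : Matrix (Fin 4) (Fin 4) A, IsAlt M → pf 4 M = 1 →
      ∃ a b : Fin 3 → A, a ⬝ᵥ b = 1 ∧ StabEquiv M (vmat a b) := fun M hM hp =>
    ⟨![M 0 1, M 0 2, M 0 3], ![M 2 3, -M 1 3, M 1 2], by rw [← pf_vmat, ← hM.eq_vmat, hp], by
      rw [← hM.eq_vmat]; exact StabEquiv.refl ⟨2, rfl⟩ M⟩
  intro m
  induction m using Nat.strong_induction_on with
  | _ m ih =>
    intro hm M hM hp
    obtain ⟨c, rfl⟩ := hm
    obtain rfl | rfl | rfl | ⟨k, rfl⟩ :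
        c = 0 ∨ c = 1 ∨ c = 2 ∨ ∃ k, c = k + 3 := by
      rcases c with _ | _ | _ | k
      · simp
      · simp
      · simp
      · exact Or.inr (Or.inr (Or.inr ⟨k, rfl⟩))
    -- Sizes 0 and 2 are enlarged to 4 by standard planes; only sizes from 6 on use the splitting.
    · obtain ⟨a, b, hab, h⟩ := h4 _ (hM.stab 4) (by
        rw [← stab_stab (N := 2) (by omega), pf_stab_add_two (n := 2) even_two,
          pf_stab_add_two (n := 0) (by simp), hp])
      exact ⟨a, b, hab, (stabEquiv_stab (by omega) ⟨2, rfl⟩ M).symm.trans h⟩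
    · obtain ⟨a, b, hab, h⟩ := h4 _ (hM.stab 4) (by
        rw [pf_stab_add_two (n := 2) even_two, hp])
      exact ⟨a, b, hab, (stabEquiv_stab (by omega) ⟨2, rfl⟩ M).symm.trans h⟩
    · exact h4 M hM hp
    · have aux : ∀ N, N = k + k + 4 + 2 → ∀ M : Matrix (Fin N) (Fin N) A, IsAlt M → pf N M = 1 →
          (∀ M' : Matrix (Fin (k + k + 4)) (Fin (k + k + 4)) A, IsAlt M' →
            pf (k + k + 4) M' = 1 → ∃ a b : Fin 3 → A, a ⬝ᵥ b = 1 ∧ StabEquiv M' (vmat a b)) →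
          ∃ a b : Fin 3 → A, a ⬝ᵥ b = 1 ∧ StabEquiv M (vmat a b) := by
        rintro _ rfl M hM hp ih
        obtain ⟨M', hM', hp', hs⟩ := exists_split ⟨k + 2, by omega⟩ hM
          (H _ (by omega) _ (isUnimodular_row_of_pf hp))
        obtain ⟨a, b, hab, h'⟩ := ih M' hM' (hp'.trans hp)
        exact ⟨a, b, hab, hs.trans h'⟩
      exact aux _ (by omega) M hM hp (ih _ (by omega) ⟨k + 2, by omega⟩)

end Splitting

/-! ### Block operations on alternating matrices. -/

section Blocks

variable {A : Type u} [CommRing A] {n : ℕ}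

/-- Block matrices indexed by `Fin (n + n)`. -/
def blk (P M N Q : Matrix (Fin n) (Fin n) A) : Matrix (Fin (n + n)) (Fin (n + n)) A :=
  (fromBlocks P M N Q).submatrix finSumFinEquiv.symm finSumFinEquiv.symm

theorem blk_mul (P M N Q P' M' N' Q' : Matrix (Fin n) (Fin n) A) :
    blk P M N Q * blk P' M' N' Q' =
      blk (P * P' + M * N') (P * M' + M * Q') (N * P' + Q * N') (N * M' + Q * Q') := by
  simp [blk, submatrix_mul_equiv, fromBlocks_multiply]

theorem blk_transpose {A : Type u} (P M N Q : Matrix (Fin n) (Fin n) A) :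
    (blk P M N Q)ᵀ = blk Pᵀ Nᵀ Mᵀ Qᵀ := by
  simp [blk, transpose_submatrix, fromBlocks_transpose]

theorem blk_one : blk (1 : Matrix (Fin n) (Fin n) A) 0 0 1 = 1 := by
  simp [blk, fromBlocks_one]

theorem blk_upper_mem (S : Matrix (Fin n) (Fin n) A) :
    blk 1 S 0 1 ∈ mats (Elem (n + n) A) := by
  induction S using Matrix.induction_on' with
  | h_zero => rw [blk_one]; exact one_mem _
  | h_add p q hp hq =>
    have : blk 1 (p + q) 0 1 = blk 1 p 0 1 * blk 1 q 0 1 := by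
      rw [blk_mul]; simp [add_comm]
    rw [this]
    exact mul_mem hp hq
  | h_std_basis i j x =>
    refine ⟨_, transvection_mem (i := Fin.castAdd n i) (j := Fin.natAdd n j) ?_ x, ?_⟩
    · intro h
      have := congrArg Fin.val h
      simp at this
      omega
    · change 1 + single (Fin.castAdd n i) (Fin.natAdd n j) x = _
      rw [← blk_one]
      ext a b
      refine Fin.addCases (fun a => ?_) (fun a => ?_) a <;>
        refine Fin.addCases (fun b => ?_) (fun b => ?_) b <;>
        simp only [blk, single_apply, Fin.ext_iff, Matrix.add_apply, submatrix_apply,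
          finSumFinEquiv_symm_apply_castAdd, finSumFinEquiv_symm_apply_natAdd, fromBlocks_apply₁₁,
          fromBlocks_apply₁₂, fromBlocks_apply₂₁, fromBlocks_apply₂₂, Fin.val_castAdd,
          Fin.val_natAdd, Matrix.zero_apply] <;> grind

theorem blk_lower_mem (S : Matrix (Fin n) (Fin n) A) :
    blk 1 0 S 1 ∈ mats (Elem (n + n) A) := by
  obtain ⟨g, hg, h⟩ := blk_upper_mem Sᵀ
  refine ⟨g.transpose, elem_transpose hg, ?_⟩
  change g.1ᵀ = _
  rw [h, blk_transpose]
  simp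

theorem blk_diag_mem {g : Matrix (Fin n) (Fin n) A} (hg : g ∈ mats (Elem n A)) :
    blk 1 0 0 g ∈ mats (Elem (n + n) A) := by
  obtain ⟨g, hg, rfl⟩ := hg
  obtain ⟨g', hg', h⟩ := perp_one_mem (k := n) hg
  exact ⟨g', hg', h⟩

variable {P M Q : Matrix (Fin n) (Fin n) A}

theorem cong_blk_diag {g : Matrix (Fin n) (Fin n) A} (hg : g ∈ mats (Elem n A)) :
    Cong (Elem (n + n) A) (blk P M (-Mᵀ) Q) (blk P (M * g) (-(M * g)ᵀ) (gᵀ * Q * g)) := by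
  refine ⟨_, blk_diag_mem hg, ?_⟩
  rw [blk_transpose, blk_mul, blk_mul]
  simp

theorem cong_blk_upper (hP : Pᵀ = -P) (S : Matrix (Fin n) (Fin n) A) :
    Cong (Elem (n + n) A) (blk P M (-Mᵀ) Q) (blk P (M + P * S) (-(M + P * S)ᵀ)
      (Q + Sᵀ * M - Mᵀ * S + Sᵀ * P * S)) := by
  refine ⟨_, blk_upper_mem S, ?_⟩
  rw [blk_transpose, blk_mul, blk_mul]
  simp only [transpose_one, transpose_zero, one_mul, mul_one, Matrix.mul_zero, Matrix.zero_mul,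
    add_zero, transpose_add, transpose_mul, hP]
  congr 1
  · exact add_comm _ _
  · simp only [Matrix.mul_neg, neg_add, neg_neg]; abel
  · rw [add_mul]; noncomm_ring

theorem cong_blk_lower (hQ : Qᵀ = -Q) (T : Matrix (Fin n) (Fin n) A) :
    Cong (Elem (n + n) A) (blk P M (-Mᵀ) Q) (blk (P + M * T - Tᵀ * Mᵀ + Tᵀ * Q * T)
      (M + Tᵀ * Q) (-(M + Tᵀ * Q)ᵀ) Q) := by
  refine ⟨_, blk_lower_mem T, ?_⟩
  rw [blk_transpose, blk_mul, blk_mul]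
  simp only [transpose_one, transpose_zero, one_mul, mul_one, Matrix.mul_zero, Matrix.zero_mul,
    zero_add, transpose_add, transpose_mul, hQ, transpose_transpose]
  congr 1
  · rw [add_mul]; noncomm_ring
  · simp only [Matrix.neg_mul, neg_add, neg_neg]

end Blocks

/-! ### Explicit 4 × 4 arithmetic. -/

section FourByFour

variable {A : Type u}
  {a₀₀ a₀₁ a₀₂ a₀₃ a₁₀ a₁₁ a₁₂ a₁₃ a₂₀ a₂₁ a₂₂ a₂₃ a₃₀ a₃₁ a₃₂ a₃₃
    b₀₀ b₀₁ b₀₂ b₀₃ b₁₀ b₁₁ b₁₂ b₁₃ b₂₀ b₂₁ b₂₂ b₂₃ b₃₀ b₃₁ b₃₂ b₃₃ : A}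

theorem mul_four [CommRing A] :
    !![a₀₀, a₀₁, a₀₂, a₀₃;
      a₁₀, a₁₁, a₁₂, a₁₃;
      a₂₀, a₂₁, a₂₂, a₂₃;
      a₃₀, a₃₁, a₃₂, a₃₃] *
    !![b₀₀, b₀₁, b₀₂, b₀₃;
      b₁₀, b₁₁, b₁₂, b₁₃;
      b₂₀, b₂₁, b₂₂, b₂₃;
      b₃₀, b₃₁, b₃₂, b₃₃] =
    !![a₀₀ * b₀₀ + a₀₁ * b₁₀ + a₀₂ * b₂₀ + a₀₃ * b₃₀, a₀₀ * b₀₁ + a₀₁ * b₁₁ + a₀₂ * b₂₁ + a₀₃ * b₃₁, a₀₀ * b₀₂ + a₀₁ * b₁₂ + a₀₂ * b₂₂ + a₀₃ * b₃₂, a₀₀ * b₀₃ + a₀₁ * b₁₃ + a₀₂ * b₂₃ + a₀₃ * b₃₃;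
      a₁₀ * b₀₀ + a₁₁ * b₁₀ + a₁₂ * b₂₀ + a₁₃ * b₃₀, a₁₀ * b₀₁ + a₁₁ * b₁₁ + a₁₂ * b₂₁ + a₁₃ * b₃₁, a₁₀ * b₀₂ + a₁₁ * b₁₂ + a₁₂ * b₂₂ + a₁₃ * b₃₂, a₁₀ * b₀₃ + a₁₁ * b₁₃ + a₁₂ * b₂₃ + a₁₃ * b₃₃;
      a₂₀ * b₀₀ + a₂₁ * b₁₀ + a₂₂ * b₂₀ + a₂₃ * b₃₀, a₂₀ * b₀₁ + a₂₁ * b₁₁ + a₂₂ * b₂₁ + a₂₃ * b₃₁, a₂₀ * b₀₂ + a₂₁ * b₁₂ + a₂₂ * b₂₂ + a₂₃ * b₃₂, a₂₀ * b₀₃ + a₂₁ * b₁₃ + a₂₂ * b₂₃ + a₂₃ * b₃₃;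
      a₃₀ * b₀₀ + a₃₁ * b₁₀ + a₃₂ * b₂₀ + a₃₃ * b₃₀, a₃₀ * b₀₁ + a₃₁ * b₁₁ + a₃₂ * b₂₁ + a₃₃ * b₃₁, a₃₀ * b₀₂ + a₃₁ * b₁₂ + a₃₂ * b₂₂ + a₃₃ * b₃₂, a₃₀ * b₀₃ + a₃₁ * b₁₃ + a₃₂ * b₂₃ + a₃₃ * b₃₃] := by
  ext i j
  rw [mul_apply, Fin.sum_univ_four]
  fin_cases i <;> fin_cases j <;> rfl

theorem add_four [CommRing A] :
    !![a₀₀, a₀₁, a₀₂, a₀₃;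
      a₁₀, a₁₁, a₁₂, a₁₃;
      a₂₀, a₂₁, a₂₂, a₂₃;
      a₃₀, a₃₁, a₃₂, a₃₃] +
    !![b₀₀, b₀₁, b₀₂, b₀₃;
      b₁₀, b₁₁, b₁₂, b₁₃;
      b₂₀, b₂₁, b₂₂, b₂₃;
      b₃₀, b₃₁, b₃₂, b₃₃] =
    !![a₀₀ + b₀₀, a₀₁ + b₀₁, a₀₂ + b₀₂, a₀₃ + b₀₃;
      a₁₀ + b₁₀, a₁₁ + b₁₁, a₁₂ + b₁₂, a₁₃ + b₁₃;
      a₂₀ + b₂₀, a₂₁ + b₂₁, a₂₂ + b₂₂, a₂₃ + b₂₃;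
      a₃₀ + b₃₀, a₃₁ + b₃₁, a₃₂ + b₃₂, a₃₃ + b₃₃] := by
  ext i j
  fin_cases i <;> fin_cases j <;> rfl

theorem sub_four [CommRing A] :
    !![a₀₀, a₀₁, a₀₂, a₀₃;
      a₁₀, a₁₁, a₁₂, a₁₃;
      a₂₀, a₂₁, a₂₂, a₂₃;
      a₃₀, a₃₁, a₃₂, a₃₃] -
    !![b₀₀, b₀₁, b₀₂, b₀₃;
      b₁₀, b₁₁, b₁₂, b₁₃;
      b₂₀, b₂₁, b₂₂, b₂₃;
      b₃₀, b₃₁, b₃₂, b₃₃] =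
    !![a₀₀ - b₀₀, a₀₁ - b₀₁, a₀₂ - b₀₂, a₀₃ - b₀₃;
      a₁₀ - b₁₀, a₁₁ - b₁₁, a₁₂ - b₁₂, a₁₃ - b₁₃;
      a₂₀ - b₂₀, a₂₁ - b₂₁, a₂₂ - b₂₂, a₂₃ - b₂₃;
      a₃₀ - b₃₀, a₃₁ - b₃₁, a₃₂ - b₃₂, a₃₃ - b₃₃] := by
  ext i j
  fin_cases i <;> fin_cases j <;> rfl

theorem neg_four [CommRing A] :
    -!![a₀₀, a₀₁, a₀₂, a₀₃;
      a₁₀, a₁₁, a₁₂, a₁₃;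
      a₂₀, a₂₁, a₂₂, a₂₃;
      a₃₀, a₃₁, a₃₂, a₃₃] =
    !![-a₀₀, -a₀₁, -a₀₂, -a₀₃;
      -a₁₀, -a₁₁, -a₁₂, -a₁₃;
      -a₂₀, -a₂₁, -a₂₂, -a₂₃;
      -a₃₀, -a₃₁, -a₃₂, -a₃₃] := by
  ext i j
  fin_cases i <;> fin_cases j <;> rfl

theorem transpose_four :
    !![a₀₀, a₀₁, a₀₂, a₀₃;
      a₁₀, a₁₁, a₁₂, a₁₃;
      a₂₀, a₂₁, a₂₂, a₂₃;
      a₃₀, a₃₁, a₃₂, a₃₃]ᵀ =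
    !![a₀₀, a₁₀, a₂₀, a₃₀;
      a₀₁, a₁₁, a₂₁, a₃₁;
      a₀₂, a₁₂, a₂₂, a₃₂;
      a₀₃, a₁₃, a₂₃, a₃₃] := by
  ext i j
  fin_cases i <;> fin_cases j <;> rfl

theorem ext_four (h₀₀ : a₀₀ = b₀₀) (h₀₁ : a₀₁ = b₀₁) (h₀₂ : a₀₂ = b₀₂) (h₀₃ : a₀₃ = b₀₃) (h₁₀ : a₁₀ = b₁₀) (h₁₁ : a₁₁ = b₁₁) (h₁₂ : a₁₂ = b₁₂) (h₁₃ : a₁₃ = b₁₃) (h₂₀ : a₂₀ = b₂₀) (h₂₁ : a₂₁ = b₂₁) (h₂₂ : a₂₂ = b₂₂) (h₂₃ : a₂₃ = b₂₃) (h₃₀ : a₃₀ = b₃₀) (h₃₁ : a₃₁ = b₃₁) (h₃₂ : a₃₂ = b₃₂) (h₃₃ : a₃₃ = b₃₃) :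
    !![a₀₀, a₀₁, a₀₂, a₀₃;
      a₁₀, a₁₁, a₁₂, a₁₃;
      a₂₀, a₂₁, a₂₂, a₂₃;
      a₃₀, a₃₁, a₃₂, a₃₃] =
    !![b₀₀, b₀₁, b₀₂, b₀₃;
      b₁₀, b₁₁, b₁₂, b₁₃;
      b₂₀, b₂₁, b₂₂, b₂₃;
      b₃₀, b₃₁, b₃₂, b₃₃] := by
  subst h₀₀ h₀₁ h₀₂ h₀₃ h₁₀ h₁₁ h₁₂ h₁₃ h₂₀ h₂₁ h₂₂ h₂₃ h₃₀ h₃₁ h₃₂ h₃₃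
  rfl

end FourByFour

/-! ### The sum of two symbols as a symbol. -/

section Product

variable {A : Type u} [CommRing A]

theorem col_mem_elem {n : ℕ} (j : Fin n) {p : Fin n → A} (hj : p j = 0) :
    1 + vecMulVec p (e j) ∈ mats (Elem n A) :=
  col_mem good_elem j hj fun _ => Submodule.mem_top

theorem stabEquiv_permute {n : ℕ} (hn : Even n) (M : Matrix (Fin n) (Fin n) A)
    (σ : Equiv.Perm (Fin n)) (hσ : Equiv.Perm.sign σ = 1) : StabEquiv M (M.submatrix σ σ) := by
  obtain ⟨g, hg, h⟩ := permMat_mem (A := A) σ hσ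
  exact Cong.stabEquiv ⟨_, ⟨g, hg, h⟩, permMat_conj σ M⟩ hn

/-- Both `diag(J, J)`-symplectic and elementary. -/
theorem whitehead_mem {y₁₁ y₁₂ y₂₁ y₂₂ s : A} (h : y₁₁ * y₂₂ - y₁₂ * y₂₁ = 1 - s) :
    !![s, 0, (1 + s) * y₁₁, (1 + s) * y₁₂; 0, s, y₂₁, y₂₂;
      -y₂₂, (1 + s) * y₁₂, s, 0; y₂₁, -((1 + s) * y₁₁), 0, s] ∈ mats (Elem 4 A) := by
  have h1 : 1 + vecMulVec ![0, 0, y₁₂, -y₁₁] (e 1) ∈ mats (Elem 4 A) := col_mem_elem 1 rfl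
  have h2 : 1 + vecMulVec (e 0) ![0, 0, y₁₁, y₁₂] ∈ mats (Elem 4 A) := row_mem_elem 0 rfl
  have h3 : 1 + vecMulVec ![0, 0, -y₂₂, y₂₁] (e 0) ∈ mats (Elem 4 A) := col_mem_elem 0 rfl
  have h4 : 1 + vecMulVec (e 1) ![0, 0, y₂₁, y₂₂] ∈ mats (Elem 4 A) := row_mem_elem 1 rfl
  have hE := mul_mem h1 h2
  have hF := mul_mem h3 h4
  have eE : (1 + vecMulVec ![0, 0, y₁₂, -y₁₁] (e 1)) * (1 + vecMulVec (e 0) ![0, 0, y₁₁, y₁₂]) =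
      !![1, 0, y₁₁, y₁₂; 0, 1, 0, 0; 0, y₁₂, 1, 0; 0, -y₁₁, 0, 1] := by
    rw [add_mul, mul_add, mul_add, vmv_mul, e_dot, e_ne (by decide)]
    ext i j
    simp only [Matrix.add_apply, vecMulVec_apply, one_mul, mul_one, zero_smul, add_zero]
    fin_cases i <;> fin_cases j <;> simp [e]
  have eF : (1 + vecMulVec ![0, 0, -y₂₂, y₂₁] (e 0)) * (1 + vecMulVec (e 1) ![0, 0, y₂₁, y₂₂]) =
      !![1, 0, 0, 0; 0, 1, y₂₁, y₂₂; -y₂₂, 0, 1, 0; y₂₁, 0, 0, 1] := by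
    rw [add_mul, mul_add, mul_add, vmv_mul, e_dot, e_ne (by decide)]
    ext i j
    simp only [Matrix.add_apply, vecMulVec_apply, one_mul, mul_one, zero_smul, add_zero]
    fin_cases i <;> fin_cases j <;> simp [e]
  have := mul_mem (mul_mem hE hF) hE
  rw [eE, eF] at this
  rw [mul_four, mul_four] at this
  convert this using 1
  apply ext_four <;>
    first
      | ring1
      | linear_combination h
      | linear_combination -h
      | linear_combination y₁₁ * h
      | linear_combination y₁₂ * h
      | linear_combination -y₁₁ * h

/-- Whitehead's lemma modulo `s = d δ`, in the symplectic setting. -/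
theorem cong_whitehead (P : Matrix (Fin 4) (Fin 4) A) {x₁₁ x₁₂ x₂₁ x₂₂ y₁₁ y₁₂ y₂₁ y₂₂ δ s : A}
    (hY : y₁₁ * y₂₂ - y₁₂ * y₂₁ = 1 - s) {M M₁ Q : Matrix (Fin 4) (Fin 4) A}
    (hM : M = !![x₁₁, x₁₂, 0, 0; -x₂₁, -x₂₂, 0, 0; 0, 0, y₁₁, y₁₂; 0, 0, -y₂₁, -y₂₂])
    (hQ : Q = !![0, δ, 0, 0; -δ, 0, 0, 0; 0, 0, 0, δ; 0, 0, -δ, 0])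
    (hM₁ : M₁ = !![s * x₁₁, s * x₁₂, (1 + s) * x₁₁ * y₁₁ + x₁₂ * y₂₁,
        (1 + s) * x₁₁ * y₁₂ + x₁₂ * y₂₂;
      -(s * x₂₁), -(s * x₂₂), -((1 + s) * x₂₁ * y₁₁ + x₂₂ * y₂₁),
        -((1 + s) * x₂₁ * y₁₂ + x₂₂ * y₂₂);
      -(1 - s), 0, s * y₁₁, s * y₁₂; 0, 1 - s * s, -(s * y₂₁), -(s * y₂₂)]) :
    Cong (Elem (4 + 4) A) (blk P M (-Mᵀ) Q) (blk P M₁ (-M₁ᵀ) Q) := by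
  have c1 := cong_blk_diag (P := P) (M := M) (Q := Q) (whitehead_mem hY)
  generalize hG : !![s, 0, (1 + s) * y₁₁, (1 + s) * y₁₂; 0, s, y₂₁, y₂₂;
      -y₂₂, (1 + s) * y₁₂, s, 0; y₂₁, -((1 + s) * y₁₁), 0, s] = G at c1
  have e1 : M * G = M₁ := by
    rw [hM, ← hG, hM₁]
    rw [mul_four]
    apply ext_four <;> first | ring1 | linear_combination -hY | linear_combination (1 + s) * hY
  have e2 : Gᵀ * Q * G = Q := by
    have hQG : Q * G = !![0, δ * s, δ * y₂₁, δ * y₂₂;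
        -(δ * s), 0, -(δ * ((1 + s) * y₁₁)), -(δ * ((1 + s) * y₁₂));
        δ * y₂₁, -(δ * ((1 + s) * y₁₁)), 0, δ * s; δ * y₂₂, -(δ * ((1 + s) * y₁₂)), -(δ * s), 0] := by
      rw [hQ, ← hG]
      rw [mul_four]
      apply ext_four <;> ring1
    have hGt : Gᵀ = !![s, 0, -y₂₂, y₂₁; 0, s, (1 + s) * y₁₂, -((1 + s) * y₁₁);
        (1 + s) * y₁₁, y₂₁, s, 0; (1 + s) * y₁₂, y₂₂, 0, s] := by
      rw [← hG]
      exact transpose_four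
    rw [Matrix.mul_assoc, hQG, hGt, hQ]
    rw [mul_four]
    apply ext_four <;>
      first
        | ring1
        | linear_combination (δ * (1 + s)) * hY
        | linear_combination -(δ * (1 + s)) * hY
  rwa [e1, e2] at c1

/-- Since P = d(J ⊥ J), adding P S to the off-diagonal block removes multiples of d, in particular
the terms with s = dδ. This empties two corners of `M₁` and makes its lower left corner invertible.
The determinant relations for X and Y clean up Q. -/
theorem cong_clear {x₁₁ x₁₂ x₂₁ x₂₂ y₁₁ y₁₂ y₂₁ y₂₂ z₁₁ z₁₂ z₂₁ z₂₂ d δ s : A} (hs : s = d * δ)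
    (hX : x₁₁ * x₂₂ - x₁₂ * x₂₁ = 1 - s) (hY : y₁₁ * y₂₂ - y₁₂ * y₂₁ = 1 - s)
    (h₁₁ : z₁₁ = (1 + s) * x₁₁ * y₁₁ + x₁₂ * y₂₁) (h₁₂ : z₁₂ = (1 + s) * x₁₁ * y₁₂ + x₁₂ * y₂₂)
    (h₂₁ : z₂₁ = (1 + s) * x₂₁ * y₁₁ + x₂₂ * y₂₁) (h₂₂ : z₂₂ = (1 + s) * x₂₁ * y₁₂ + x₂₂ * y₂₂)
    {P M₁ M₂ Q Q₂ : Matrix (Fin 4) (Fin 4) A}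
    (hP : P = !![0, d, 0, 0; -d, 0, 0, 0; 0, 0, 0, d; 0, 0, -d, 0])
    (hM₁ : M₁ = !![s * x₁₁, s * x₁₂, z₁₁, z₁₂; -(s * x₂₁), -(s * x₂₂), -z₂₁, -z₂₂;
      -(1 - s), 0, s * y₁₁, s * y₁₂; 0, 1 - s * s, -(s * y₂₁), -(s * y₂₂)])
    (hM₂ : M₂ = !![0, 0, z₁₁, z₁₂; 0, 0, -z₂₁, -z₂₂; -1, 0, 0, 0; 0, 1, 0, 0])
    (hQ : Q = !![0, δ, 0, 0; -δ, 0, 0, 0; 0, 0, 0, δ; 0, 0, -δ, 0])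
    (hQ₂ : Q₂ = !![0, 0, 0, 0; 0, 0, 0, 0;
      0, 0, 0, δ * (1 + s * (1 - s)); 0, 0, -(δ * (1 + s * (1 - s))), 0]) :
    Cong (Elem (4 + 4) A) (blk P M₁ (-M₁ᵀ) Q) (blk P M₂ (-M₂ᵀ) Q₂) := by
  obtain ⟨S, hS⟩ : ∃ S, S = !![-(δ * x₂₁), -(δ * x₂₂), 0, 0; -(δ * x₁₁), -(δ * x₁₂), 0, 0;
    0, -(δ * s), -(δ * y₂₁), -(δ * y₂₂); -δ, 0, -(δ * y₁₁), -(δ * y₁₂)] := ⟨_, rfl⟩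
  have hPt : Pᵀ = -P := by
    rw [hP, transpose_four, neg_four]
    simp only [neg_zero, neg_neg]
  have c2 := cong_blk_upper (M := M₁) (Q := Q) hPt S
  have e3 : M₁ + P * S = M₂ := by
    rw [hM₁, hP, hS, hM₂]
    rw [mul_four, add_four]
    subst hs
    apply ext_four <;> ring1
  have hSt : Sᵀ = !![-(δ * x₂₁), -(δ * x₁₁), 0, -δ; -(δ * x₂₂), -(δ * x₁₂), -(δ * s), 0;
      0, 0, -(δ * y₂₁), -(δ * y₁₁); 0, 0, -(δ * y₂₂), -(δ * y₁₂)] := by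
    rw [hS]
    exact transpose_four
  have hM₁t : M₁ᵀ = !![s * x₁₁, -(s * x₂₁), -(1 - s), 0; s * x₁₂, -(s * x₂₂), 0, 1 - s * s;
      z₁₁, -z₂₁, s * y₁₁, -(s * y₂₁); z₁₂, -z₂₂, s * y₁₂, -(s * y₂₂)] := by
    rw [hM₁]
    exact transpose_four
  have e4 : Q + Sᵀ * M₁ - M₁ᵀ * S + Sᵀ * P * S = Q₂ := by
    have : Q + Sᵀ * M₁ - M₁ᵀ * S + Sᵀ * P * S = Q + Sᵀ * M₂ - M₁ᵀ * S := by
      rw [← e3]; noncomm_ring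
    rw [this, hSt, hM₁t, hS, hM₂, hQ, hQ₂]
    subst h₁₁ h₁₂ h₂₁ h₂₂
    rw [mul_four, mul_four, add_four, sub_four]
    apply ext_four <;>
      first
        | ring1
        | linear_combination (δ * s) * hX
        | linear_combination -(δ * s) * hX
        | linear_combination (δ * y₂₁) * hX
        | linear_combination -(δ * y₂₁) * hX
        | linear_combination (δ * y₂₂) * hX
        | linear_combination -(δ * y₂₂) * hX
        | linear_combination (δ * (1 + s) * y₁₁) * hX
        | linear_combination -(δ * (1 + s) * y₁₁) * hX
        | linear_combination (δ * (1 + s) * y₁₂) * hX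
        | linear_combination -(δ * (1 + s) * y₁₂) * hX
        | linear_combination (δ * s) * hY
        | linear_combination -(δ * s) * hY
  rwa [e3, e4] at c2

/-- The unit entries of M allow the lower operation T to cancel the second d in P. It leaves M and Q
alone because `Tᵀ * Q = 0`. Two hyperbolic planes are then visible after an even permutation. -/
theorem stabEquiv_split {z₁₁ z₁₂ z₂₁ z₂₂ d q : A} {P M Q : Matrix (Fin 4) (Fin 4) A}
    (hP : P = !![0, d, 0, 0; -d, 0, 0, 0; 0, 0, 0, d; 0, 0, -d, 0])
    (hM : M = !![0, 0, z₁₁, z₁₂; 0, 0, -z₂₁, -z₂₂; -1, 0, 0, 0; 0, 1, 0, 0])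
    (hQ : Q = !![0, 0, 0, 0; 0, 0, 0, 0; 0, 0, 0, q; 0, 0, -q, 0]) :
    StabEquiv (blk P M (-Mᵀ) Q) (vmat ![z₁₁, z₁₂, d] ![z₂₂, -z₂₁, q]) := by
  have h8 : Even (4 + 4) := ⟨4, rfl⟩
  have hQt : Qᵀ = -Q := by
    rw [hQ, transpose_four, neg_four]
    simp only [neg_zero, neg_neg]
  obtain ⟨T, hT⟩ : ∃ T : Matrix (Fin 4) (Fin 4) A,
    T = !![0, 0, 0, d; 0, 0, 0, 0; 0, 0, 0, 0; 0, 0, 0, 0] := ⟨_, rfl⟩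
  have hTt : Tᵀ = !![0, 0, 0, 0; 0, 0, 0, 0; 0, 0, 0, 0; d, 0, 0, 0] := by
    rw [hT]
    exact transpose_four
  have hMt : Mᵀ = !![0, 0, -1, 0; 0, 0, 0, 1; z₁₁, -z₂₁, 0, 0; z₁₂, -z₂₂, 0, 0] := by
    rw [hM]
    exact transpose_four
  have c := cong_blk_lower (M := M) (P := P) hQt T
  have e6 : Tᵀ * Q = 0 := by
    rw [hTt, hQ, mul_four]
    simp only [mul_zero, zero_mul, add_zero]
    ext i j
    fin_cases i <;> fin_cases j <;> rfl
  have e5 : P + M * T - Tᵀ * Mᵀ =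
      !![0, d, 0, 0; -d, 0, 0, 0; 0, 0, 0, 0; 0, 0, 0, 0] := by
    rw [hMt, hTt, hP, hT, hM, mul_four, mul_four, add_four, sub_four]
    apply ext_four <;> ring1
  rw [e6, Matrix.zero_mul, add_zero, add_zero, e5] at c
  refine (c.stabEquiv h8).trans ?_
  let σ : Equiv.Perm (Fin 8) := ⟨![0, 6, 7, 1, 4, 2, 3, 5], ![0, 3, 5, 6, 4, 7, 1, 2],
    by decide, by decide⟩
  refine (stabEquiv_permute h8 _ σ (by decide)).trans ?_
  refine StabEquiv.trans ?_ (stabEquiv_stab (N := 8) (by omega) ⟨4, rfl⟩ _)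
  convert StabEquiv.refl h8 _ using 1
  rw [hMt, hM, hQ, neg_four]
  simp only [neg_zero, neg_neg]
  ext i j
  fin_cases i <;> fin_cases j <;>
    first | rfl | exact neg_neg _

theorem zero_four : (0 : Matrix (Fin 4) (Fin 4) A) =
    !![0, 0, 0, 0; 0, 0, 0, 0; 0, 0, 0, 0; 0, 0, 0, 0] := by
  ext i j
  fin_cases i <;> fin_cases j <;> rfl

theorem vmat_eq (a₀ a₁ a₂ b₀ b₁ b₂ : A) : vmat ![a₀, a₁, a₂] ![b₀, b₁, b₂] =
    !![0, a₀, a₁, a₂; -a₀, 0, b₂, -b₁; -a₁, -b₂, 0, b₀; -a₂, b₁, -b₀, 0] := rfl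

/-- The order puts the outer indices of both summands first and the inner ones last; the entries d
then fill the first diagonal block, the entries δ the second. -/
theorem stabEquiv_perp_blk (x₁₁ x₁₂ x₂₁ x₂₂ y₁₁ y₁₂ y₂₁ y₂₂ d δ : A)
    {P M Q : Matrix (Fin 4) (Fin 4) A}
    (hP : P = !![0, d, 0, 0; -d, 0, 0, 0; 0, 0, 0, d; 0, 0, -d, 0])
    (hM : M = !![x₁₁, x₁₂, 0, 0; -x₂₁, -x₂₂, 0, 0; 0, 0, y₁₁, y₁₂; 0, 0, -y₂₁, -y₂₂])
    (hQ : Q = !![0, δ, 0, 0; -δ, 0, 0, 0; 0, 0, 0, δ; 0, 0, -δ, 0]) :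
    StabEquiv (perp (vmat ![x₁₁, x₁₂, d] ![x₂₂, -x₂₁, δ]) (vmat ![y₁₁, y₁₂, d] ![y₂₂, -y₂₁, δ]))
      (blk P M (-Mᵀ) Q) := by
  have h8 : Even (4 + 4) := ⟨4, rfl⟩
  -- A square root of the reordering, which shows that it is even.
  let τ : Equiv.Perm (Fin 8) := ⟨![0, 5, 7, 2, 6, 3, 1, 4], ![0, 6, 3, 5, 7, 1, 4, 2],
    by decide, by decide⟩
  obtain ⟨σ, hσ⟩ : ∃ σ : Equiv.Perm (Fin 8), σ = ⟨![0, 3, 4, 7, 1, 2, 5, 6],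
    ![0, 4, 5, 1, 2, 6, 7, 3], by decide, by decide⟩ := ⟨_, rfl⟩
  refine (stabEquiv_permute h8 _ σ (by
    rw [show σ = τ * τ by rw [hσ]; decide, Equiv.Perm.sign_mul]
    exact Int.units_mul_self _)).trans ?_
  obtain ⟨L, hL⟩ : ∃ L : Matrix (Fin 8) (Fin 8) A, L = !![0, d, 0, 0, x₁₁, x₁₂, 0, 0;
      -d, 0, 0, 0, -x₂₁, -x₂₂, 0, 0; 0, 0, 0, d, 0, 0, y₁₁, y₁₂; 0, 0, -d, 0, 0, 0, -y₂₁, -y₂₂;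
      -x₁₁, x₂₁, 0, 0, 0, δ, 0, 0; -x₁₂, x₂₂, 0, 0, -δ, 0, 0, 0;
      0, 0, -y₁₁, y₂₁, 0, 0, 0, δ; 0, 0, -y₁₂, y₂₂, 0, 0, -δ, 0] := ⟨_, rfl⟩
  have e1 : blk P M (-Mᵀ) Q = L := by
    rw [hP, hM, hQ, transpose_four, neg_four, hL]
    simp only [neg_zero, neg_neg]
    ext i j
    fin_cases i <;> fin_cases j <;> rfl
  have e2 : (perp (vmat ![x₁₁, x₁₂, d] ![x₂₂, -x₂₁, δ])
      (vmat ![y₁₁, y₁₂, d] ![y₂₂, -y₂₁, δ])).submatrix σ σ = L := by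
    rw [hσ, perp, zero_four, vmat_eq, vmat_eq, hL]
    simp only [neg_neg]
    ext i j
    fin_cases i <;> fin_cases j <;> rfl
  rw [e1]
  exact e2 ▸ StabEquiv.refl h8 L

/-- The first two entries of the resulting row are the first row of X diag(1 + s, 1) Y, where X and
Y are the 2 × 2 matrices (x_{ij}), (y_{ij}) of determinant 1 - s. -/
theorem stabEquiv_vmat_perp {x₁₁ x₁₂ x₂₁ x₂₂ y₁₁ y₁₂ y₂₁ y₂₂ d δ s : A} (hs : s = d * δ)
    (hX : x₁₁ * x₂₂ - x₁₂ * x₂₁ = 1 - s) (hY : y₁₁ * y₂₂ - y₁₂ * y₂₁ = 1 - s) :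
    StabEquiv (perp (vmat ![x₁₁, x₁₂, d] ![x₂₂, -x₂₁, δ]) (vmat ![y₁₁, y₁₂, d] ![y₂₂, -y₂₁, δ]))
      (vmat ![(1 + s) * x₁₁ * y₁₁ + x₁₂ * y₂₁, (1 + s) * x₁₁ * y₁₂ + x₁₂ * y₂₂, d]
        ![(1 + s) * x₂₁ * y₁₂ + x₂₂ * y₂₂, -((1 + s) * x₂₁ * y₁₁ + x₂₂ * y₂₁),
          δ * (1 + s * (1 - s))]) := by
  have h8 : Even (4 + 4) := ⟨4, rfl⟩
  have h1 := stabEquiv_perp_blk x₁₁ x₁₂ x₂₁ x₂₂ y₁₁ y₁₂ y₂₁ y₂₂ d δ rfl rfl rfl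
  have h2 := (cong_whitehead !![0, d, 0, 0; -d, 0, 0, 0; 0, 0, 0, d; 0, 0, -d, 0] hY (x₁₁ := x₁₁)
    (x₁₂ := x₁₂) (x₂₁ := x₂₁) (x₂₂ := x₂₂) (δ := δ) rfl rfl rfl).stabEquiv h8
  have h3 := (cong_clear hs hX hY rfl rfl rfl rfl rfl rfl rfl rfl rfl).stabEquiv h8
  exact (h1.trans h2).trans (h3.trans (stabEquiv_split rfl rfl rfl))

end Product

/-! ### The Vaserstein–van der Kallen rule and inverses in W_E. -/

section WittGroup

variable {A : Type u} [CommRing A]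

theorem dot_three (a₀ a₁ a₂ b₀ b₁ b₂ : A) :
    ![a₀, a₁, a₂] ⬝ᵥ ![b₀, b₁, b₂] = a₀ * b₀ + a₁ * b₁ + a₂ * b₂ := by
  simp [dotProduct, Fin.sum_univ_three]

/-- Two rows with the same last entry `d` and otherwise congruent modulo `d`. -/
theorem orb_of_congr_last (a₀ a₁ d x y : A) :
    Orb (Elem 3 A) ![a₀, a₁, d] ![a₀ + x * d, a₁ + y * d, d] := by
  have h0 : (2 : Fin 3) ≠ 0 := by decide
  have h1 : (2 : Fin 3) ≠ 1 := by decide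
  have o1 := Orb.add (K := Elem 3 A) h0 (transvection_mem h0 x) ![a₀, a₁, d]
  have o2 := Orb.add (K := Elem 3 A) h1 (transvection_mem h1 y)
    (![a₀, a₁, d] + (x * ![a₀, a₁, d] 2) • e 0)
  convert o1.trans o2 using 1
  ext i
  simp only [Pi.add_apply, Pi.smul_apply]
  fin_cases i <;> simp [e]

theorem WE.mk_mul (φ ψ : AltForm A) : WE.mk φ * WE.mk ψ = WE.mk (φ.perp ψ) := rfl

/-- The Vaserstein-van der Kallen rule in the Witt group. -/
theorem mk_vaserstein_mul {a b c d p c' d' : A} (hap : a * p + c * c' + d * d' = 1)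
    {bw bv : Fin 3 → A} (hw : ![b, c, d] ⬝ᵥ bw = 1) (hv : ![a, c, d] ⬝ᵥ bv = 1) :
    ∃ (u : Fin 3 → A) (hu : ![a * (b + p) - 1, c * (b + p), d] ⬝ᵥ u = 1),
      WE.mk (vaserstein _ bw hw) * WE.mk (vaserstein _ bv hv) = WE.mk (vaserstein _ u hu) := by
  have hbw : b * bw 0 + c * bw 1 + d * bw 2 = 1 := by
    simpa [dotProduct, Fin.sum_univ_three] using hw
  set b' := bw 0
  set c'' := bw 1
  set d'' := bw 2
  -- Chosen so that 1 - dδ = (1 - dd')(1 - dd''): scaling the other dual entries of one row by 1 -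
  -- dd' and of the other by 1 - dd'' gives both rows the last dual entry δ.
  obtain ⟨δ, hδ⟩ : ∃ δ, δ = d' + d'' - d * d' * d'' := ⟨_, rfl⟩
  obtain ⟨s, hs⟩ : ∃ s, s = d * δ := ⟨_, rfl⟩
  have hX : b * (b' * (1 - d * d')) - c * (-(c'' * (1 - d * d'))) = 1 - s := by
    rw [hs, hδ]
    linear_combination (1 - d * d') * hbw
  have hY : a * (p * (1 - d * d'')) - c * (-(c' * (1 - d * d''))) = 1 - s := by
    rw [hs, hδ]
    linear_combination (1 - d * d'') * hap
  have key := stabEquiv_vmat_perp hs hX hY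
  set z₁₁ := (1 + s) * b * a + c * (-(c' * (1 - d * d''))) with hz₁₁
  set z₁₂ := (1 + s) * b * c + c * (p * (1 - d * d'')) with hz₁₂
  have ho : Orb (Elem 3 A) ![z₁₁, z₁₂, d] ![a * (b + p) - 1, c * (b + p), d] := by
    -- Modulo d one has s ≡ 0 and a p - 1 ≡ -c c', so the row obtained agrees with that of the rule.
    convert orb_of_congr_last z₁₁ z₁₂ d (-(δ * b * a) - c * c' * d'' - d')
      (-(δ * b * c) + c * p * d'') using 2
    · rw [hz₁₁, hs]
      linear_combination hap
    · rw [hz₁₂, hs]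
      congr 1
      ring
  have hz : ![z₁₁, z₁₂, d] ⬝ᵥ ![(1 + s) * (-(c'' * (1 - d * d'))) * c +
      b' * (1 - d * d') * (p * (1 - d * d'')), -((1 + s) * (-(c'' * (1 - d * d'))) * a +
      b' * (1 - d * d') * (-(c' * (1 - d * d'')))), δ * (1 + s * (1 - s))] = 1 := by
    rw [dot_three, hz₁₁, hz₁₂]
    generalize b' * (1 - d * d') = x₂₂ at *
    generalize -(c'' * (1 - d * d')) = x₂₁ at *
    generalize p * (1 - d * d'') = y₂₂ at *
    generalize -(c' * (1 - d * d'')) = y₂₁ at *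
    linear_combination ((1 + s) * (a * y₂₂ - c * y₂₁)) * hX + ((1 + s) * (1 - s)) * hY -
      (1 + s * (1 - s)) * hs
  obtain ⟨u, hu⟩ := ho.isUnimodular ⟨_, hz⟩
  refine ⟨u, hu, ?_⟩
  have hw' : ![b, c, d] ⬝ᵥ ![b' * (1 - d * d'), -(-(c'' * (1 - d * d'))), δ] = 1 := by
    rw [dot_three]
    linear_combination hX - hs
  have hv' : ![a, c, d] ⬝ᵥ ![p * (1 - d * d''), -(-(c' * (1 - d * d''))), δ] = 1 := by
    rw [dot_three]
    linear_combination hY - hs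
  rw [mk_vaserstein_eq hw hw' (Orb.refl _), mk_vaserstein_eq hv hv' (Orb.refl _),
    ← mk_vaserstein_eq hz hu ho, WE.mk_mul]
  exact WE.mk_eq.2 key

/-- The form of size zero. -/
def AltForm.empty (A : Type u) [CommRing A] : AltForm A where
  size := 0
  even := ⟨0, rfl⟩
  mat := 0
  skew := by ext i; exact i.elim0
  diag i := i.elim0
  pf_eq := rfl

theorem mk_vaserstein_e {b : Fin 3 → A} (h : (e 0 : Fin 3 → A) ⬝ᵥ b = 1) :
    WE.mk (vaserstein (e 0) b h) = WE.mk (AltForm.empty A) := by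
  have h0 : (e 0 : Fin 3 → A) ⬝ᵥ e 0 = 1 := by rw [e_dot, e_self]
  rw [mk_vaserstein_eq h h0 (Orb.refl _), WE.mk_eq]
  have h1 := stabEquiv_stab (N := 4) (by omega) ⟨2, rfl⟩ (0 : Matrix (Fin 0) (Fin 0) A)
  have h2 : stab (0 : Matrix (Fin 0) (Fin 0) A) 4 = vmat (e 0) (e 0) := by
    ext i j
    fin_cases i <;> fin_cases j <;> simp [vmat, e, stab, stdEntry]
  rw [h2] at h1
  exact h1

theorem orb_neg_one (d : A) : Orb (Elem 3 A) ![-1, 0, d] (e 0) := by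
  have h01 : (0 : Fin 3) ≠ 1 := by decide
  have h10 : (1 : Fin 3) ≠ 0 := by decide
  have h02 : (0 : Fin 3) ≠ 2 := by decide
  have o1 : Orb (Elem 3 A) ![-1, 0, d] ![-1, 0, 0] := by
    convert Orb.add (K := Elem 3 A) h02 (transvection_mem h02 d) ![-1, 0, d] using 1
    ext i
    fin_cases i <;> simp [e]
  have o2 : Orb (Elem 3 A) ![-1, 0, 0] ![-1, 1, 0] := by
    convert Orb.add (K := Elem 3 A) h01 (transvection_mem h01 (-1)) ![-1, 0, 0] using 1
    ext i
    fin_cases i <;> simp [e]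
  have o3 : Orb (Elem 3 A) ![-1, 1, 0] ![1, 1, 0] := by
    convert Orb.add (K := Elem 3 A) h10 (transvection_mem h10 2) ![-1, 1, 0] using 1
    ext i
    fin_cases i <;> simp [e]
    norm_num
  have o4 : Orb (Elem 3 A) ![1, 1, 0] (e 0) := by
    convert Orb.add (K := Elem 3 A) h01 (transvection_mem h01 (-1)) ![1, 1, 0] using 1
    ext i
    fin_cases i <;> simp [e]
  exact o1.trans (o2.trans (o3.trans o4))

theorem WE.mul_comm' (x y : WE A) : x * y = y * x := by
  induction x using Quotient.inductionOn with | _ φ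
  induction y using Quotient.inductionOn with | _ ψ
  exact WE.mk_eq.2 (perp_comm φ.even ψ.even φ.mat ψ.mat)

theorem WE.mul_assoc' (x y z : WE A) : x * y * z = x * (y * z) := by
  induction x using Quotient.inductionOn with | _ φ
  induction y using Quotient.inductionOn with | _ ψ
  induction z using Quotient.inductionOn with | _ χ
  refine WE.mk_eq.2 ?_
  change StabEquiv (perp (perp φ.mat ψ.mat) χ.mat) (perp φ.mat (perp ψ.mat χ.mat))
  have : perp (perp φ.mat ψ.mat) χ.mat = (perp φ.mat (perp ψ.mat χ.mat)).submatrix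
      (Fin.cast (Nat.add_assoc _ _ _)) (Fin.cast (Nat.add_assoc _ _ _)) := by
    ext i j
    simp only [submatrix_apply, perp_apply, Fin.val_cast]
    split_ifs <;> try first | omega | rfl
    congr 2 <;> omega
  rw [this]
  exact stabEquiv_cast _ (φ.even.add (ψ.even.add χ.even)) _

theorem WE.one_mul' (x : WE A) : WE.mk (AltForm.empty A) * x = x := by
  induction x using Quotient.inductionOn with | _ φ
  refine WE.mk_eq.2 ?_
  change StabEquiv (perp (0 : Matrix (Fin 0) (Fin 0) A) φ.mat) φ.mat
  have : perp (0 : Matrix (Fin 0) (Fin 0) A) φ.mat = φ.mat.submatrix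
      (Fin.cast (Nat.zero_add _)) (Fin.cast (Nat.zero_add _)) := by
    ext i j
    rw [perp_ge _ _ _ _ (Nat.zero_le _) (Nat.zero_le _)]
    rfl
  rw [this]
  exact stabEquiv_cast _ φ.even _

/-- In the rule with p = b₀ and -b₀ as first entry of the second row, the sum of these two vanishes;
the product row (-1, 0, a₂) is in the orbit of e₁. -/
theorem WE.exists_inv {a b : Fin 3 → A} (h : a ⬝ᵥ b = 1) :
    ∃ y, y * WE.mk (vaserstein a b h) = WE.mk (AltForm.empty A) := by
  obtain ⟨a₀, a₁, a₂, rfl⟩ : ∃ a₀ a₁ a₂, a = ![a₀, a₁, a₂] :=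
    ⟨a 0, a 1, a 2, by ext i; fin_cases i <;> rfl⟩
  have h' : a₀ * b 0 + a₁ * b 1 + a₂ * b 2 = 1 := by
    simpa [dotProduct, Fin.sum_univ_three] using h
  have hw : ![-b 0, a₁, a₂] ⬝ᵥ ![-a₀, b 1, b 2] = 1 := by
    rw [dot_three]
    linear_combination h'
  obtain ⟨u, hu, e'⟩ := mk_vaserstein_mul h' hw h
  refine ⟨_, e'.trans ?_⟩
  have h0 : (e 0 : Fin 3 → A) ⬝ᵥ e 0 = 1 := by rw [e_dot, e_self]
  rw [mk_vaserstein_eq hu h0, mk_vaserstein_e]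
  convert orb_neg_one a₂ using 1
  simp

/-- The group structure on the Witt group, when all its elements are Vaserstein symbols. -/
@[reducible]
noncomputable def weCommGroup (hs : ∀ x : WE A, ∃ (a b : Fin 3 → A) (h : a ⬝ᵥ b = 1),
    x = WE.mk (vaserstein a b h)) : CommGroup (WE A) :=
  have hinv : ∀ x : WE A, ∃ y, y * x = WE.mk (AltForm.empty A) := fun x => by
    obtain ⟨a, b, h, rfl⟩ := hs x
    exact WE.exists_inv h
  { mul := (· * ·)
    mul_assoc := WE.mul_assoc'
    one := WE.mk (AltForm.empty A)
    one_mul := WE.one_mul'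
    mul_one := fun x => (WE.mul_comm' _ _).trans (WE.one_mul' x)
    inv := fun x => (hinv x).choose
    inv_mul_cancel := fun x => (hinv x).choose_spec
    mul_comm := WE.mul_comm' }

end WittGroup

/-! ### E₄(R, I) acting on symbol matrices. -/

section RelativeSymbol

variable {R : Type u} [CommRing R] {I : Ideal R}

theorem good_relElem_z {n : ℕ} (o j : Fin n) (hj : j ≠ o) (a : R) :
    Good (mats (RelElem n I)) I (e j + a • e o) (e o - a • e j) := fun x hx => by
  obtain ⟨g, hg, h⟩ := zGen_good_z o I j hj a x hx
  exact ⟨g, (Subgroup.closure_le _).2 (zGen_subset o) hg, h⟩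

/-- `g` moves the row of a symbol matrix within its relative orbit. -/
def RowStable (I : Ideal R) (g : Matrix (Fin 4) (Fin 4) R) : Prop :=
  ∀ v b : Fin 3 → R, v ⬝ᵥ b = 1 → ∃ v' b' : Fin 3 → R, gᵀ * vmat v b * g = vmat v' b' ∧
    v' ⬝ᵥ b' = 1 ∧ Orb (RelElem 3 I) v v'

theorem RowStable.mul {g h : Matrix (Fin 4) (Fin 4) R} (hg : RowStable I g) (hh : RowStable I h) :
    RowStable I (g * h) := by
  intro v b hvb
  obtain ⟨v', b', h1, h2, h3⟩ := hg v b hvb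
  obtain ⟨v'', b'', h4, h5, h6⟩ := hh v' b' h2
  refine ⟨v'', b'', ?_, h5, h3.trans h6⟩
  rw [← h4, ← h1, transpose_mul]
  simp only [Matrix.mul_assoc]

theorem rowStable_zero_row (q : Fin 3 → R) :
    RowStable I (1 + vecMulVec (e 0) ![0, q 0, q 1, q 2]) := by
  intro v b hvb
  refine ⟨v, _, vmat_row_zero v b q, ?_, Orb.refl v⟩
  rw [dotProduct_add, hvb]
  simp only [dotProduct, Fin.sum_univ_three]
  simp
  ring

/-- As v · b = 1, the row v + x q is the image of v under 1 + x b q. The coordinate of b at `l`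
contributes row operations; the rest of b is orthogonal to q, and both vanish at `l`, so
`Good.of_row_index` applies. -/
theorem orb_cross {v b : Fin 3 → R} (hvb : v ⬝ᵥ b = 1) {q : Fin 3 → R} (l : Fin 3) (hl : q l = 0)
    (hq : q ⬝ᵥ b = 0) {x : R} (hx : x ∈ I) : Orb (RelElem 3 I) v (v + x • q) := by
  have he := good_relElem (I := I) (n := 3)
  have h1 : Good (mats (RelElem 3 I)) I (b l • e l) q :=
    (Good.row l (fun j hj => he l j hj.symm) hl).smul_left _
  have hd : q ⬝ᵥ (b - b l • e l) = 0 := by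
    rw [dotProduct_sub, hq, dotProduct_smul, dot_e, hl, smul_zero, sub_zero]
  have h2 : Good (mats (RelElem 3 I)) I (b - b l • e l) q :=
    Good.of_row_index l he (fun i hi a => good_relElem_z l i hi a) (by simp [e_self]) hl hd
  have h3 := h1.add_left h2 hd
  rw [add_sub_cancel] at h3
  have h4 := h3 x hx
  rw [← vecMulVec_smul] at h4
  have h5 := Orb.add_vmv h4 v
  rwa [hvb, one_smul] at h5

/-- The operation adds to the top row x times a row of the cross product block. Such a row is
orthogonal to b and has a zero diagonal entry, which is the situation of `orb_cross`. Invariance of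
the Pfaffian keeps the new pair dual. -/
theorem rowStable_zero_col (i : Fin 3) {x : R} (hx : x ∈ I) :
    RowStable I (1 + x • vecMulVec (e i.succ) (e 0)) := by
  intro v b hvb
  rw [← smul_vecMulVec]
  set M' := (1 + vecMulVec (x • e i.succ) (e 0))ᵀ * vmat v b *
    (1 + vecMulVec (x • e i.succ) (e 0)) with hM'
  have hA : IsAlt M' := (vmat_isAlt v b).conj _
  have hvb' : v 0 * b 0 + v 1 * b 1 + v 2 * b 2 = 1 := by
    simpa [dotProduct, Fin.sum_univ_three] using hvb
  refine ⟨_, _, hA.eq_vmat, ?_, ?_⟩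
  · rw [← pf_vmat, ← hA.eq_vmat, ← hvb, ← pf_vmat]
    refine Cong.pf_eq ⟨_, ?_, rfl⟩ (vmat_isAlt v b)
    exact col_mem_elem 0 (by simp [e])
  · have h0 : ∀ l : Fin 3, M' 0 l.succ = v l + x * vmat v b i.succ l.succ := by
      intro l
      rw [hM', (vmat_isAlt v b).conj_vmv, Matrix.sub_apply, Matrix.add_apply, vecMulVec_apply,
        vecMulVec_apply, mulVec_smul, Pi.smul_apply, Pi.smul_apply, mulVec, mulVec, dot_e, dot_e,
        e_self, e_ne (Fin.succ_ne_zero l).symm, (vmat_isAlt v b).swap l.succ]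
      have : vmat v b 0 l.succ = v l := by fin_cases l <;> rfl
      rw [this]
      simp
    have := orb_cross hvb (q := fun l => vmat v b i.succ l.succ) i
      ((vmat_isAlt v b).2 _) (by
        fin_cases i <;> simp [vmat, dotProduct, Fin.sum_univ_three] <;> ring) hx
    convert this using 1
    ext l
    have := h0 l
    fin_cases l <;> exact this

theorem rowStable_of_mem {g : SpecialLinearGroup (Fin 4) R} (hg : g ∈ RelElem 4 I) :
    RowStable I g.1 := by
  -- Here a is arbitrary in R: these operations change the dual only. This lets the conjugating
  -- factors of the generators through.
  have hrow : ∀ (j : Fin 3) (a : R), RowStable I (1 + a • vecMulVec (e 0) (e j.succ)) := by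
    intro j a
    have := rowStable_zero_row (I := I) (a • e j)
    rw [← vecMulVec_smul]
    convert this using 3
    ext l
    fin_cases l <;> fin_cases j <;> simp [e]
  have hgen : ∀ g ∈ zGen 0 I, RowStable I g.1 := by
    rintro g ⟨x, hx, ⟨i, j, hij, hg⟩ | ⟨j, a, hj, hg⟩⟩
    · rw [hg]
      rcases Fin.eq_zero_or_eq_succ i with rfl | ⟨i, rfl⟩
      · rcases Fin.eq_zero_or_eq_succ j with rfl | ⟨j, rfl⟩
        · exact absurd rfl hij
        · exact hrow j x
      · rcases Fin.eq_zero_or_eq_succ j with rfl | ⟨j, rfl⟩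
        · exact rowStable_zero_col i hx
        · have hij' : i ≠ j := fun h => hij (by rw [h])
          intro v b hvb
          refine ⟨v ᵥ* (1 + single i j x), (1 + single i j (-x)) *ᵥ b, ?_, ?_, ?_⟩
          · rw [vecMulVec_e_e]
            exact vmat_transvection hij' x v b
          · rw [dotProduct_mulVec, vecMul_vecMul]
            have : (1 + single i j x) * (1 + single i j (-x)) = (1 : Matrix (Fin 3) (Fin 3) R) := by
              have := coe_mul_inv (SpecialLinearGroup.transvection hij' x)
              rwa [SpecialLinearGroup.transvection_inv] at this
            rw [this, vecMul_one, hvb]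
          · exact ⟨_, ⟨_, transvection_mem_relElem hij' hx, rfl⟩, rfl⟩
    · obtain ⟨j, rfl⟩ := Fin.exists_succ_eq_of_ne_zero hj
      have h1 := conj_transvection hj.symm a x (e j.succ) (e 0)
      rw [e_self, e_self, mul_one] at h1
      rw [hg, ← h1, transvection_val, transvection_inv_val]
      exact ((hrow j a).mul (rowStable_zero_col j hx)).mul (hrow j (-a))
  have hinv : ∀ g : SpecialLinearGroup (Fin 4) R, g ∈ zGen 0 I → g⁻¹ ∈ zGen 0 I := by
    have key : ∀ (g : SpecialLinearGroup (Fin 4) R) (p q : Fin 4 → R) (x : R), q ⬝ᵥ p = 0 →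
        g.1 = 1 + x • vecMulVec p q → (g⁻¹).1 = 1 + (-x) • vecMulVec p q := by
      intro g p q x h hg
      have h1 : (1 + (-x) • vecMulVec p q) * g.1 = 1 := by
        rw [hg, one_add_mul_coeff p q _ _ h, neg_add_cancel, zero_smul, add_zero]
      calc (g⁻¹).1 = (1 + (-x) • vecMulVec p q) * g.1 * (g⁻¹).1 := by rw [h1, one_mul]
        _ = _ := by rw [Matrix.mul_assoc, coe_mul_inv, mul_one]
    rintro g ⟨x, hx, ⟨i, j, hij, hg⟩ | ⟨j, a, hj, hg⟩⟩
    · exact ⟨-x, I.neg_mem hx, Or.inl ⟨i, j, hij, key g _ _ x (by rw [dot_e, e_ne hij.symm]) hg⟩⟩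
    · refine ⟨-x, I.neg_mem hx, Or.inr ⟨j, a, hj, key g _ _ x ?_ hg⟩⟩
      simp [sub_dotProduct, dotProduct_add, e_dot, e_ne hj, e_ne hj.symm, e_self]
  replace hg := relElem_le_zGen 0 I (by norm_num) hg
  induction hg using
      Subgroup.closure_induction_left with
  | one => exact fun v b h => ⟨v, b, by simp, h, Orb.refl v⟩
  | mul_left x hx y _ ih => exact (hgen x hx).mul ih
  | inv_mul_cancel x hx y _ ih => exact (hgen _ (hinv x hx)).mul ih

end RelativeSymbol

/-! ### Relative symplectic and Eichler transvections. -/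

section Isometry

variable {R : Type u} [CommRing R] {N : ℕ} {Ψ : Matrix (Fin N) (Fin N) R}

/-- `g` is an isometry of the bilinear form with matrix `Ψ`. -/
def IsIsom (Ψ g : Matrix (Fin N) (Fin N) R) : Prop := gᵀ * Ψ * g = Ψ

theorem IsIsom.mul {g h : Matrix (Fin N) (Fin N) R} (hg : IsIsom Ψ g) (hh : IsIsom Ψ h) :
    IsIsom Ψ (g * h) := by
  unfold IsIsom at *
  calc _ = hᵀ * (gᵀ * Ψ * g) * h := by rw [transpose_mul]; simp only [Matrix.mul_assoc]
    _ = Ψ := by rw [hg, hh]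

theorem IsIsom.of_mul_eq_one {g h : Matrix (Fin N) (Fin N) R} (hg : IsIsom Ψ g) (hh : g * h = 1) :
    IsIsom Ψ h := by
  unfold IsIsom at *
  calc _ = hᵀ * (gᵀ * Ψ * g) * h := by rw [hg]
    _ = (g * h)ᵀ * Ψ * (g * h) := by rw [transpose_mul]; simp only [Matrix.mul_assoc]
    _ = Ψ := by rw [hh]; simp

theorem isIsom_iff {g : Matrix (Fin N) (Fin N) R} :
    IsIsom Ψ g ↔ ∀ x y : Fin N → R, (g *ᵥ x) ⬝ᵥ Ψ *ᵥ (g *ᵥ y) = x ⬝ᵥ Ψ *ᵥ y := by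
  have key : ∀ x y : Fin N → R, (g *ᵥ x) ⬝ᵥ Ψ *ᵥ (g *ᵥ y) = x ⬝ᵥ (gᵀ * Ψ * g) *ᵥ y := by
    intro x y
    rw [← vecMul_transpose, ← dotProduct_mulVec, mulVec_mulVec, mulVec_mulVec]
  constructor
  · intro h x y
    rw [key, h]
  · intro h
    refine ext_of_mulVec_single fun j => ?_
    ext i
    have := h (e i) (e j)
    rw [key, e_dot, e_dot] at this
    exact this

theorem IsAlt.dot_swap (hΨ : IsAlt Ψ) (x y : Fin N → R) : x ⬝ᵥ Ψ *ᵥ y = -(y ⬝ᵥ Ψ *ᵥ x) := by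
  rw [dotProduct_mulVec, ← mulVec_transpose, hΨ.1, neg_mulVec, neg_dotProduct, dotProduct_comm]

/-- The Eichler transformation `x ↦ x + ⟨z, x⟩ p + ⟨p, x⟩ z`. -/
def eichler (Ψ : Matrix (Fin N) (Fin N) R) (p z : Fin N → R) : Matrix (Fin N) (Fin N) R :=
  1 + vecMulVec p (z ᵥ* Ψ) + vecMulVec z (p ᵥ* Ψ)

/-- The symplectic transvection `x ↦ x + c ⟨p, x⟩ p`. -/
def symp (Ψ : Matrix (Fin N) (Fin N) R) (p : Fin N → R) (c : R) : Matrix (Fin N) (Fin N) R :=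
  1 + c • vecMulVec p (p ᵥ* Ψ)

theorem eichler_mulVec (p z x : Fin N → R) :
    eichler Ψ p z *ᵥ x = x + (z ⬝ᵥ Ψ *ᵥ x) • p + (p ⬝ᵥ Ψ *ᵥ x) • z := by
  rw [eichler, add_mulVec, add_mulVec, one_mulVec, vecMulVec_mulVec, vecMulVec_mulVec,
    ← dotProduct_mulVec, ← dotProduct_mulVec, op_smul_eq_smul, op_smul_eq_smul]

theorem symp_mulVec (p x : Fin N → R) (c : R) :
    symp Ψ p c *ᵥ x = x + (c * (p ⬝ᵥ Ψ *ᵥ x)) • p := by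
  rw [symp, add_mulVec, one_mulVec, smul_mulVec, vecMulVec_mulVec, ← dotProduct_mulVec,
    op_smul_eq_smul, smul_smul]

theorem isIsom_symp (hΨ : IsAlt Ψ) (p : Fin N → R) (c : R) : IsIsom Ψ (symp Ψ p c) := by
  rw [isIsom_iff]
  intro x y
  rw [symp_mulVec, symp_mulVec]
  simp only [mulVec_add, mulVec_smul, dotProduct_add, add_dotProduct, dotProduct_smul,
    smul_dotProduct, hΨ.dot_self, smul_eq_mul]
  rw [hΨ.dot_swap x p]
  ring

theorem isIsom_eichler (hΨ : IsAlt Ψ) {p z : Fin N → R} (h : p ⬝ᵥ Ψ *ᵥ z = 0) :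
    IsIsom Ψ (eichler Ψ p z) := by
  rw [isIsom_iff]
  intro x y
  rw [eichler_mulVec, eichler_mulVec]
  have h' : z ⬝ᵥ Ψ *ᵥ p = 0 := by rw [hΨ.dot_swap, h, neg_zero]
  simp only [mulVec_add, mulVec_smul, dotProduct_add, add_dotProduct, dotProduct_smul,
    smul_dotProduct, hΨ.dot_self, smul_eq_mul, h, h']
  rw [hΨ.dot_swap x p, hΨ.dot_swap x z]
  ring

/-- `i`, `k` are the indices of a hyperbolic pair of basis vectors that is split off by `Ψ`. -/
structure IsHyp (Ψ : Matrix (Fin N) (Fin N) R) (i k : Fin N) : Prop where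
  ne : i ≠ k
  left : e i ᵥ* Ψ = e k
  right : e k ᵥ* Ψ = -e i

variable {i k : Fin N} {I : Ideal R}

theorem IsHyp.swap (h : IsHyp Ψ i k) (hΨ : IsAlt Ψ) : Ψ *ᵥ e i = -e k ∧ Ψ *ᵥ e k = e i := by
  have : ∀ x : Fin N → R, Ψ *ᵥ x = -(x ᵥ* Ψ) := fun x => by
    rw [← mulVec_transpose, hΨ.1, neg_mulVec, neg_neg]
  rw [this, this, h.left, h.right, neg_neg]
  exact ⟨rfl, rfl⟩

theorem IsHyp.dot_left (h : IsHyp Ψ i k) (x : Fin N → R) : e i ⬝ᵥ Ψ *ᵥ x = x k := by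
  rw [dotProduct_mulVec, h.left, e_dot]

theorem IsHyp.dot_right (h : IsHyp Ψ i k) (x : Fin N → R) : e k ⬝ᵥ Ψ *ᵥ x = -x i := by
  rw [dotProduct_mulVec, h.right, neg_dotProduct, e_dot]

theorem IsHyp.vecMul_apply (h : IsHyp Ψ i k) (hΨ : IsAlt Ψ) (z : Fin N → R) :
    (z ᵥ* Ψ) i = -z k ∧ (z ᵥ* Ψ) k = z i := by
  rw [← dot_e i (z ᵥ* Ψ), ← dot_e k (z ᵥ* Ψ), ← dotProduct_mulVec, ← dotProduct_mulVec, (h.swap hΨ).1,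
    (h.swap hΨ).2, dotProduct_neg, dot_e, dot_e]
  exact ⟨rfl, rfl⟩

theorem vecMul_mem_ideal {z : Fin N → R} (hz : ∀ j, z j ∈ I) (M : Matrix (Fin N) (Fin N) R)
    (j : Fin N) : (z ᵥ* M) j ∈ I := by
  rw [vecMul, dotProduct]
  exact I.sum_mem fun l _ => I.mul_mem_right _ (hz l)

theorem IsHyp.symp_left_mem (h : IsHyp Ψ i k) {c : R} (hc : c ∈ I) :
    symp Ψ (e i) c ∈ mats (RelElem N I) := by
  rw [symp, h.left]
  exact good_relElem _ _ h.ne c hc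

theorem IsHyp.symp_right_mem (h : IsHyp Ψ i k) {c : R} (hc : c ∈ I) :
    symp Ψ (e k) c ∈ mats (RelElem N I) := by
  rw [symp, h.right, vecMulVec_neg, smul_neg, ← neg_smul]
  exact good_relElem _ _ h.ne.symm _ (I.neg_mem hc)

/-- The two rank one parts compose without a cross term since i ≠ k. The condition z k = 0 makes one
factor a column operation and, through `IsHyp.vecMul_apply`, the other a row operation. -/
theorem IsHyp.eichler_left_mem (h : IsHyp Ψ i k) (hΨ : IsAlt Ψ) {z : Fin N → R}
    (hz : ∀ j, z j ∈ I) (hk : z k = 0) :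
    eichler Ψ (e i) z ∈ mats (RelElem N I) := by
  have h1 : 1 + vecMulVec (e i) (z ᵥ* Ψ) ∈ mats (RelElem N I) :=
    row_mem good_relElem i (by rw [(h.vecMul_apply hΨ z).1, hk, neg_zero])
      (vecMul_mem_ideal hz Ψ)
  have h2 : 1 + vecMulVec z (e k) ∈ mats (RelElem N I) := col_mem good_relElem k hk hz
  have := mul_mem h2 h1
  have e1 : eichler Ψ (e i) z = (1 + vecMulVec z (e k)) * (1 + vecMulVec (e i) (z ᵥ* Ψ)) := by
    rw [eichler, h.left, mul_add, add_mul, add_mul, vmv_mul, e_dot, e_ne h.ne]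
    rw [zero_smul, mul_one, mul_one, one_mul, add_zero]
    abel
  rwa [e1]

theorem IsHyp.eichler_right_mem (h : IsHyp Ψ i k) (hΨ : IsAlt Ψ) {z : Fin N → R}
    (hz : ∀ j, z j ∈ I) (hi : z i = 0) :
    eichler Ψ (e k) z ∈ mats (RelElem N I) := by
  have h1 : 1 + vecMulVec (e k) (z ᵥ* Ψ) ∈ mats (RelElem N I) :=
    row_mem good_relElem k (by rw [(h.vecMul_apply hΨ z).2, hi])
      (vecMul_mem_ideal hz Ψ)
  have h2 : 1 + vecMulVec (-z) (e i) ∈ mats (RelElem N I) :=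
    col_mem good_relElem i (by simp [hi]) fun j => I.neg_mem (hz j)
  have := mul_mem h2 h1
  have e1 : eichler Ψ (e k) z = (1 + vecMulVec (-z) (e i)) * (1 + vecMulVec (e k) (z ᵥ* Ψ)) := by
    rw [eichler, h.right, mul_add, add_mul, add_mul, vmv_mul, e_dot, e_ne h.ne.symm]
    rw [zero_smul, mul_one, mul_one, one_mul, add_zero, vecMulVec_neg, neg_vecMulVec]
    abel
  rwa [e1]

/-- `u` and `u'` are conjugate under isometries of `Ψ` that lie in `K`. -/
def IsoOrb (K : Subgroup (SpecialLinearGroup (Fin N) R)) (Ψ : Matrix (Fin N) (Fin N) R)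
    (u u' : Fin N → R) : Prop :=
  ∃ g ∈ mats K, IsIsom Ψ g ∧ g *ᵥ u = u'

theorem IsoOrb.trans {K : Subgroup (SpecialLinearGroup (Fin N) R)} {u u' u'' : Fin N → R}
    (h : IsoOrb K Ψ u u') (h' : IsoOrb K Ψ u' u'') : IsoOrb K Ψ u u'' := by
  obtain ⟨g, hg, hi, rfl⟩ := h
  obtain ⟨g', hg', hi', rfl⟩ := h'
  exact ⟨g' * g, mul_mem hg' hg, hi'.mul hi, by rw [mulVec_mulVec]⟩

/-- The auxiliary isometry need not be relative: E_N(R, I) is normalized by E_N(R). -/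
theorem IsoOrb.conj {s : Matrix (Fin N) (Fin N) R} (hs : s ∈ mats (Elem N R)) (hi : IsIsom Ψ s)
    {u u' : Fin N → R} (h : IsoOrb (RelElem N I) Ψ (s *ᵥ u) (s *ᵥ u')) :
    IsoOrb (RelElem N I) Ψ u u' := by
  obtain ⟨s, hs, rfl⟩ := hs
  obtain ⟨_, ⟨g, hg, rfl⟩, hgi, h⟩ := h
  refine ⟨_, ⟨s⁻¹ * g * s, ?_, rfl⟩, ?_, ?_⟩
  · have := relElem_conj (inv_mem hs) hg
    rwa [inv_inv] at this
  · exact ((hi.of_mul_eq_one (coe_mul_inv s)).mul hgi).mul hi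
  · change ((s⁻¹).1 * g.1 * s.1) *ᵥ u = u'
    rw [← mulVec_mulVec, ← mulVec_mulVec, h, mulVec_mulVec, coe_inv_mul, one_mulVec]

/-- The analogue for isometries of the transitivity on long rows. A dual not involving position i
permits changing u_i to 1 - u_k. A transvection along e_k adds this to u_k and gives 1, after which
the remaining entries are cleared. -/
theorem IsHyp.isoOrb_of_dual (h : IsHyp Ψ i k) (hΨ : IsAlt Ψ) {Θ : Matrix (Fin N) (Fin N) R}
    (hΘ : Θ * Ψ = 1) {u w : Fin N → R} (hu : ∀ j, u j - (e k : Fin N → R) j ∈ I)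
    (hw : w ⬝ᵥ u = 1) (hi : w i = 0) : IsoOrb (RelElem N I) Ψ u (e k) := by
  have huk : u k - 1 ∈ I := by simpa [e_self] using hu k
  have huj : ∀ j, j ≠ k → u j ∈ I := fun j hj => by simpa [e_ne hj.symm] using hu j
  set δ := 1 - u k - u i with hδ
  have hδI : δ ∈ I := by
    have := I.sub_mem (I.neg_mem huk) (huj i h.ne)
    rwa [neg_sub] at this
  -- The vector representing w - w_k e_k under the form; it pairs with u to 1 - w_k u_k. The missing
  -- w_k u_k is supplied by the symplectic transvection in the second move.
  set z := (w - w k • e k) ᵥ* Θ with hz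
  have hzΨ : z ᵥ* Ψ = w - w k • e k := by rw [hz, vecMul_vecMul, hΘ, vecMul_one]
  have hzi : z i = 0 := by
    rw [← (h.vecMul_apply hΨ z).2, hzΨ]
    simp [e_self]
  have hzk : z k = 0 := by
    rw [← neg_eq_zero, ← (h.vecMul_apply hΨ z).1, hzΨ]
    simp [hi, e_ne h.ne.symm]
  have hzu : z ⬝ᵥ Ψ *ᵥ u = 1 - w k * u k := by
    rw [dotProduct_mulVec, hzΨ, sub_dotProduct, hw, smul_dotProduct, e_dot, smul_eq_mul]
  have horth : ∀ z : Fin N → R, z k = 0 → (e i : Fin N → R) ⬝ᵥ Ψ *ᵥ z = 0 := fun z hz => by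
    rw [h.dot_left, hz]
  have o1 : IsoOrb (RelElem N I) Ψ u (u + (δ * (1 - w k * u k)) • e i + (u k * δ) • z) := by
    refine ⟨eichler Ψ (e i) (δ • z), h.eichler_left_mem hΨ (fun j => I.mul_mem_right _ hδI)
      (by simp [hzk]), isIsom_eichler hΨ (horth _ (by simp [hzk])), ?_⟩
    rw [eichler_mulVec, smul_dotProduct, hzu, h.dot_left, smul_smul, smul_eq_mul]
  have o2 : IsoOrb (RelElem N I) Ψ (u + (δ * (1 - w k * u k)) • e i + (u k * δ) • z)
      (u + δ • e i + (u k * δ) • z) := by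
    refine ⟨symp Ψ (e i) (δ * w k), h.symp_left_mem (I.mul_mem_right _ hδI),
      isIsom_symp hΨ _ _, ?_⟩
    rw [symp_mulVec, h.dot_left]
    simp only [Pi.add_apply, Pi.smul_apply, e_ne h.ne, hzk, smul_eq_mul, mul_zero, add_zero]
    module
  refine (o1.trans o2).trans ?_
  -- It adds the entry i to the entry k and fixes e_k; it is not relative, whence the conjugation.
  set s := symp Ψ (e k) (-1 : R) with hs
  have hs_mem : s ∈ mats (Elem N R) := by
    have := h.symp_right_mem (I := ⊤) (c := -1) Submodule.mem_top
    rwa [relElem_top] at this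
  refine IsoOrb.conj hs_mem (isIsom_symp hΨ _ _) ?_
  have hsk : s *ᵥ e k = e k := by
    rw [hs, symp_mulVec, h.dot_right, e_ne h.ne.symm]
    simp
  set l := u - u i • e i - u k • e k + (u k * δ) • z with hl
  have hli : l i = 0 := by simp [hl, e_self, e_ne h.ne.symm, hzi]
  have hlk : l k = 0 := by simp [hl, e_self, e_ne h.ne, hzk]
  have hsu : s *ᵥ (u + δ • e i + (u k * δ) • z) = l + (1 - u k) • e i + e k := by
    rw [hs, symp_mulVec, h.dot_right]
    simp only [Pi.add_apply, Pi.smul_apply, e_self, hzi, smul_eq_mul, mul_zero, add_zero, mul_one]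
    rw [hl, hδ]
    module
  have hlI : ∀ j, l j ∈ I := by
    intro j
    by_cases hji : j = i
    · rw [hji, hli]; exact I.zero_mem
    by_cases hjk : j = k
    · rw [hjk, hlk]; exact I.zero_mem
    have : l j = u j + u k * δ * z j := by
      simp [hl, e_ne (Ne.symm hji), e_ne (Ne.symm hjk)]
    rw [this]
    exact I.add_mem (huj j hjk) (I.mul_mem_right _ (I.mul_mem_left _ hδI))
  rw [hsk, hsu]
  have hll : (-l) ⬝ᵥ Ψ *ᵥ (l + (1 - u k) • e i + e k) = 0 := by
    rw [mulVec_add, mulVec_add, mulVec_smul, (h.swap hΨ).1, (h.swap hΨ).2, dotProduct_add,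
      dotProduct_add, dotProduct_smul, dotProduct_neg, dot_e, dot_e, neg_dotProduct,
      hΨ.dot_self]
    simp [hli, hlk]
  have o3 : IsoOrb (RelElem N I) Ψ (l + (1 - u k) • e i + e k) ((1 - u k) • e i + e k) := by
    refine ⟨eichler Ψ (e i) (-l), h.eichler_left_mem hΨ (fun j => I.neg_mem (hlI j))
      (by simp [hlk]), isIsom_eichler hΨ (horth _ (by simp [hlk])), ?_⟩
    rw [eichler_mulVec, hll, h.dot_left]
    simp only [Pi.add_apply, Pi.smul_apply, e_self, e_ne h.ne, hlk, smul_eq_mul, mul_zero,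
      add_zero, zero_add]
    module
  refine o3.trans ⟨symp Ψ (e i) (u k - 1), h.symp_left_mem huk, isIsom_symp hΨ _ _, ?_⟩
  rw [symp_mulVec, h.dot_left]
  simp only [Pi.add_apply, Pi.smul_apply, e_self, e_ne h.ne, smul_eq_mul, mul_zero, zero_add]
  module

/-- A reduction using a partial shortening `ζ` of `u`. -/
theorem IsHyp.isoOrb_of_shorten (h : IsHyp Ψ i k) (hΨ : IsAlt Ψ) {Θ : Matrix (Fin N) (Fin N) R}
    (hΘ : Θ * Ψ = 1) {u ζ w : Fin N → R} (hu : ∀ j, u j - (e k : Fin N → R) j ∈ I)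
    (hζi : ζ i = 0) (hζk : ζ k = 0) (hi : w i = 0) (hw : w ⬝ᵥ (u - (u i * u i) • ζ) = 1) :
    IsoOrb (RelElem N I) Ψ u (e k) := by
  have hui : u i ∈ I := by simpa [e_ne h.ne.symm] using hu i
  set c := ζ ⬝ᵥ Ψ *ᵥ u with hc
  have hζ : ∀ j, (u i • ζ) j ∈ I := fun j => I.mul_mem_right _ hui
  have horth : (e k : Fin N → R) ⬝ᵥ Ψ *ᵥ (u i • ζ) = 0 := by
    rw [h.dot_right]; simp [hζi]
  have hval : eichler Ψ (e k) (u i • ζ) *ᵥ u = u - (u i * u i) • ζ + (u i * c) • e k := by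
    rw [eichler_mulVec, h.dot_right, smul_dotProduct, ← hc, smul_eq_mul]
    module
  have o1 : IsoOrb (RelElem N I) Ψ u (u - (u i * u i) • ζ + (u i * c) • e k) :=
    ⟨_, h.eichler_right_mem hΨ hζ (by simp [hζi]), isIsom_eichler hΨ horth, hval⟩
  -- The Eichler move also adds u_i c to the entry k; the correction of w cancels its contribution
  -- w_k u_i c.
  refine o1.trans (h.isoOrb_of_dual hΨ hΘ (w := w - (w k * u i) • (ζ ᵥ* Ψ)) ?_ ?_ ?_)
  · intro j
    have : (u - (u i * u i) • ζ + (u i * c) • e k : Fin N → R) j - (e k : Fin N → R) j =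
        (u j - (e k : Fin N → R) j) - u i * (u i * ζ j - c * (e k : Fin N → R) j) := by
      simp; ring
    rw [this]
    exact I.sub_mem (hu j) (I.mul_mem_right _ hui)
  · have h1 : (ζ ᵥ* Ψ) ⬝ᵥ (e k : Fin N → R) = 0 := by
      rw [dot_e, (h.vecMul_apply hΨ ζ).2, hζi]
    have h2 : (ζ ᵥ* Ψ) ⬝ᵥ ζ = 0 := by rw [← dotProduct_mulVec, hΨ.dot_self]
    have h3 : (ζ ᵥ* Ψ) ⬝ᵥ u = c := by rw [← dotProduct_mulVec]
    rw [dotProduct_add, sub_dotProduct, hw, dotProduct_smul, sub_dotProduct, smul_dotProduct,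
      smul_dotProduct, h1, dotProduct_sub, h3, dotProduct_smul, h2, dot_e]
    simp
    ring
  · simp [hi, (h.vecMul_apply hΨ ζ).1, hζk]

/-- The stabilizer of `e k` moves every partner of `e k` to `e i`. -/
theorem IsHyp.isoOrb_partner (h : IsHyp Ψ i k) (hΨ : IsAlt Ψ) {w : Fin N → R}
    (hw : ∀ j, w j - (e i : Fin N → R) j ∈ I) (hi : w i = 1) :
    ∃ g ∈ mats (RelElem N I), IsIsom Ψ g ∧ g *ᵥ w = e i ∧ g *ᵥ e k = e k := by
  set l := w - e i - w k • e k with hl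
  have hli : l i = 0 := by simp [hl, hi, e_self, e_ne h.ne.symm]
  have hlk : l k = 0 := by simp [hl, e_self, e_ne h.ne]
  have hwk : w k ∈ I := by simpa [e_ne h.ne] using hw k
  have hlI : ∀ j, l j ∈ I := fun j => I.sub_mem (hw j) (I.mul_mem_right _ hwk)
  have horth : (e k : Fin N → R) ⬝ᵥ Ψ *ᵥ l = 0 := by rw [h.dot_right, hli, neg_zero]
  have hlw : l ⬝ᵥ Ψ *ᵥ w = 0 := by
    have : w = l + e i + w k • e k := by rw [hl]; abel
    rw [this, mulVec_add, mulVec_add, mulVec_smul, (h.swap hΨ).1, (h.swap hΨ).2, dotProduct_add,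
      dotProduct_add, dotProduct_smul, dotProduct_neg, dot_e, dot_e, hΨ.dot_self]
    simp [hli, hlk]
  refine ⟨symp Ψ (e k) (w k) * eichler Ψ (e k) l, mul_mem (h.symp_right_mem hwk)
    (h.eichler_right_mem hΨ hlI hli), (isIsom_symp hΨ _ _).mul (isIsom_eichler hΨ horth),
    ?_, ?_⟩
  · rw [← mulVec_mulVec, eichler_mulVec, hlw, h.dot_right, hi, symp_mulVec, h.dot_right]
    have : (w + (0 : R) • e k + (-1 : R) • l : Fin N → R) i = 1 := by simp [hi, hli]
    rw [this, hl]
    module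
  · have h1 : l ⬝ᵥ Ψ *ᵥ (e k : Fin N → R) = 0 := by rw [hΨ.dot_swap, horth, neg_zero]
    rw [← mulVec_mulVec, eichler_mulVec, h1, hΨ.dot_self, zero_smul, zero_smul, add_zero,
      add_zero, symp_mulVec, hΨ.dot_self, mul_zero, zero_smul, add_zero]

end Isometry

/-! ### Stabilization by identity blocks. -/

section Padding

variable {R : Type u} [CommRing R] {n : ℕ} {I : Ideal R}

/-- The matrix `M ⊥ 1` of size `N ≥ n`. -/
def pad (M : Matrix (Fin n) (Fin n) R) (N : ℕ) : Matrix (Fin N) (Fin N) R :=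
  of fun i j => if h : (i : ℕ) < n ∧ (j : ℕ) < n then M ⟨i, h.1⟩ ⟨j, h.2⟩ else
    (1 : Matrix (Fin N) (Fin N) R) i j

theorem pad_self (M : Matrix (Fin n) (Fin n) R) : pad M n = M := by
  ext i j
  simp [pad]

theorem pad_pad {N N' : ℕ} (h : n ≤ N) (M : Matrix (Fin n) (Fin n) R) :
    pad (pad M N) N' = pad M N' := by
  ext i j
  simp only [pad, of_apply]
  by_cases h1 : (i : ℕ) < n ∧ (j : ℕ) < n
  · rw [dif_pos h1, dif_pos (by omega), dif_pos h1]
  · rw [dif_neg h1]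
    split_ifs
    · simp only [one_apply, Fin.ext_iff]
    · rfl

theorem pad_add (M : Matrix (Fin n) (Fin n) R) (k : ℕ) : pad M (n + k) = perp M 1 := by
  ext i j
  by_cases hi : (i : ℕ) < n <;> by_cases hj : (j : ℕ) < n
  · rw [perp_lt _ _ _ _ hi hj]
    simp [pad, hi, hj]
  · rw [perp_lt_ge _ _ _ _ hi (by omega)]
    simp only [pad, of_apply, hj, and_false, dif_neg, not_false_eq_true]
    exact one_apply_ne (by rw [Ne, Fin.ext_iff]; omega)
  · rw [perp_ge_lt _ _ _ _ (by omega) hj]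
    simp only [pad, of_apply, hi, false_and, dif_neg, not_false_eq_true]
    exact one_apply_ne (by rw [Ne, Fin.ext_iff]; omega)
  · rw [perp_ge _ _ _ _ (by omega) (by omega)]
    simp only [pad, of_apply, hi, false_and, dif_neg, not_false_eq_true, one_apply, Fin.ext_iff]
    congr 1
    rw [eq_iff_iff]
    omega

theorem pad_mul {N : ℕ} (h : n ≤ N) (M M' : Matrix (Fin n) (Fin n) R) :
    pad (M * M') N = pad M N * pad M' N := by
  obtain ⟨k, rfl⟩ := Nat.exists_eq_add_of_le h
  rw [pad_add, pad_add, pad_add, perp_mul, one_mul]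

theorem stabSL_transvection (k : ℕ) {i j : Fin n} (hij : i ≠ j) (x : R) :
    ∃ h : Fin.castAdd k i ≠ Fin.castAdd k j, stabSL n k R (SpecialLinearGroup.transvection hij x) =
      SpecialLinearGroup.transvection h x := by
  refine ⟨by simpa using hij, Subtype.ext ?_⟩
  change perp (1 + single i j x) 1 = 1 + single _ _ x
  rw [← perp_one_one]
  ext a b
  refine Fin.addCases (fun a => ?_) (fun a => ?_) a <;>
    refine Fin.addCases (fun b => ?_) (fun b => ?_) b <;>
    simp only [Matrix.add_apply, single_apply, perp, submatrix_apply, Fin.ext_iff,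
      Fin.val_castAdd, Fin.val_natAdd, finSumFinEquiv_symm_apply_castAdd,
      finSumFinEquiv_symm_apply_natAdd, fromBlocks_apply₁₁, fromBlocks_apply₁₂,
      fromBlocks_apply₂₁, fromBlocks_apply₂₂] <;> grind

theorem stabSL_mem_elem (k : ℕ) {g : SpecialLinearGroup (Fin n) R} (hg : g ∈ Elem n R) :
    stabSL n k R g ∈ Elem (n + k) R := by
  have : Elem n R ≤ (Elem (n + k) R).comap (stabSL n k R) := by
    refine (Subgroup.closure_le _).2 ?_
    rintro _ ⟨i, j, hij, x, rfl⟩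
    obtain ⟨h, e1⟩ := stabSL_transvection k hij x
    exact Subgroup.subset_closure ⟨_, _, h, x, e1⟩
  exact this hg

theorem stabSL_mem_relElem (k : ℕ) {g : SpecialLinearGroup (Fin n) R} (hg : g ∈ RelElem n I) :
    stabSL n k R g ∈ RelElem (n + k) I := by
  have : RelElem n I ≤ (RelElem (n + k) I).comap (stabSL n k R) := by
    refine (Subgroup.closure_le _).2 ?_
    rintro _ ⟨h, hh, i, j, hij, x, hx, rfl⟩
    obtain ⟨h', e1⟩ := stabSL_transvection k hij x
    refine Subgroup.subset_closure ⟨_, stabSL_mem_elem k hh, _, _, h', x, hx, ?_⟩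
    rw [map_mul, map_mul, map_inv, e1]
  exact this hg

theorem pad_mem_relElem {N : ℕ} (h : n ≤ N) {g : Matrix (Fin n) (Fin n) R}
    (hg : g ∈ mats (RelElem n I)) : pad g N ∈ mats (RelElem N I) := by
  obtain ⟨k, rfl⟩ := Nat.exists_eq_add_of_le h
  obtain ⟨g, hg, rfl⟩ := hg
  exact ⟨_, stabSL_mem_relElem k hg, (pad_add _ _).symm⟩

theorem sub_one_mem_of_mem_relElem {g : Matrix (Fin n) (Fin n) R}
    (hg : g ∈ mats (RelElem n I)) (i j : Fin n) : g i j - (1 : Matrix (Fin n) (Fin n) R) i j ∈ I := by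
  obtain ⟨g, hg, rfl⟩ := hg
  have h1 : SpecialLinearGroup.map (Ideal.Quotient.mk I) g = 1 := relElem_le_relSL hg
  have h2 : Ideal.Quotient.mk I (g.1 i j) = (1 : Matrix (Fin n) (Fin n) (R ⧸ I)) i j :=
    congrFun (congrFun (congrArg Subtype.val h1) i) j
  rw [← Ideal.Quotient.eq, h2, one_apply, one_apply]
  split_ifs <;> simp

theorem sub_one_mem_of_pad {N : ℕ} (h : n ≤ N) {g : Matrix (Fin n) (Fin n) R}
    (hg : pad g N ∈ mats (RelElem N I)) (i j : Fin n) :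
    g i j - (1 : Matrix (Fin n) (Fin n) R) i j ∈ I := by
  have := sub_one_mem_of_mem_relElem hg (Fin.castLE h i) (Fin.castLE h j)
  simpa [pad, one_apply] using this

theorem det_of_pad {N : ℕ} (h : n ≤ N) {g : Matrix (Fin n) (Fin n) R}
    (hg : pad g N ∈ mats (RelElem N I)) : g.det = 1 := by
  obtain ⟨k, rfl⟩ := Nat.exists_eq_add_of_le h
  obtain ⟨a, ha, e1⟩ := hg
  have := a.2
  rw [e1, pad_add, perp_det, det_one, mul_one] at this
  exact this

end Padding

/-! ### Relative cancellation of hyperbolic planes. -/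

section Descent

variable {R : Type u} [CommRing R] {n : ℕ} {I : Ideal R}

/-- Stable range is applied modulo the last entry y to x² and the first n entries, where x is the
entry to be dropped. The square is used because the Eichler move has vector x ζ, with entries in I,
and shifts u by x times it. Lifting the relation from R/(y) supplies the coefficient of y, and none
for x. -/
theorem exists_shorten (hR : ringKrullDim R < n) {u w : Fin (n + 2) → R} (hw : w ⬝ᵥ u = 1) :
    ∃ ζ w' : Fin (n + 2) → R, ζ (Fin.natAdd n 0) = 0 ∧ ζ (Fin.natAdd n 1) = 0 ∧
      w' (Fin.natAdd n 0) = 0 ∧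
      w' ⬝ᵥ (u - (u (Fin.natAdd n 0) * u (Fin.natAdd n 0)) • ζ) = 1 := by
  set x := u (Fin.natAdd n 0) with hx
  set y := u (Fin.natAdd n 1) with hy
  have hdim : ringKrullDim (R ⧸ Ideal.span {y}) < n := (ringKrullDim_quotient_le _).trans_lt hR
  let π := Ideal.Quotient.mk (Ideal.span {y})
  have hsplit : ∀ f g : Fin (n + 2) → R, f ⬝ᵥ g = ∑ j : Fin n, f (Fin.castAdd 2 j) *
      g (Fin.castAdd 2 j) + (f (Fin.natAdd n 0) * g (Fin.natAdd n 0) +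
        f (Fin.natAdd n 1) * g (Fin.natAdd n 1)) := fun f g => by
    rw [dotProduct, Fin.sum_univ_add, Fin.sum_univ_two]
  obtain ⟨ξ, c, hc⟩ := stable_range n hdim (π (x * x)) (fun j => π (u (Fin.castAdd 2 j))) (by
    intro p hp hxp
    by_contra! hcon
    refine hp.ne_top ((Ideal.eq_top_iff_one _).2 ?_)
    rw [← map_one π, ← hw, hsplit, map_add, map_add, map_sum]
    refine p.add_mem (p.sum_mem fun j _ => ?_) (p.add_mem ?_ ?_)
    · rw [map_mul]
      exact p.mul_mem_left _ (hcon j)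
    · rw [map_mul] at hxp
      rw [map_mul]
      exact p.mul_mem_left _ ((hp.mem_or_mem hxp).elim id id)
    · rw [map_mul]
      have : π (u (Fin.natAdd n 1)) = 0 :=
        Ideal.Quotient.eq_zero_iff_mem.2 (Ideal.mem_span_singleton_self y)
      rw [this, mul_zero]
      exact p.zero_mem)
  choose ζ hζ using fun j => Ideal.Quotient.mk_surjective (-ξ j)
  choose d hd using fun j => Ideal.Quotient.mk_surjective (c j)
  have h1 : 1 - ∑ j, d j * (u (Fin.castAdd 2 j) - x * x * ζ j) ∈ Ideal.span {y} := by
    rw [← Ideal.Quotient.eq_zero_iff_mem, map_sub, map_one, map_sum, sub_eq_zero, ← hc,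
      dotProduct]
    refine Finset.sum_congr rfl fun j _ => ?_
    change _ = π (d j * (u (Fin.castAdd 2 j) - x * x * ζ j))
    have hd' : π (d j) = c j := hd j
    have hζ' : π (ζ j) = -ξ j := hζ j
    simp only [map_sub, map_mul, hd', hζ', Pi.add_apply, Pi.smul_apply, smul_eq_mul]
    ring
  obtain ⟨t, ht⟩ := Ideal.mem_span_singleton'.1 h1
  refine ⟨Fin.append ζ 0, Fin.append d ![0, t], ?_, ?_, ?_, ?_⟩
  · simp
  · simp
  · simp
  · rw [hsplit]
    simp only [Fin.append_left, Fin.append_right, Pi.sub_apply, Pi.smul_apply, smul_eq_mul]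
    simp [← hy, ht]

theorem isHyp_stab (hn : Even n) (M : Matrix (Fin n) (Fin n) R) :
    IsHyp (stab M (n + 2)) (Fin.natAdd n 0) (Fin.natAdd n 1) := by
  have hodd : ¬ Even (n + 1) := by simpa [Nat.even_add_one] using hn
  refine ⟨by simp, ?_, ?_⟩
  · ext j
    rw [← dot_e j (e _ ᵥ* _), ← dotProduct_mulVec, e_dot, mulVec, dot_e]
    simp only [stab, of_apply, stdEntry, e, Pi.single_apply, Fin.ext_iff, Fin.val_natAdd,
      Fin.val_zero, Fin.val_one, add_zero, hn, true_and, lt_irrefl, false_and, dif_neg,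
      not_false_eq_true]
    grind
  · ext j
    rw [← dot_e j (e _ ᵥ* _), ← dotProduct_mulVec, e_dot, mulVec, dot_e]
    simp only [stab, of_apply, stdEntry, Pi.neg_apply, e, Pi.single_apply, Fin.ext_iff,
      Fin.val_natAdd, Fin.val_zero, Fin.val_one, add_zero, hodd, false_and]
    grind

theorem exists_inv_stab (hn : Even n) {M Θ : Matrix (Fin n) (Fin n) R} (hΘ : Θ * M = 1) :
    ∃ Θ', Θ' * stab M (n + 2) = 1 := by
  refine ⟨perp Θ (-of fun i j : Fin 2 => stdEntry R (i + n) (j + n)), ?_⟩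
  rw [stab_add hn, perp_mul, hΘ, ← perp_one_one]
  congr 1
  have hodd : ¬ Even (1 + n) := by simpa [Nat.even_add_one, add_comm] using hn
  ext i j
  rw [Matrix.mul_apply, Fin.sum_univ_two]
  fin_cases i <;> fin_cases j <;> simp [stdEntry, hn, hodd] <;> grind

/-- Cancellation of a hyperbolic plane, relative to `I`. -/
theorem exists_descent (hn : Even n) (hR : ringKrullDim R < n)
    {φ φ' Θ : Matrix (Fin n) (Fin n) R} (hφ' : IsAlt φ') (hΘ : Θ * φ' = 1) {N : ℕ}
    (hN : n + 2 ≤ N) {ε : Matrix (Fin (n + 2)) (Fin (n + 2)) R}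
    (hε : pad ε N ∈ mats (RelElem N I))
    (h : εᵀ * stab φ' (n + 2) * ε = stab φ (n + 2)) :
    ∃ ε' : Matrix (Fin n) (Fin n) R, pad ε' N ∈ mats (RelElem N I) ∧ ε'ᵀ * φ' * ε' = φ := by
  have hΨ' := hφ'.stab (n + 2)
  have hyp' := isHyp_stab hn φ'
  have hyp := isHyp_stab hn φ
  obtain ⟨Θ', hΘ'⟩ := exists_inv_stab hn hΘ
  have hst : stab φ' (n + 2) = _ := stab_add hn φ' 2
  have hst2 : stab φ (n + 2) = _ := stab_add hn φ 2
  set Ψ' := stab φ' (n + 2) with hdef'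
  set Ψ := stab φ (n + 2) with hdef
  set i : Fin (n + 2) := Fin.natAdd n 0 with hi
  set k : Fin (n + 2) := Fin.natAdd n 1 with hk
  have hform : ∀ (η : Matrix (Fin (n + 2)) (Fin (n + 2)) R), ηᵀ * Ψ' * η = Ψ →
      ∀ x y : Fin (n + 2) → R, (η *ᵥ x) ⬝ᵥ Ψ' *ᵥ (η *ᵥ y) = x ⬝ᵥ Ψ *ᵥ y := by
    intro η hη x y
    rw [← hη, ← vecMul_transpose, ← dotProduct_mulVec, mulVec_mulVec, mulVec_mulVec]
  have hcol : ∀ l j, (ε *ᵥ e l) j - (e l : Fin (n + 2) → R) j ∈ I := by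
    intro l j
    have := sub_one_mem_of_pad hN hε j l
    rw [mulVec, dot_e]
    convert this using 2
    simp [e, Pi.single_apply, one_apply]
  have hpair : (ε *ᵥ e i) ⬝ᵥ Ψ' *ᵥ (ε *ᵥ e k) = 1 := by
    rw [hform ε h, hyp.dot_left, e_self]
  have hwu : ((ε *ᵥ e i) ᵥ* Ψ') ⬝ᵥ (ε *ᵥ e k) = 1 := by rw [← dotProduct_mulVec, hpair]
  obtain ⟨ζ, w, h1, h2, h3, h4⟩ := exists_shorten hR hwu
  -- First ε e_k is moved to e_k; the image of ε e_i is then a partner of e_k, and can be moved to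
  -- e_i with e_k fixed.
  obtain ⟨g₁, hg₁, hi₁, hgu⟩ := hyp'.isoOrb_of_shorten hΨ' hΘ' (hcol k) h1 h2 h3 h4
  have hw1 : (g₁ *ᵥ (ε *ᵥ e i)) i = 1 := by
    have := isIsom_iff.1 hi₁ (ε *ᵥ e i) (ε *ᵥ e k)
    rw [hgu, hpair, hΨ'.dot_swap, hyp'.dot_right, neg_neg] at this
    exact this
  have hcol' : ∀ j, (g₁ *ᵥ (ε *ᵥ e i)) j - (e i : Fin (n + 2) → R) j ∈ I := by
    intro j
    have hm : pad (g₁ * ε) N ∈ mats (RelElem N I) := by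
      rw [pad_mul hN]
      exact mul_mem (pad_mem_relElem hN hg₁) hε
    have := sub_one_mem_of_pad hN hm j i
    rw [mulVec_mulVec, mulVec, dot_e]
    convert this using 2
    simp [e, Pi.single_apply, one_apply]
  obtain ⟨g₂, hg₂, hi₂, hgw, hgk⟩ := hyp'.isoOrb_partner hΨ' hcol' hw1
  set η := g₂ * g₁ * ε with hη
  have hηk : η *ᵥ e k = e k := by rw [hη, ← mulVec_mulVec, ← mulVec_mulVec, hgu, hgk]
  have hηi : η *ᵥ e i = e i := by rw [hη, ← mulVec_mulVec, ← mulVec_mulVec, hgw]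
  have hηΨ : ηᵀ * Ψ' * η = Ψ := by
    have := hi₂.mul hi₁
    rw [hη, transpose_mul]
    calc _ = εᵀ * ((g₂ * g₁)ᵀ * Ψ' * (g₂ * g₁)) * ε := by simp only [Matrix.mul_assoc]
      _ = Ψ := by rw [this, h]
  have hηm : pad η N ∈ mats (RelElem N I) := by
    rw [hη, pad_mul hN]
    exact mul_mem (pad_mem_relElem hN (mul_mem hg₂ hg₁)) hε
  -- These coordinates are pairings with e_k and e_i, which η fixes; hence η is a block sum with an
  -- identity.
  have hrow : ∀ x, (η *ᵥ x) i = x i ∧ (η *ᵥ x) k = x k := by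
    intro x
    have a1 := hform η hηΨ (e k) x
    have a2 := hform η hηΨ (e i) x
    rw [hηk, hyp'.dot_right, hyp.dot_right, neg_inj] at a1
    rw [hηi, hyp'.dot_left, hyp.dot_left] at a2
    exact ⟨a1, a2⟩
  have hlast : ∀ j : Fin (n + 2), n ≤ (j : ℕ) → j = i ∨ j = k := by
    intro j hj
    have := j.2
    rw [Fin.ext_iff, Fin.ext_iff]
    simp [hi, hk]
    omega
  have hηp : η = pad (η.submatrix (Fin.castAdd 2) (Fin.castAdd 2)) (n + 2) := by
    ext a b
    simp only [pad, of_apply, submatrix_apply]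
    split_ifs with hab
    · rfl
    · rcases not_and_or.1 hab with ha | hb
      · have : η a b = (η *ᵥ e b) a := by rw [mulVec, dot_e]
        rw [this, one_apply]
        have : (η *ᵥ e b) a = (e b : Fin (n + 2) → R) a := by
          rcases hlast a (not_lt.1 ha) with rfl | rfl
          · exact (hrow _).1
          · exact (hrow _).2
        rw [this]
        simp [e, Pi.single_apply]
      · have : η a b = (η *ᵥ e b) a := by rw [mulVec, dot_e]
        rw [this, one_apply]
        have : η *ᵥ e b = e b := by
          rcases hlast b (not_lt.1 hb) with rfl | rfl
          · exact hηi
          · exact hηk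
        rw [this]
        simp [e, Pi.single_apply]
  set ε' := η.submatrix (Fin.castAdd 2) (Fin.castAdd 2)
  refine ⟨ε', ?_, ?_⟩
  · rw [← pad_pad (show n ≤ n + 2 by omega), ← hηp]
    exact hηm
  · rw [hηp, pad_add, hst, hst2, perp_transpose, perp_mul, perp_mul] at hηΨ
    ext a b
    have := congrFun (congrFun hηΨ (Fin.castAdd 2 a)) (Fin.castAdd 2 b)
    rw [perp_lt _ _ _ _ (by simp) (by simp), perp_lt _ _ _ _ (by simp) (by simp)] at this
    exact this

end Descent

/-! ### Lifting integral isometries to elementary ones. -/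

section Lifting

variable {A : Type u} [CommRing A] {N : ℕ} {Ψ : Matrix (Fin N) (Fin N) A} (π : A →+* ℤ)

theorem symp_smul (p : Fin N → A) (k c : A) : symp Ψ (k • p) c = symp Ψ p (c * (k * k)) := by
  rw [symp, symp, smul_vecMul, smul_vecMulVec, vecMulVec_smul, smul_smul, smul_smul, mul_assoc]

/-- An integral vector is a multiple k of s e₀ with s integral elementary. The transvection is
therefore conjugate by s to a row operation, whose diagonal coefficient vanishes because the form is
alternating. -/
theorem symp_mem_elem (hΨ : IsAlt Ψ) (y : Fin N → ℤ) (c : A) :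
    symp Ψ (fun i => (y i : A)) c ∈ mats (Elem N A) := by
  rcases Nat.eq_zero_or_pos N with rfl | hN
  · have : symp Ψ (fun i => (y i : A)) c = 1 := by ext i; exact i.elim0
    rw [this]
    exact one_mem _
  have : NeZero N := ⟨hN.ne'⟩
  obtain ⟨k, _, ⟨g, hg, rfl⟩, h⟩ := orb_int_smul y
  set s := SpecialLinearGroup.map (Int.castRingHom A) (g⁻¹).transpose with hs
  have hs_mem : s ∈ Elem N A := map_mem_elem N _ (elem_transpose (inv_mem hg))
  have hy : (fun i => (y i : A)) = (k : A) • (s.1 *ᵥ e 0) := by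
    have h1 : y = k • ((g⁻¹).1ᵀ *ᵥ e 0) := by
      rw [mulVec_transpose, ← smul_vecMul, ← h, vecMul_vecMul, coe_mul_inv, vecMul_one]
    ext i
    have h2 := congrArg (Int.castRingHom A) (congrFun h1 i)
    rw [Pi.smul_apply, mulVec, dot_e] at h2
    rw [Pi.smul_apply, mulVec, dot_e]
    rw [smul_eq_mul, map_mul] at h2
    exact h2
  rw [hy, symp_smul]
  set c' := c * ((k : A) * k)
  have h3 : symp Ψ (s.1 *ᵥ e 0) c' = s.1 *
      (1 + vecMulVec (e 0) (c' • ((s.1 *ᵥ e 0) ᵥ* Ψ ᵥ* s.1))) * (s⁻¹).1 := by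
    have := conj_one_add s.1 (s⁻¹).1 (coe_mul_inv s) (e 0) ((s.1 *ᵥ e 0) ᵥ* Ψ ᵥ* s.1) c'
    rw [← vecMulVec_smul, vecMul_vecMul _ s.1, coe_mul_inv, vecMul_one] at this
    rw [this, symp]
  rw [h3]
  refine mul_mem (mul_mem ⟨s, hs_mem, rfl⟩ (row_mem_elem 0 ?_)) ⟨s⁻¹, inv_mem hs_mem, rfl⟩
  rw [Pi.smul_apply, ← dot_e 0 (_ ᵥ* s.1), ← dotProduct_mulVec, ← dotProduct_mulVec,
    hΨ.dot_self, smul_zero]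

theorem map_symp (p : Fin N → A) (c : A) :
    (symp Ψ p c).map π = symp (Ψ.map π) (π ∘ p) (π c) := by
  ext i j
  simp only [symp, map_apply, Matrix.add_apply, Matrix.smul_apply, smul_eq_mul, vecMulVec_apply,
    vecMul, dotProduct, map_add, map_mul, map_sum, Function.comp, one_apply]
  split_ifs <;> simp

/-- The integral matrices that lift to elementary isometries of `Ψ`. -/
def lifts (Ψ : Matrix (Fin N) (Fin N) A) : Submonoid (Matrix (Fin N) (Fin N) ℤ) where
  carrier := {g | ∃ η ∈ mats (Elem N A), IsIsom Ψ η ∧ η.map π = g}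
  one_mem' := ⟨1, one_mem _, by simp [IsIsom], Matrix.map_one π (map_zero π) (map_one π)⟩
  mul_mem' := by
    rintro _ _ ⟨η, hη, hi, rfl⟩ ⟨η', hη', hi', rfl⟩
    exact ⟨η * η', mul_mem hη hη', hi.mul hi', Matrix.map_mul⟩

theorem symp_mem_lifts (hΨ : IsAlt Ψ) (y : Fin N → ℤ) (c : ℤ) :
    symp (Ψ.map π) y c ∈ lifts π Ψ := by
  refine ⟨_, symp_mem_elem hΨ y (c : A), isIsom_symp hΨ _ _, ?_⟩
  rw [map_symp]
  congr 1
  · ext i; simp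
  · simp

theorem IsAlt.map {S : Type v} [CommRing S] (hΨ : IsAlt Ψ) (f : A →+* S) : IsAlt (Ψ.map f) :=
  .of_swap (fun i j => by rw [map_apply, map_apply, hΨ.swap, map_neg])
    fun i => by rw [map_apply, hΨ.2, map_zero]

/-- Polarization of p ↦ ⟨p, x⟩ p: orthogonality of p and z makes the three transvections combine
additively. This makes lifting symplectic transvections sufficient. -/
theorem eichler_eq_symp (hΨ : IsAlt Ψ) {p z : Fin N → A} (h : p ⬝ᵥ Ψ *ᵥ z = 0) :
    eichler Ψ p z = symp Ψ (p + z) 1 * symp Ψ p (-1) * symp Ψ z (-1) := by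
  have h' : z ⬝ᵥ Ψ *ᵥ p = 0 := by rw [hΨ.dot_swap, h, neg_zero]
  refine ext_of_mulVec_single fun j => ?_
  rw [← mulVec_mulVec, ← mulVec_mulVec, eichler_mulVec, symp_mulVec, symp_mulVec, symp_mulVec]
  simp only [mulVec_add, mulVec_smul, dotProduct_add, dotProduct_smul, add_dotProduct,
    hΨ.dot_self, h, h', smul_eq_mul, mul_zero, add_zero]
  module

theorem eichler_mem_lifts (hΨ : IsAlt Ψ) {p z : Fin N → ℤ} (h : p ⬝ᵥ (Ψ.map π) *ᵥ z = 0) :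
    eichler (Ψ.map π) p z ∈ lifts π Ψ := by
  rw [eichler_eq_symp (hΨ.map π) h]
  exact mul_mem (mul_mem (symp_mem_lifts π hΨ _ _) (symp_mem_lifts π hΨ _ _))
    (symp_mem_lifts π hΨ _ _)

/-- The rotation interchanging two hyperbolic planes. -/
theorem exists_rotation (hΨ : IsAlt Ψ) {i k i' k' : Fin N} (h : IsHyp (Ψ.map π) i k)
    (h' : IsHyp (Ψ.map π) i' k') (h₁ : i ≠ i') (h₂ : i ≠ k') (h₃ : k ≠ i') (h₄ : k ≠ k') :
    ∃ g ∈ lifts π Ψ, ∀ x : Fin N → ℤ, (g *ᵥ x) i = x i' ∧ (g *ᵥ x) k = x k' ∧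
      (g *ᵥ x) i' = -x i ∧ (g *ᵥ x) k' = -x k ∧
      ∀ j, j ≠ i → j ≠ k → j ≠ i' → j ≠ k' → (g *ᵥ x) j = x j := by
  have m₁ : eichler (Ψ.map π) (-e i) (e k') ∈ lifts π Ψ :=
    eichler_mem_lifts π hΨ (by rw [neg_dotProduct, h.dot_left, e_ne h₄.symm, neg_zero])
  have m₂ : eichler (Ψ.map π) (e i') (e k) ∈ lifts π Ψ :=
    eichler_mem_lifts π hΨ (by rw [h'.dot_left, e_ne h₄])
  have a₁ : ∀ x : Fin N → ℤ, eichler (Ψ.map π) (-e i) (e k') *ᵥ x =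
      x + x i' • e i - x k • e k' := fun x => by
    rw [eichler_mulVec, neg_dotProduct, h.dot_left, h'.dot_right]
    module
  have a₂ : ∀ x : Fin N → ℤ, eichler (Ψ.map π) (e i') (e k) *ᵥ x =
      x - x i • e i' + x k' • e k := fun x => by
    rw [eichler_mulVec, h'.dot_left, h.dot_right]
    module
  -- The usual expression of a rotation by a right angle as three shears, on two hyperbolic planes
  -- at once.
  refine ⟨_, mul_mem (mul_mem m₁ m₂) m₁, fun x => ?_⟩
  rw [← mulVec_mulVec, ← mulVec_mulVec, a₁ x, a₂, a₁]
  have n₁ := h.ne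
  have n₂ := h'.ne
  simp only [Pi.add_apply, Pi.sub_apply, Pi.smul_apply, smul_eq_mul, e_self, e_ne n₁, e_ne n₁.symm,
    e_ne n₂, e_ne n₂.symm, e_ne h₁, e_ne h₁.symm, e_ne h₂, e_ne h₂.symm, e_ne h₃, e_ne h₃.symm,
    e_ne h₄, e_ne h₄.symm]
  refine ⟨by ring, by ring, by ring, by ring, fun j j₁ j₂ j₃ j₄ => ?_⟩
  rw [e_ne j₁.symm, e_ne j₂.symm, e_ne j₃.symm, e_ne j₄.symm]
  ring

/-- The standard alternating matrix of size `N`. -/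
def stdForm (A : Type u) [CommRing A] (N : ℕ) : Matrix (Fin N) (Fin N) A :=
  of fun i j => stdEntry A i j

theorem isHyp_stdForm {i k : Fin N} (hi : Even (i : ℕ)) (hk : (k : ℕ) = i + 1) :
    IsHyp (stdForm A N) i k := by
  have hodd : ¬ Even (k : ℕ) := by rw [hk]; simpa [Nat.even_add_one] using hi
  refine ⟨fun h => by rw [h] at hk; omega, ?_, ?_⟩
  · ext j
    rw [← dot_e j (e _ ᵥ* _), ← dotProduct_mulVec, e_dot, mulVec, dot_e]
    simp only [stdForm, of_apply, stdEntry, e, Pi.single_apply, Fin.ext_iff, hi, true_and]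
    grind
  · ext j
    rw [← dot_e j (e _ ᵥ* _), ← dotProduct_mulVec, e_dot, mulVec, dot_e]
    simp only [stdForm, of_apply, stdEntry, Pi.neg_apply, e, Pi.single_apply, Fin.ext_iff, hodd,
      false_and]
    grind

theorem map_stab {S : Type v} [CommRing S] {n : ℕ} (M : Matrix (Fin n) (Fin n) A) (f : A →+* S)
    (N : ℕ) : (stab M N).map f = stab (M.map f) N := by
  ext i j
  simp only [stab, map_apply, of_apply, stdEntry]
  split_ifs <;> simp

theorem stab_stdForm (n N : ℕ) : stab (stdForm A n) N = stdForm A N := by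
  ext i j
  simp [stab, stdForm]

/-- The block rotation lifts. -/
theorem exists_block_rotation {n : ℕ} (hn : Even n)
    {Ψ : Matrix (Fin (n + n)) (Fin (n + n)) A} (hΨ : IsAlt Ψ)
    (hπ : Ψ.map π = stdForm ℤ (n + n)) : ∃ g ∈ lifts π Ψ, ∀ (x : Fin (n + n) → ℤ) (j : Fin n),
      (g *ᵥ x) (Fin.castAdd n j) = x (Fin.natAdd n j) ∧
      (g *ᵥ x) (Fin.natAdd n j) = -x (Fin.castAdd n j) := by
  -- The first a hyperbolic planes of each half are interchanged; a increases by one rotation at a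
  -- time.
  have key : ∀ a : ℕ, a + a ≤ n → ∃ g ∈ lifts π Ψ, ∀ (x : Fin (n + n) → ℤ) (j : Fin n),
      (g *ᵥ x) (Fin.castAdd n j) =
        (if (j : ℕ) < a + a then x (Fin.natAdd n j) else x (Fin.castAdd n j)) ∧
      (g *ᵥ x) (Fin.natAdd n j) =
        (if (j : ℕ) < a + a then -x (Fin.castAdd n j) else x (Fin.natAdd n j)) := by
    intro a
    induction a with
    | zero => exact fun _ => ⟨1, one_mem _, fun x j => by simp⟩
    | succ a ih =>
      intro ha
      obtain ⟨g, hg, h⟩ := ih (by omega)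
      have e₁ : Even (a + a) := ⟨a, rfl⟩
      have H₁ : IsHyp (Ψ.map π) (Fin.castAdd n ⟨a + a, by omega⟩)
          (Fin.castAdd n ⟨a + a + 1, by omega⟩) := by
        rw [hπ]; exact isHyp_stdForm (by simp) (by simp)
      have H₂ : IsHyp (Ψ.map π) (Fin.natAdd n ⟨a + a, by omega⟩)
          (Fin.natAdd n ⟨a + a + 1, by omega⟩) := by
        rw [hπ]; exact isHyp_stdForm (hn.add e₁) (by simp; omega)
      obtain ⟨r, hr, h'⟩ := exists_rotation π hΨ H₁ H₂ (by simp [Fin.ext_iff]; omega)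
        (by simp [Fin.ext_iff]; omega) (by simp [Fin.ext_iff]; omega)
        (by simp [Fin.ext_iff]; omega)
      refine ⟨g * r, mul_mem hg hr, fun x j => ?_⟩
      rw [← mulVec_mulVec, (h _ j).1, (h _ j).2]
      obtain ⟨r₁, r₂, r₃, r₄, r₅⟩ := h' x
      by_cases j₀ : j = ⟨a + a, by omega⟩
      · have : ¬ (j : ℕ) < a + a := by rw [j₀]; simp
        have t : (j : ℕ) < a + 1 + (a + 1) := by rw [j₀]; simp; omega
        rw [if_neg this, if_neg this, if_pos t, if_pos t, j₀]
        exact ⟨r₁, r₃⟩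
      by_cases j₁ : j = ⟨a + a + 1, by omega⟩
      · have : ¬ (j : ℕ) < a + a := by rw [j₁]; simp
        have t : (j : ℕ) < a + 1 + (a + 1) := by rw [j₁]; simp; omega
        rw [if_neg this, if_neg this, if_pos t, if_pos t, j₁]
        exact ⟨r₂, r₄⟩
      rw [Fin.ext_iff] at j₀ j₁
      have c₁ : (r *ᵥ x) (Fin.castAdd n j) = x (Fin.castAdd n j) :=
        r₅ _ (by simpa [Fin.ext_iff] using j₀) (by simpa [Fin.ext_iff] using j₁)
          (by simp [Fin.ext_iff]; omega) (by simp [Fin.ext_iff]; omega)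
      have c₂ : (r *ᵥ x) (Fin.natAdd n j) = x (Fin.natAdd n j) :=
        r₅ _ (by simp [Fin.ext_iff]; omega) (by simp [Fin.ext_iff]; omega)
          (by simpa [Fin.ext_iff] using j₀) (by simpa [Fin.ext_iff] using j₁)
      have t : (j : ℕ) < a + 1 + (a + 1) ↔ (j : ℕ) < a + a := by
        simp at j₀ j₁
        omega
      rw [c₁, c₂]
      simp only [t, and_self]
  obtain ⟨c, hc⟩ := hn
  obtain ⟨g, hg, h⟩ := key c hc.ge
  refine ⟨g, hg, fun x j => ?_⟩
  have : (j : ℕ) < c + c := by have := j.2; omega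
  simpa [this] using h x j

end Lifting

/-! ### Injectivity of the symbol. -/

section RelativeIsometry

variable {R : Type u} [CommRing R] {I : Ideal R}

theorem perp_mulVec {A : Type u} [CommRing A] {m n : ℕ} (M : Matrix (Fin m) (Fin m) A)
    (M' : Matrix (Fin n) (Fin n) A) (x : Fin (m + n) → A) :
    (∀ j, (perp M M' *ᵥ x) (Fin.castAdd n j) = (M *ᵥ fun l => x (Fin.castAdd n l)) j) ∧
    ∀ j, (perp M M' *ᵥ x) (Fin.natAdd m j) = (M' *ᵥ fun l => x (Fin.natAdd m l)) j := by
  constructor <;> intro j <;> simp [perp, mulVec, dotProduct, Fin.sum_univ_add]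

theorem map_perp {A : Type u} [CommRing A] {S : Type v} [CommRing S] {m n : ℕ} (f : A →+* S)
    (M : Matrix (Fin m) (Fin m) A) (M' : Matrix (Fin n) (Fin n) A) :
    (perp M M').map f = perp (M.map f) (M'.map f) := by
  ext i j
  simp only [map_apply, perp_apply]
  split_ifs <;> simp

theorem stdEntry_add {A : Type u} [CommRing A] {n : ℕ} (hn : Even n) :
    (of fun i j : Fin n => stdEntry A (i + n) (j + n)) = stdForm A n := by
  ext i j
  have := stdEntry_shift (A := A) hn (i := i + n) (j := j + n) (by omega) (by omega)
  rw [Nat.add_sub_cancel, Nat.add_sub_cancel] at this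
  exact this.symm

theorem map_stdForm {A : Type u} [CommRing A] {S : Type v} [CommRing S] (f : A →+* S) (n : ℕ) :
    (stdForm A n).map f = stdForm S n := by
  ext i j
  simp only [stdForm, map_apply, of_apply, stdEntry]
  split_ifs <;> simp

/-- An elementary equivalence of forms that are standard modulo `0 ⊕ I` can be made relative. -/
theorem exists_relative_isometry {n : ℕ} (hn : Even n) (hn4 : 4 ≤ n)
    {φ φ' : Matrix (Fin 4) (Fin 4) (Exc I)} (hφ' : IsAlt φ')
    (h0 : φ.map (Exc.toInt I) = stdForm ℤ 4) (h0' : φ'.map (Exc.toInt I) = stdForm ℤ 4)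
    {ε : SpecialLinearGroup (Fin n) (Exc I)} (hε : ε ∈ Elem n (Exc I))
    (h : stab φ n = ε.1ᵀ * stab φ' n * ε.1) :
    ∃ η ∈ RelElem (n + n) (Exc.ideal I), η.1ᵀ * stab φ' (n + n) * η.1 = stab φ (n + n) := by
  have hst : ∀ M : Matrix (Fin 4) (Fin 4) (Exc I),
      stab M (n + n) = perp (stab M n) (stdForm _ n) := fun M => by
    rw [← stab_stab hn4, stab_add hn, stdEntry_add hn]
  have hΨ := hφ'.stab (n + n)
  have hπ : (stab φ' (n + n)).map (Exc.toInt I) = stdForm ℤ (n + n) := by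
    rw [map_stab, h0', stab_stdForm]
  -- p is an elementary isometry of the actual form over ℤ ⊕ I; only its reduction to ℤ is the block
  -- rotation.
  obtain ⟨_, ⟨_, ⟨p, hp, rfl⟩, hpi, rfl⟩, hrot⟩ := exists_block_rotation _ hn hΨ hπ
  set g := SpecialLinearGroup.map (Exc.toInt I) ε with hg
  set s := SpecialLinearGroup.map (Int.castRingHom (Exc I)) g with hs
  have hgψ : g.1ᵀ * stdForm ℤ n * g.1 = stdForm ℤ n := by
    have := congrArg (fun M : Matrix (Fin n) (Fin n) (Exc I) => M.map (Exc.toInt I)) h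
    simp only [Matrix.map_mul, map_stab, h0, h0', stab_stdForm] at this
    exact this.symm
  have hsψ : s.1ᵀ * stdForm (Exc I) n * s.1 = stdForm (Exc I) n := by
    have := congrArg (fun M : Matrix (Fin n) (Fin n) ℤ => M.map (Int.castRingHom (Exc I))) hgψ
    simp only [Matrix.map_mul, map_stdForm] at this
    exact this
  have hs_mem : s ∈ Elem n (Exc I) := map_mem_elem n _ (map_mem_elem n _ hε)
  -- On the added summand the form is standard, so the integral part of ε is an isometry there; it
  -- need not be one on the first summand.
  obtain ⟨γ, hγ, hγv⟩ := perp_one_mem (k := n) hs_mem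
  have hγi : IsIsom (stab φ' (n + n)) γ.1 := by
    rw [IsIsom, hγv, hst, perp_transpose, perp_mul, perp_mul, hsψ]
    simp
  have hεs : (stabSL n n _ ε).1ᵀ * stab φ' (n + n) * (stabSL n n _ ε).1 = stab φ (n + n) := by
    change (perp ε.1 1)ᵀ * _ * perp ε.1 1 = _
    rw [hst, hst, perp_transpose, perp_mul, perp_mul, ← h]
    simp
  -- An elementary isometry of the form whose reduction is g ⊥ 1, the same as that of ε ⊥ 1. No
  -- generation theorem for the integral symplectic group is needed.
  set κ := p⁻¹ * γ * p with hκ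
  have hκi : IsIsom (stab φ' (n + n)) (κ⁻¹).1 := by
    refine IsIsom.of_mul_eq_one (g := κ.1) ?_ (coe_mul_inv κ)
    exact ((hpi.of_mul_eq_one (coe_mul_inv p)).mul hγi).mul hpi
  have hκ_mem : κ ∈ Elem (n + n) (Exc I) := mul_mem (mul_mem (inv_mem hp) hγ) hp
  have hcomm : SpecialLinearGroup.map (Exc.toInt I) (γ * p) =
      SpecialLinearGroup.map (Exc.toInt I) (p * stabSL n n _ ε) := by
    rw [map_mul, map_mul]
    apply Subtype.ext
    change γ.1.map (Exc.toInt I) * p.1.map (Exc.toInt I) =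
      p.1.map (Exc.toInt I) * (perp ε.1 1).map (Exc.toInt I)
    have hsg : s.1.map (Exc.toInt I) = g.1 := congrArg Subtype.val (map_toInt_cast g)
    rw [hγv, map_perp, map_perp, hsg, Matrix.map_one _ (map_zero _) (map_one _)]
    change _ = _ * perp g.1 1
    refine ext_of_mulVec_single fun l => ?_
    rw [← mulVec_mulVec, ← mulVec_mulVec]
    generalize (Pi.single l 1 : Fin (n + n) → ℤ) = x
    ext j
    refine Fin.addCases (fun j => ?_) (fun j => ?_) j
    · rw [(perp_mulVec _ _ _).1, one_mulVec, (hrot _ j).1, (hrot _ j).1, (perp_mulVec _ _ _).2,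
        one_mulVec]
    · rw [(perp_mulVec _ _ _).2, (hrot _ j).2, (perp_mulVec _ _ _).1]
      have : (fun l => (p.1.map (Exc.toInt I) *ᵥ x) (Fin.natAdd n l)) =
          -fun l => x (Fin.castAdd n l) := funext fun l => (hrot x l).2
      rw [this, mulVec_neg]
      rfl
  set η := κ⁻¹ * stabSL n n _ ε with hη
  have hη1 : SpecialLinearGroup.map (Exc.toInt I) η = 1 := by
    have : η = (p⁻¹ * γ⁻¹) * (p * stabSL n n _ ε) := by rw [hη, hκ]; group
    rw [this, map_mul, ← hcomm, ← map_mul]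
    have : p⁻¹ * γ⁻¹ * (γ * p) = 1 := by group
    rw [this, map_one]
  refine ⟨η, ?_, ?_⟩
  · have := split_mem_relElem (Exc.retr I) Exc.sub_retr
      (mul_mem (inv_mem hκ_mem) (stabSL_mem_elem n hε))
    have h1 : SpecialLinearGroup.map (Exc.retr I) η = 1 := by
      change SpecialLinearGroup.map (Int.castRingHom (Exc I))
        (SpecialLinearGroup.map (Exc.toInt I) η) = 1
      rw [hη1, map_one]
    rw [← hη, h1, inv_one, mul_one] at this
    exact this
  · change ((κ⁻¹).1 * (stabSL n n _ ε).1)ᵀ * _ * ((κ⁻¹).1 * (stabSL n n _ ε).1) = _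
    rw [transpose_mul]
    calc _ = (stabSL n n _ ε).1ᵀ * ((κ⁻¹).1ᵀ * stab φ' (n + n) * (κ⁻¹).1) *
          (stabSL n n _ ε).1 := by simp only [Matrix.mul_assoc]
      _ = _ := by rw [hκi, hεs]

theorem vmat_mul_vmat {v b : Fin 3 → R} (h : v ⬝ᵥ b = 1) : -vmat b v * vmat v b = 1 := by
  have h' : v 0 * b 0 + v 1 * b 1 + v 2 * b 2 = 1 := by
    simpa [dotProduct, Fin.sum_univ_three] using h
  ext i j
  rw [Matrix.mul_apply, Fin.sum_univ_four]
  fin_cases i <;> fin_cases j <;> simp [vmat] <;>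
    first | ring1 | linear_combination h'

/-- Iterated cancellation. The padded size N stays fixed, so membership in E_N(R, I) is retained
while the matrix itself shrinks to size 4. -/
theorem exists_descent_four (hR : ringKrullDim R < 4) {φ φ' Θ : Matrix (Fin 4) (Fin 4) R}
    (hφ' : IsAlt φ') (hΘ : Θ * φ' = 1) {N : ℕ} (k : ℕ) (hN : 4 + 2 * k ≤ N)
    {ε : Matrix (Fin (4 + 2 * k)) (Fin (4 + 2 * k)) R} (hε : pad ε N ∈ mats (RelElem N I))
    (h : εᵀ * stab φ' (4 + 2 * k) * ε = stab φ (4 + 2 * k)) :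
    ∃ ε' : Matrix (Fin 4) (Fin 4) R, pad ε' N ∈ mats (RelElem N I) ∧ ε'ᵀ * φ' * ε' = φ := by
  have hinv : ∀ k, ∃ Θ' : Matrix (Fin (4 + 2 * k)) (Fin (4 + 2 * k)) R,
      Θ' * stab φ' (4 + 2 * k) = 1 := by
    intro k
    induction k with
    | zero => exact ⟨Θ, by rw [stab_self]; exact hΘ⟩
    | succ k ih =>
      obtain ⟨Θ', h'⟩ := ih
      have := exists_inv_stab (by simp [Nat.even_add]; decide) h'
      rw [stab_stab (by omega)] at this
      exact this
  induction k with
  | zero =>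
    rw [stab_self, stab_self] at h
    exact ⟨ε, hε, h⟩
  | succ k ih =>
    obtain ⟨Θ', hΘ'⟩ := hinv k
    change (ε : Matrix (Fin (4 + 2 * k + 2)) (Fin (4 + 2 * k + 2)) R)ᵀ *
      stab φ' (4 + 2 * k + 2) * ε = stab φ (4 + 2 * k + 2) at h
    rw [← stab_stab (N := 4 + 2 * k) (by omega) φ', ← stab_stab (N := 4 + 2 * k) (by omega) φ] at h
    obtain ⟨ε', h1, h2⟩ := exists_descent (by simp [Nat.even_add]; decide)
      (hR.trans_le (by norm_cast; omega)) (hφ'.stab _) hΘ' hN hε h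
    exact ih (by omega) h1 h2

theorem vmat_inj {v b v' b' : Fin 3 → R} (h : vmat v b = vmat v' b') : v = v' := by
  ext j
  have := congrFun (congrFun h 0) j.succ
  fin_cases j <;> exact this

/-- The only place where SL₄(R, I) ∩ E(R, I) = E₄(R, I) is used: descent yields a 4 × 4 matrix known
merely to be congruent to 1 and stably relative elementary. -/
theorem orb_of_relative_isometry (hR : ringKrullDim R < 4)
    (hE : (RelSL 4 I : Set (SpecialLinearGroup (Fin 4) R)) ∩ StableRelElem 4 I = RelElem 4 I)
    {v b v' b' : Fin 3 → R} (hv' : v' ⬝ᵥ b' = 1) {N : ℕ} (hN : Even N) (hN4 : 4 ≤ N)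
    {ε : SpecialLinearGroup (Fin N) R} (hε : ε ∈ RelElem N I)
    (h : ε.1ᵀ * stab (vmat v' b') N * ε.1 = stab (vmat v b) N) : Orb (RelElem 3 I) v' v := by
  obtain ⟨k, rfl⟩ : ∃ k, N = 4 + 2 * k := by
    obtain ⟨c, rfl⟩ := hN
    exact ⟨c - 2, by omega⟩
  obtain ⟨ε', h1, h2⟩ := exists_descent_four hR (vmat_isAlt v' b') (vmat_mul_vmat hv') k le_rfl
    (ε := ε.1) (by rw [pad_self]; exact ⟨ε, hε, rfl⟩) h
  have hdet := det_of_pad (by omega) h1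
  have hmem : (⟨ε', hdet⟩ : SpecialLinearGroup (Fin 4) R) ∈ RelElem 4 I := by
    change _ ∈ (RelElem 4 I : Set (SpecialLinearGroup (Fin 4) R))
    rw [← hE]
    refine ⟨?_, 2 * k, ?_⟩
    · change SpecialLinearGroup.map (Ideal.Quotient.mk I) _ = 1
      apply Subtype.ext
      ext i j
      have := sub_one_mem_of_pad (by omega) h1 i j
      change Ideal.Quotient.mk I (ε' i j) = (1 : Matrix (Fin 4) (Fin 4) (R ⧸ I)) i j
      rw [Ideal.Quotient.eq.2 this, one_apply, one_apply]
      split_ifs <;> simp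
    · rw [pad_add] at h1
      obtain ⟨a, ha, hav⟩ := h1
      have : stabSL 4 (2 * k) R ⟨ε', hdet⟩ = a := Subtype.ext hav.symm
      rw [this]
      exact ha
  obtain ⟨v'', b'', h3, -, h5⟩ := rowStable_of_mem hmem v' b' hv'
  have h6 := h3.symm.trans h2
  rwa [vmat_inj h6] at h5

theorem map_vmat {S : Type v} [CommRing S] (f : R →+* S) (a b : Fin 3 → R) :
    (vmat a b).map f = vmat (f ∘ a) (f ∘ b) := by
  ext i j
  fin_cases i <;> fin_cases j <;> simp [vmat]

theorem vmat_toInt {a b : Fin 3 → Exc I} (ha : Congr (Exc.ideal I) a)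
    (hb : Congr (Exc.ideal I) b) : (vmat a b).map (Exc.toInt I) = stdForm ℤ 4 := by
  rw [congr_iff_toInt] at ha hb
  rw [map_vmat, ha, hb]
  ext i j
  fin_cases i <;> fin_cases j <;> simp [vmat, stdForm, stdEntry, e]

/-- The symbol is injective on orbits. -/
theorem orb_of_mk_vaserstein_eq (hR : ringKrullDim R < 4)
    (hE : (RelSL 4 I : Set (SpecialLinearGroup (Fin 4) R)) ∩ StableRelElem 4 I = RelElem 4 I)
    {a b a' b' : Fin 3 → Exc I} (h : a ⬝ᵥ b = 1) (h' : a' ⬝ᵥ b' = 1)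
    (hm : WE.mk (vaserstein a b h) = WE.mk (vaserstein a' b' h')) :
    Orb (Elem 3 (Exc I)) a a' := by
  obtain ⟨c, o, hc⟩ := exists_orb_congr (by norm_num) ⟨b, h⟩
  obtain ⟨c', o', hc'⟩ := exists_orb_congr (by norm_num) ⟨b', h'⟩
  have uc := o.isUnimodular ⟨b, h⟩
  have uc' := o'.isUnimodular ⟨b', h'⟩
  obtain ⟨d, hd, hdc⟩ := exists_congr_dual uc hc
  obtain ⟨d', hd', hdc'⟩ := exists_congr_dual uc' hc'
  rw [mk_vaserstein_eq h hd o, mk_vaserstein_eq h' hd' o', WE.mk_eq] at hm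
  obtain ⟨n, hn, hn4, -, ε, hε, hst⟩ := hm
  obtain ⟨η, hη, hηst⟩ := exists_relative_isometry hn hn4 (vmat_isAlt c' d')
    (vmat_toInt hc hdc) (vmat_toInt hc' hdc') hε hst
  -- The relative isometry is pushed to R, where the dimension bound and the hypothesis on E₄ live;
  -- injectivity of F brings the conclusion back.
  have hst' := congrArg (fun M : Matrix (Fin (n + n)) (Fin (n + n)) (Exc I) =>
    M.map (Exc.toRing I)) hηst
  simp only [Matrix.map_mul, map_stab, map_vmat] at hst'
  have hdot : (Exc.toRing I ∘ c') ⬝ᵥ (Exc.toRing I ∘ d') = 1 := by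
    have := congrArg (Exc.toRing I) hd'
    rw [map_one] at this
    rw [← this]
    simp [dotProduct]
  have h1 := orb_of_relative_isometry hR hE hdot (hn.add hn) (by
    have : 4 ≤ n := hn4
    omega) (map_mem_relElem _ _ (Exc.le_comap I) hη) hst'
  have h2 : Quotient.mk (orbitSetoid 3 (Exc.ideal I)) ⟨c', uc', hc'⟩ =
      Quotient.mk (orbitSetoid 3 (Exc.ideal I)) ⟨c, uc, hc⟩ :=
    (Exc.F_bijective le_rfl I).1 (mk_eq_mk_iff.2 h1)
  exact o.trans (((mk_eq_mk_iff.1 h2).mono relElem_le_elem).symm.trans o'.symm)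

end RelativeIsometry

/-! ### The symbol as a map of orbit sets. -/

section Symbol

variable {R : Type u} [CommRing R] {I : Ideal R}

/-- The Vaserstein symbol. -/
noncomputable def symbol (A : Type u) [CommRing A] : MSE 3 (⊤ : Ideal A) → WE A :=
  Quotient.lift (fun v : Um 3 (⊤ : Ideal A) => WE.mk (vaserstein v.1 v.2.1.choose v.2.1.choose_spec))
    (by
      rintro v w ⟨g, hg, h⟩
      rw [relElem_top] at hg
      exact mk_vaserstein_eq _ _ ⟨_, ⟨g, hg, rfl⟩, h⟩)

theorem symbol_absClass {A : Type u} [CommRing A] {a b : Fin 3 → A} (h : a ⬝ᵥ b = 1) :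
    symbol A (absClass a ⟨b, h⟩) = WE.mk (vaserstein a b h) :=
  mk_vaserstein_eq _ _ (Orb.refl a)

theorem exists_eq_vaserstein (hR : ringKrullDim R < 4) (x : WE (Exc I)) :
    ∃ (a b : Fin 3 → Exc I) (h : a ⬝ᵥ b = 1), x = WE.mk (vaserstein a b h) := by
  induction x using Quotient.inductionOn with | _ φ
  have H : ∀ n, 4 ≤ n → ∀ v : Fin (n + 1) → Exc I, IsUnimodular v →
      Orb (Elem (n + 1) (Exc I)) v (e 0) := by
    intro n hn v hv
    have : NeZero n := ⟨by omega⟩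
    exact orb_exc_e (hR.trans_le (by exact_mod_cast hn)) hv
  obtain ⟨a, b, h, hab⟩ := exists_vmat H φ.size φ.even φ.mat φ.isAlt φ.pf_eq
  exact ⟨a, b, h, WE.mk_eq.2 hab⟩

theorem symbol_bijective (hR : ringKrullDim R < 4)
    (hE : (RelSL 4 I : Set (SpecialLinearGroup (Fin 4) R)) ∩ StableRelElem 4 I = RelElem 4 I) :
    Function.Bijective (symbol (Exc I)) := by
  constructor
  · rintro ⟨v⟩ ⟨w⟩ h
    have := orb_of_mk_vaserstein_eq hR hE v.2.1.choose_spec w.2.1.choose_spec h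
    rw [← relElem_top] at this
    exact mk_eq_mk_iff.2 this
  · intro x
    obtain ⟨a, b, h, rfl⟩ := exists_eq_vaserstein hR x
    exact ⟨_, symbol_absClass h⟩

theorem symbol_mul {A : Type u} [CommRing A] {a b c d p : A} (hv : IsUnimodular ![a, c, d])
    (hw : IsUnimodular ![b, c, d]) (hp : a * p - 1 ∈ Ideal.span {c, d}) :
    ∃ h : IsUnimodular ![a * (b + p) - 1, c * (b + p), d],
      symbol A (absClass _ hw) * symbol A (absClass _ hv) = symbol A (absClass _ h) := by
  obtain ⟨s, t, hst⟩ := Ideal.mem_span_pair.1 hp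
  obtain ⟨bv, hv⟩ := hv
  obtain ⟨bw, hw⟩ := hw
  obtain ⟨u, hu, h⟩ := mk_vaserstein_mul (p := p) (c' := -s) (d' := -t)
    (by linear_combination -hst) hw hv
  refine ⟨⟨u, hu⟩, ?_⟩
  rw [symbol_absClass hw, symbol_absClass hv, symbol_absClass hu, h]

end Symbol

end WittOrbit

theorem mainTheorem9 {R : Type*} [CommRing R] (I : Ideal R) (hdim : ringKrullDim R = 3)
    (hE : (WittOrbit.RelSL 4 I : Set (Matrix.SpecialLinearGroup (Fin 4) R)) ∩
      WittOrbit.StableRelElem 4 I = WittOrbit.RelElem 4 I) :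
    ∃ (_ : CommGroup (WittOrbit.MSE 3 I))
      (hF : Function.Bijective (WittOrbit.Exc.F 3 I))
      (hG : Function.Bijective (WittOrbit.Exc.G 3 I)),
      WittOrbit.IsVvRule (fun x y => WittOrbit.Exc.equiv hF hG
        ((WittOrbit.Exc.equiv hF hG).symm x * (WittOrbit.Exc.equiv hF hG).symm y)) ∧
      ∃ V : WittOrbit.MSE 3 I ≃* WittOrbit.WE (WittOrbit.Exc I),
        ∀ (a b : Fin 3 → WittOrbit.Exc I) (h : a ⬝ᵥ b = 1),
          V ((WittOrbit.Exc.equiv hF hG).symm (WittOrbit.absClass a ⟨b, h⟩)) =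
            WittOrbit.WE.mk (WittOrbit.vaserstein a b h) := by
  have hR : ringKrullDim R < 4 := by
    rw [hdim]
    exact_mod_cast (by norm_num : (3 : ℕ) < 4)
  have hF := WittOrbit.Exc.F_bijective le_rfl I
  have hG := WittOrbit.Exc.G_bijective I
  let _ : CommGroup (WittOrbit.WE (WittOrbit.Exc I)) :=
    WittOrbit.weCommGroup (WittOrbit.exists_eq_vaserstein hR)
  let E := WittOrbit.Exc.equiv hF hG
  let σ := Equiv.ofBijective _ (WittOrbit.symbol_bijective hR hE)
  -- The group structure is pulled back along this bijection, so the symbol is an isomorphism by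
  -- construction, and the rule holds because it holds in the Witt group.
  let Φ := E.trans σ
  let _ : CommGroup (WittOrbit.MSE 3 I) := Φ.commGroup
  refine ⟨inferInstance, hF, hG, ?_, Φ.mulEquiv, fun a b h => ?_⟩
  · intro a b c d p hv hw hp
    obtain ⟨h, hm⟩ := WittOrbit.symbol_mul hv hw hp
    refine ⟨h, σ.injective ?_⟩
    change Φ (E.symm _ * E.symm _) = _
    have hmul : ∀ x y, Φ (x * y) = Φ x * Φ y := Φ.mulEquiv.map_mul
    rw [hmul]
    change σ (E (E.symm _)) * σ (E (E.symm _)) = _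
    rw [E.apply_symm_apply, E.apply_symm_apply]
    exact hm
  · change σ (E (E.symm _)) = _
    rw [E.apply_symm_apply]
    exact WittOrbit.symbol_absClass h
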